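/- Let $M$ be a compact smooth $7$-manifold without boundary, and let $\varphi_0=e^{123}+e^{145}+e^{167}+e^{246}-e^{257}-e^{347}-e^{356}$ be the standard $3$-form on $\mathbb R^7$, whose stabiliser in $\mathrm{GL}(7)$ is $\mathrm G_2\subset \mathrm{SO}(7)$. A smooth $3$-form $\Omega$ on $M$ is *positive* if for every $x\in M$ there is a linear isomorphism $f\colon T_xM\to\mathbb R^7$ with $\Omega_x=f^*\varphi_0$; it induces the Riemannian metric $g_\Omega$ given at $x$ by $f^*\langle\cdot,\cdot\rangle$ (and an orientation of $M$), with volume form $\mathrm{vol}_\Omega$, norms $|\cdot|_\Omega$ on forms, Levi-Civita connection $\nabla^\Omega$ and codifferential $\delta_\Omega$. Call $\Omega$ *torsion-free* if $\nabla^\Omega\Omega=0$. Let $$\mathcal H(\Omega)=\int_M \mathrm{vol}_\Omega,\qquad \mathcal D(\Omega)=\frac12\int_M\bigl(|d\Omega|_\Omega^2+|\delta_\Omega\Omega|_\Omega^2\bigr)\,\mathrm{vol}_\Omega$$ be the Hitchin functional and the Dirichlet energy, and let $Q(\Omega)=-\mathrm{grad}\,\mathcal D(\Omega)$ be the negative $L^2$-gradient,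 i.e. the smooth $3$-form such that $$\frac{d}{ds}\Big|_{s=0}\mathcal D(\Omega+s\eta)=-\int_M g_\Omega(Q(\Omega),\eta)\,\mathrm{vol}_\Omega$$ for all smooth $3$-forms $\eta$. Let $T\in(0,\infty]$ and let $(\Omega_t)_{t\in[0,T)}$ be a family of positive $3$-forms, smooth on $[0,T)\times M$, which solves the Dirichlet energy flow $\partial_t\Omega_t=Q(\Omega_t)$. Then $t\mapsto\mathcal H(\Omega_t)$ is twice differentiable on $[0,T)$ (with one-sided derivatives at $t=0$), and for all $t\in[0,T)$ $$\frac{d}{dt}\mathcal H(\Omega_t)=-\frac59\,\mathcal D(\Omega_t)\le 0,\qquad \frac{d^2}{dt^2}\mathcal H(\Omega_t)\ge 0 .$$ In particular $\mathcal H(\Omega_t)$ is non-increasing and convex in $t$. Moreover, for $t_0\in[0,T)$, $\frac{d}{dt}\big|_{t=t_0}\mathcal H(\Omega_t)=0$ if and only if $\Omega_{t_0}$ is torsion-free. -/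

import Mathlib

open Set MeasureTheory
open scoped Manifold ContDiff

namespace G2Flow

noncomputable section

/-! ### Linear algebra of positive 3-forms on a seven-dimensional space -/

/-- The model space `ℝ⁷` with its Euclidean inner product. -/
abbrev E7 : Type := EuclideanSpace ℝ (Fin 7)

/-- The standard basis of `ℝ⁷`. -/
def stdVec (i : Fin 7) : E7 := EuclideanSpace.single i 1

/-- The alternating form `e^i ∧ e^j ∧ e^k` on `ℝ⁷`. -/
def dualWedge (i j k : Fin 7) : E7 [⋀^Fin 3]→L[ℝ] ℝ :=
  { (Matrix.detRowAlternating (R := ℝ) (n := Fin 3)).compLinearMap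
      (LinearMap.pi fun b : Fin 3 => (EuclideanSpace.proj (![i, j, k] b) : E7 →L[ℝ] ℝ).toLinearMap)
    with
    cont := by
      change Continuous fun v : Fin 3 → E7 =>
        Matrix.det (Matrix.of fun a b : Fin 3 => v a (![i, j, k] b))
      exact Continuous.matrix_det (by fun_prop) }

/-- The standard `G₂`-invariant 3-form
`e¹²³ + e¹⁴⁵ + e¹⁶⁷ + e²⁴⁶ - e²⁵⁷ - e³⁴⁷ - e³⁵⁶` on `ℝ⁷` (indices shifted by one). Its stabiliser
in `GL(7)` is `G₂ ⊂ SO(7)`. -/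
def stdForm : E7 [⋀^Fin 3]→L[ℝ] ℝ :=
  dualWedge 0 1 2 + dualWedge 0 3 4 + dualWedge 0 5 6 + dualWedge 1 3 5
    - dualWedge 1 4 6 - dualWedge 2 3 6 - dualWedge 2 4 5

/-- `f : V ≃ ℝ⁷` is a `G₂`-coframe for the 3-form `α` if `α = f^* stdForm`. -/
def IsCoframe {V : Type*} [AddCommGroup V] [Module ℝ V] [TopologicalSpace V]
    (α : V [⋀^Fin 3]→L[ℝ] ℝ) (f : V ≃L[ℝ] E7) : Prop :=
  stdForm.compContinuousLinearMap (f : V →L[ℝ] E7) = α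

/-- Positive 3-forms: those which are equivalent to `stdForm` under a linear isomorphism `V ≃ ℝ⁷`.
Such an `α` orients `V` (its coframes all induce the same orientation). -/
def IsPositive {V : Type*} [AddCommGroup V] [Module ℝ V] [TopologicalSpace V]
    (α : V [⋀^Fin 3]→L[ℝ] ℝ) : Prop :=
  ∃ f : V ≃L[ℝ] E7, IsCoframe α f

open Classical in
/-- The Gram matrix `g_α(eᵢ, eⱼ)` of the inner product `g_α = f^* ⟪·,·⟫` induced by a positive form
`α = f^* stdForm`; it does not depend on `f` because `G₂ ⊂ SO(7)`. (Zero if `α` is not positive.) -/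
def gram (α : E7 [⋀^Fin 3]→L[ℝ] ℝ) : Matrix (Fin 7) (Fin 7) ℝ :=
  if h : IsPositive α then
    Matrix.of fun i j => inner ℝ (h.choose (stdVec i)) (h.choose (stdVec j))
  else 0

/-- Components of an alternating `k`-form on `ℝ⁷`. -/
def comps {k : ℕ} (α : E7 [⋀^Fin k]→L[ℝ] ℝ) : (Fin k → Fin 7) → ℝ :=
  fun I => α fun a => stdVec (I a)

/-- The inner product of `k`-forms, given by their components, with respect to the metric with
Gram matrix `G`: `(1/k!) ∑ g^{i₁j₁} ⋯ g^{iₖjₖ} α_{i₁…iₖ} β_{j₁…jₖ}`. -/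
def formInner {k : ℕ} (G : Matrix (Fin 7) (Fin 7) ℝ) (α β : (Fin k → Fin 7) → ℝ) : ℝ :=
  (k.factorial : ℝ)⁻¹ *
    ∑ I : Fin k → Fin 7, ∑ J : Fin k → Fin 7, (∏ a, G⁻¹ (I a) (J a)) * α I * β J

/-! ### Local expressions, for a 3-form `w` on (an open subset of) `ℝ⁷` -/

/-- Partial derivative `∂ᵢ u (y)`. -/
def pd (u : E7 → ℝ) (y : E7) (i : Fin 7) : ℝ := fderiv ℝ u y (stdVec i)

/-- Christoffel symbol `Γ^k_{ij}` of the Levi-Civita connection of `g_w`. -/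
def christoffel (w : E7 → E7 [⋀^Fin 3]→L[ℝ] ℝ) (y : E7) (k i j : Fin 7) : ℝ :=
  (1 / 2) * ∑ l, (gram (w y))⁻¹ k l *
    (pd (fun z => gram (w z) j l) y i + pd (fun z => gram (w z) i l) y j
      - pd (fun z => gram (w z) i j) y l)

/-- Components `(∇ᵢ w)_I` of the covariant derivative of `w` with respect to the Levi-Civita
connection of `g_w`. -/
def nabla (w : E7 → E7 [⋀^Fin 3]→L[ℝ] ℝ) (y : E7) (i : Fin 7) (I : Fin 3 → Fin 7) : ℝ :=
  pd (fun z => comps (w z) I) y i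
    - ∑ a : Fin 3, ∑ l, christoffel w y l i (I a) * comps (w y) (Function.update I a l)

/-- Components of the codifferential `δ_w w`, with
`(δ_w w)(X, Y) = - tr_{g_w} (∇ w) (·, ·, X, Y)`. -/
def codiff (w : E7 → E7 [⋀^Fin 3]→L[ℝ] ℝ) (y : E7) (J : Fin 2 → Fin 7) : ℝ :=
  - ∑ i, ∑ l, (gram (w y))⁻¹ i l * nabla w y i (Fin.cons l J)

/-- `|dw|² + |δ_w w|²` at `y`. -/
def torsionSq (w : E7 → E7 [⋀^Fin 3]→L[ℝ] ℝ) (y : E7) : ℝ :=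
  formInner (gram (w y)) (comps (extDeriv w y)) (comps (extDeriv w y))
    + formInner (gram (w y)) (codiff w y) (codiff w y)

/-! ### 3-forms on a seven-dimensional manifold -/

section Manifold

variable (M : Type*) [TopologicalSpace M] [ChartedSpace E7 M]

/-- (Not necessarily smooth) 3-forms on `M`. -/
abbrev ThreeForm := ∀ x : M, TangentSpace 𝓘(ℝ, E7) x [⋀^Fin 3]→L[ℝ] ℝ

variable {M}

/-- The expression of a 3-form in a chart `e`: its pullback under `e⁻¹`. -/
def inChart (e : OpenPartialHomeomorph M E7) (α : ThreeForm M) (y : E7) : E7 [⋀^Fin 3]→L[ℝ] ℝ :=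
  (α (e.symm y)).compContinuousLinearMap
    ((mfderiv 𝓘(ℝ, E7) 𝓘(ℝ, E7) e.symm y).comp
      ((NormedSpace.fromTangentSpace (𝕜 := ℝ) y).symm : E7 →L[ℝ] TangentSpace 𝓘(ℝ, E7) y))

/-- Smooth 3-forms. -/
def IsSmooth (α : ThreeForm M) : Prop :=
  ∀ e ∈ atlas E7 M, ContDiffOn ℝ ∞ (inChart e α) e.target

/-- `Ω` is torsion-free: `∇^Ω Ω = 0` for the Levi-Civita connection `∇^Ω` of `g_Ω`. -/
def IsTorsionFree (Ω : ThreeForm M) : Prop :=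
  ∀ e ∈ atlas E7 M, ∀ y ∈ e.target, ∀ i I, nabla (inChart e Ω) y i I = 0

variable [CompactSpace M] [T2Space M] [IsManifold 𝓘(ℝ, E7) ∞ M]

variable (M) in
/-- A smooth partition of unity on `M`, indexed by the points of `M`, with the support of the
`p`-th function inside the domain of the chart at `p`. -/
def partition : SmoothPartitionOfUnity M 𝓘(ℝ, E7) M univ :=
  (SmoothPartitionOfUnity.exists_isSubordinate_chartAt_source 𝓘(ℝ, E7) M).choose

/-- `∫_M F vol_Ω` for a function `F` on `M` given by its local expressions `F e` in the charts `e`,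
where `vol_Ω = √det g_Ω |dy|` is the Riemannian volume of `g_Ω`. -/
def volIntegral (Ω : ThreeForm M) (F : OpenPartialHomeomorph M E7 → E7 → ℝ) : ℝ :=
  ∑ᶠ p : M, ∫ y in (chartAt E7 p).target,
    partition M p ((chartAt E7 p).symm y) * F (chartAt E7 p) y *
      √(gram (inChart (chartAt E7 p) Ω y)).det

/-- The Hitchin functional `ℋ(Ω) = ∫_M vol_Ω`. -/
def hitchin (Ω : ThreeForm M) : ℝ := volIntegral Ω fun _ _ => 1

/-- The Dirichlet energy `𝒟(Ω) = ½ ∫_M (|dΩ|² + |δ_Ω Ω|²) vol_Ω`. -/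
def dirichlet (Ω : ThreeForm M) : ℝ :=
  (1 / 2) * volIntegral Ω fun e y => torsionSq (inChart e Ω) y

/-- The `L²` inner product `⟨α, β⟩_Ω = ∫_M g_Ω(α, β) vol_Ω` of 3-forms. -/
def l2Inner (Ω α β : ThreeForm M) : ℝ :=
  volIntegral Ω fun e y =>
    formInner (gram (inChart e Ω y)) (comps (inChart e α y)) (comps (inChart e β y))

/-- `Q` is the negative `L²`-gradient of `𝒟` at `Ω`: it is a smooth 3-form with
`D_Ω 𝒟 (η) = - ⟨Q, η⟩_Ω` for all smooth 3-forms `η`. -/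
def IsNegGradient (Ω Q : ThreeForm M) : Prop :=
  IsSmooth Q ∧ ∀ η : ThreeForm M, IsSmooth η →
    HasDerivAt (fun s : ℝ => dirichlet (Ω + s • η)) (-l2Inner Ω Q η) 0

/-- The time interval `[0, T)`, where `T` may be `∞`. -/
def timeInterval (T : EReal) : Set ℝ := {t | 0 ≤ t ∧ (t : EReal) < T}

/-- `(Ω_t)` is a solution of the Dirichlet energy flow `∂_t Ω_t = - grad 𝒟(Ω_t)` on `[0, T)`: a
family of positive 3-forms, smooth on `[0, T) × M`, which satisfies the flow equation. -/
structure IsDirichletFlow (T : EReal) (Ω : ℝ → ThreeForm M) : Prop where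
  smooth : ∀ e ∈ atlas E7 M,
    ContDiffOn ℝ ∞ (fun q : ℝ × E7 => inChart e (Ω q.1) q.2) (timeInterval T ×ˢ e.target)
  positive : ∀ t ∈ timeInterval T, ∀ x, IsPositive (Ω t x)
  flow : ∀ t ∈ timeInterval T, ∃ Q : ThreeForm M, IsNegGradient (Ω t) Q ∧
    ∀ x v, HasDerivWithinAt (fun s => Ω s x v) (Q x v) (timeInterval T) t

end Manifold

end

end G2Flow

/-! Two first variations carry the theorem. Infinitesimally, any 3-form `β` at a positive `Ω` is `B
· Ω` for an endomorphism `B`; the volume form then varies by the factor `tr B`, while `⟨Ω, β⟩ = 3 tr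
B`. Hence the derivative of `ℋ` at `Ω` in the direction `η` is `⅓⟨Ω, η⟩` (`fderiv_volDensity`,
`jetVariation_volDensity`). On the other hand, replacing `Ω` by `r³Ω` multiplies the metric by `r²`
and `𝒟` by `r⁵`, so `𝒟` is homogeneous of degree `5/3` and Euler's formula gives `D𝒟(Ω) = 5/3 𝒟`
(`jetVariation_dirichletDensity_self`). Since `D𝒟 = -⟨Q, ·⟩`, along the flow `dℋ/dt = ⅓⟨Ω, Q⟩ = -5/9
𝒟`. The flow is a gradient flow, so `d𝒟/dt = -‖Q‖²` and `d²ℋ/dt² = 5/9 ‖Q‖² ≥ 0`.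

The equality case is `𝒟 = 0`. The density is nonnegative and continuous, so `dΩ` and `δΩ` vanish,
and by Fernández–Gray this forces `∇Ω = 0` (`torsionJet_eq_zero_iff`): `∇Ω` is skew-endomorphism
valued, hence given by a 7×7 matrix, and its alternating part and its trace determine that matrix.
Naturality of the connection under pullback moves the conclusion from one chart to another.

Three foundations are needed. The metric must not depend on the coframe, which is the inclusion of
the stabiliser of `stdForm` in `O(7)` (`mat_transpose_mul_self`). It must depend smoothly on the
form, which follows from a smooth local section of the orbit map (`exists_section`). Finally, both
functionals are written as integrals, over compact chart supports, of smooth functions of the 1-jet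
of `Ω`, so that one formula (`hasDerivWithinAt_jetIntegral`) differentiates both of them, along the
flow and along lines `Ω + sη`. -/

namespace G2Flow

noncomputable section

open scoped Matrix Topology

/-! ### Matrices of endomorphisms of `ℝ⁷` and 3-forms -/

/-- The space of alternating 3-forms on `ℝ⁷`. -/
abbrev Form3 : Type := E7 [⋀^Fin 3]→L[ℝ] ℝ

lemma stdVec_apply (i j : Fin 7) : stdVec i j = if j = i then 1 else 0 := by
  simp [stdVec]

lemma sum_smul_stdVec (x : E7) : ∑ i, x i • stdVec i = x := by
  ext j
  simp [stdVec_apply]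

/-- The matrix of an endomorphism of `ℝ⁷`. -/
def mat (f : E7 →L[ℝ] E7) : Matrix (Fin 7) (Fin 7) ℝ := Matrix.of fun i j => f (stdVec j) i

/-- The endomorphism of `ℝ⁷` with a given matrix. -/
def ofMat (A : Matrix (Fin 7) (Fin 7) ℝ) : E7 →L[ℝ] E7 :=
  LinearMap.toContinuousLinearMap (Matrix.toEuclideanLin A)

lemma ofMat_apply (A : Matrix (Fin 7) (Fin 7) ℝ) (x : E7) (i : Fin 7) :
    ofMat A x i = ∑ j, A i j * x j := by
  simp [ofMat, Matrix.toEuclideanLin, Matrix.mulVec, dotProduct]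

lemma apply_eq_sum_mat (f : E7 →L[ℝ] E7) (x : E7) (i : Fin 7) :
    f x i = ∑ j, mat f i j * x j := by
  conv_lhs => rw [← sum_smul_stdVec x]
  simp [mat, mul_comm]

lemma mat_ofMat (A : Matrix (Fin 7) (Fin 7) ℝ) : mat (ofMat A) = A := by
  ext i j
  simp [mat, ofMat_apply, stdVec_apply]

lemma mat_comp (f g : E7 →L[ℝ] E7) : mat (f.comp g) = mat f * mat g := by
  ext i j
  simp only [Matrix.mul_apply]
  exact apply_eq_sum_mat f (g (stdVec j)) i

lemma mat_id : mat (ContinuousLinearMap.id ℝ E7) = 1 := by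
  ext i j
  simp [mat, stdVec_apply, Matrix.one_apply]

lemma mat_add (f g : E7 →L[ℝ] E7) : mat (f + g) = mat f + mat g := rfl

lemma mat_smul (c : ℝ) (f : E7 →L[ℝ] E7) : mat (c • f) = c • mat f := rfl

lemma ofMat_mat (f : E7 →L[ℝ] E7) : ofMat (mat f) = f := by
  ext x i
  rw [ofMat_apply, apply_eq_sum_mat]

lemma inner_eq_sum (x y : E7) : inner ℝ x y = ∑ i, x i * y i := by
  simp [PiLp.inner_apply, mul_comm]

lemma mat_equiv_mul_symm (f : E7 ≃L[ℝ] E7) :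
    mat (f : E7 →L[ℝ] E7) * mat (f.symm : E7 →L[ℝ] E7) = 1 := by
  rw [← mat_comp, f.coe_comp_coe_symm, mat_id]

lemma mat_symm_mul_equiv (f : E7 ≃L[ℝ] E7) :
    mat (f.symm : E7 →L[ℝ] E7) * mat (f : E7 →L[ℝ] E7) = 1 := by
  rw [← mat_comp, f.coe_symm_comp_coe, mat_id]

/-! ### The structure constants of the standard form -/

/-- `third i j` is the index `k` for which `{i, j, k}` is a line of the Fano plane. -/
def third : Fin 7 → Fin 7 → Fin 7 :=
  ![![0, 2, 1, 4, 3, 6, 5], ![2, 1, 0, 5, 6, 3, 4], ![1, 0, 2, 6, 5, 4, 3],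
    ![4, 5, 6, 3, 0, 1, 2], ![3, 6, 5, 0, 4, 2, 1], ![6, 3, 4, 1, 2, 5, 0],
    ![5, 4, 3, 2, 1, 0, 6]]

/-- The coefficient of `e^{third i j} ∧ e^i ∧ e^j` in the standard form. -/
def fanoSign : Fin 7 → Fin 7 → ℤ :=
  ![![0, 1, -1, 1, -1, 1, -1], ![-1, 0, 1, 1, -1, -1, 1], ![1, -1, 0, -1, -1, 1, 1],
    ![-1, -1, 1, 0, 1, 1, -1], ![1, 1, 1, -1, 0, -1, -1], ![-1, 1, -1, -1, 1, 0, 1],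
    ![1, -1, -1, 1, 1, -1, 0]]

lemma dualWedge_apply (i j k : Fin 7) (x y z : E7) : dualWedge i j k ![x, y, z] =
    x i * y j * z k - x i * y k * z j - x j * y i * z k + x j * y k * z i + x k * y i * z j
      - x k * y j * z i := by
  change Matrix.det (Matrix.of fun a b : Fin 3 => (![x, y, z] a) (![i, j, k] b)) = _
  simp [Matrix.det_fin_three]

lemma stdForm_apply (x y z : E7) : stdForm ![x, y, z] =
    ∑ i, ∑ j, fanoSign i j * x (third i j) * y i * z j := by
  simp only [stdForm, ContinuousAlternatingMap.add_apply, ContinuousAlternatingMap.sub_apply,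
    dualWedge_apply]
  simp [Fin.sum_univ_seven, fanoSign, third]
  ring

/-- The matrix of the 2-form `x ⌟ stdForm`. -/
def crossMat (x : Fin 7 → ℝ) : Matrix (Fin 7) (Fin 7) ℝ :=
  Matrix.of fun i j => fanoSign i j * x (third i j)

lemma stdForm_apply_eq_dotProduct (x y z : E7) :
    stdForm ![x, y, z] = y.ofLp ⬝ᵥ crossMat x.ofLp *ᵥ z.ofLp := by
  rw [stdForm_apply]
  simp only [dotProduct, Matrix.mulVec, crossMat, Finset.mul_sum, Matrix.of_apply]
  exact Finset.sum_congr rfl fun i _ => Finset.sum_congr rfl fun j _ => by ring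

lemma crossMat_transpose (x : Fin 7 → ℝ) : (crossMat x)ᵀ = -crossMat x := by
  have h1 : ∀ i j, third i j = third j i := by decide
  have h2 : ∀ i j, fanoSign i j = -fanoSign j i := by decide
  ext i j
  simp only [crossMat, Matrix.transpose_apply, Matrix.of_apply, Matrix.neg_apply]
  rw [h1, h2]
  push_cast
  ring

/-- This is the octonionic identity `x × (x × y) = -|x|² y + ⟨x, y⟩ x`. It is how the Euclidean
metric is recovered from the 3-form. -/
lemma crossMat_mul_self (x : Fin 7 → ℝ) :
    crossMat x * crossMat x = -(x ⬝ᵥ x) • (1 : Matrix (Fin 7) (Fin 7) ℝ) + Matrix.vecMulVec x x := by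
  ext i j
  simp only [Matrix.mul_apply, crossMat, Matrix.of_apply, Matrix.add_apply, Matrix.smul_apply,
    Matrix.vecMulVec_apply, dotProduct, Fin.sum_univ_seven]
  fin_cases i <;> fin_cases j <;> simp [fanoSign, third] <;> ring

lemma crossMat_mulVec_self (x : Fin 7 → ℝ) : crossMat x *ᵥ x = 0 := by
  ext i
  simp only [Matrix.mulVec, dotProduct, crossMat, Matrix.of_apply, Fin.sum_univ_seven]
  fin_cases i <;> simp [fanoSign, third] <;> ring

lemma dotProduct_self_pos {x : Fin 7 → ℝ} (hx : x ≠ 0) : 0 < x ⬝ᵥ x :=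
  lt_of_le_of_ne (Finset.sum_nonneg fun i _ => mul_self_nonneg (x i))
    fun h => hx (dotProduct_self_eq_zero.1 h.symm)

/-- `crossMat x` is singular along `x`, so a rank-one term is added to make the determinant detect
`|x|`. The matrix times its transpose is `|x|²` times a rank-one perturbation of the identity.
Squaring discards the sign of the determinant. -/
lemma det_crossMat_add_sq {x : Fin 7 → ℝ} (hx : x ≠ 0) (t : ℝ) :
    (crossMat x + t • Matrix.vecMulVec x x).det ^ 2 = t ^ 2 * (x ⬝ᵥ x) ^ 8 := by
  have hr := dotProduct_self_pos hx
  set r := x ⬝ᵥ x with hr_def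
  have hN : (crossMat x + t • Matrix.vecMulVec x x) * (crossMat x + t • Matrix.vecMulVec x x)ᵀ
      = r • (1 + Matrix.vecMulVec ((t ^ 2 - r⁻¹) • x) x) := by
    have h0 : crossMat x * Matrix.vecMulVec x x = 0 := by
      rw [Matrix.mul_vecMulVec, crossMat_mulVec_self, Matrix.zero_vecMulVec]
    have h1 : Matrix.vecMulVec x x * crossMat x = 0 := by
      have := congrArg Matrix.transpose h0
      simpa [Matrix.transpose_mul, Matrix.transpose_vecMulVec, crossMat_transpose] using this
    have h2 : Matrix.vecMulVec x x * Matrix.vecMulVec x x = r • Matrix.vecMulVec x x := by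
      rw [Matrix.vecMulVec_mul_vecMulVec, Matrix.vecMulVec_smul]
    have h3 : r * (t ^ 2 - r⁻¹) = t ^ 2 * r - 1 := by field_simp
    simp only [Matrix.transpose_add, Matrix.transpose_smul, Matrix.transpose_vecMulVec,
      crossMat_transpose, mul_add, add_mul, smul_mul_assoc, mul_smul_comm, h0, h1, h2, mul_neg,
      crossMat_mul_self, Matrix.smul_vecMulVec, smul_smul, smul_add, h3]
    module
  have hdet := congrArg Matrix.det hN
  rw [Matrix.det_mul, Matrix.det_transpose, Matrix.det_smul, Matrix.vecMulVec_eq Unit (_ • x) x,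
    Matrix.det_one_add_replicateCol_mul_replicateRow, ← pow_two] at hdet
  rw [hdet]
  simp only [dotProduct_smul, ← hr_def, smul_eq_mul, Fintype.card_fin]
  field_simp
  ring

/-- A unimodular shear fixing `crossMat x` turns the covector `x` into a multiple of `l`, which
reduces to the case `l = x`. -/
lemma det_crossMat_add_vecMulVec_sq {x l : Fin 7 → ℝ} (hx : x ≠ 0) (hl : l ⬝ᵥ x ≠ 0) (t : ℝ) :
    (crossMat x + t • Matrix.vecMulVec l l).det ^ 2 = t ^ 2 * (x ⬝ᵥ x) ^ 4 * (l ⬝ᵥ x) ^ 4 := by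
  have hr := (dotProduct_self_pos hx).ne'
  set r := x ⬝ᵥ x with hr_def
  set q := l ⬝ᵥ x with hq
  -- Chosen so that `κ ⬝ᵥ x = 0`, which makes `S` unimodular, and `x + r κ = (r / q) l`.
  set κ : Fin 7 → ℝ := r⁻¹ • ((r / q) • l - x) with hκ
  obtain ⟨S, hS⟩ : ∃ S : Matrix (Fin 7) (Fin 7) ℝ, S = 1 + Matrix.vecMulVec x κ := ⟨_, rfl⟩
  have hdetS : S.det = 1 := by
    rw [hS, Matrix.vecMulVec_eq Unit, Matrix.det_one_add_replicateCol_mul_replicateRow, hκ,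
      smul_dotProduct, sub_dotProduct, smul_dotProduct, ← hq, ← hr_def]
    simp [hl]
  have h0 : crossMat x * Matrix.vecMulVec x κ = 0 := by
    rw [Matrix.mul_vecMulVec, crossMat_mulVec_self, Matrix.zero_vecMulVec]
  have h1 : Matrix.vecMulVec κ x * crossMat x = 0 := by
    have := congrArg Matrix.transpose h0
    simpa [Matrix.transpose_mul, Matrix.transpose_vecMulVec, crossMat_transpose] using this
  have hSt : Sᵀ = 1 + Matrix.vecMulVec κ x := by
    simp [hS, Matrix.transpose_vecMulVec]
  have hSx : Sᵀ *ᵥ x = (r / q) • l := by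
    rw [hSt, Matrix.add_mulVec, Matrix.one_mulVec, Matrix.vecMulVec_mulVec, ← hr_def, hκ]
    simp [smul_smul, hr]
  have hconj : Sᵀ * (crossMat x + (t * (q / r) ^ 2) • Matrix.vecMulVec x x) * S
      = crossMat x + t • Matrix.vecMulVec l l := by
    rw [mul_add, add_mul]
    congr 1
    · rw [hSt, hS, add_mul, h1, add_zero, one_mul, mul_add, h0, mul_one, add_zero]
    · rw [mul_smul_comm, Matrix.mul_vecMulVec, smul_mul_assoc, Matrix.vecMulVec_mul,
        ← Matrix.mulVec_transpose, hSx, Matrix.smul_vecMulVec, Matrix.vecMulVec_smul, smul_smul,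
        smul_smul]
      congr 1
      field_simp
  rw [← hconj, Matrix.det_mul, Matrix.det_mul, Matrix.det_transpose, hdetS, one_mul, mul_one,
    det_crossMat_add_sq hx, ← hr_def]
  field_simp

lemma crossMat_pullback {L : E7 →L[ℝ] E7} (hL : stdForm.compContinuousLinearMap L = stdForm)
    (x : E7) : (mat L)ᵀ * crossMat (L x).ofLp * mat L = crossMat x.ofLp := by
  have key : ∀ (x : E7) (i j : Fin 7),
      stdForm ![x, stdVec i, stdVec j] = crossMat x.ofLp i j := by
    intro x i j
    rw [stdForm_apply_eq_dotProduct]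
    simp [dotProduct, Matrix.mulVec, stdVec_apply]
  ext i j
  have h := congrArg (fun α : Form3 => α ![x, stdVec i, stdVec j]) hL
  have h' : stdForm ![L x, L (stdVec i), L (stdVec j)] = stdForm ![x, stdVec i, stdVec j] := by
    rw [← h, ContinuousAlternatingMap.compContinuousLinearMap_apply]
    congr 1
    ext a : 1
    fin_cases a <;> rfl
  rw [key, stdForm_apply_eq_dotProduct] at h'
  rw [← h', mul_assoc]
  simp only [Matrix.mul_apply, dotProduct, Matrix.mulVec, mat, Matrix.transpose_apply,
    Matrix.of_apply]

/-- Linear maps which preserve the standard form are orthogonal: the stabiliser of `stdForm` is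
contained in `O(7)`. -/
lemma mat_transpose_mul_self {L : E7 →L[ℝ] E7}
    (hL : stdForm.compContinuousLinearMap L = stdForm) : (mat L)ᵀ * mat L = 1 := by
  set P := mat L with hP
  have hLx : ∀ x : E7, (L x).ofLp = P *ᵥ x.ofLp := fun x => by
    ext i
    exact apply_eq_sum_mat L x i
  -- If `L x = 0` then `crossMat x` vanishes, but its square has trace `-6 |x|²`.
  have hker : ∀ x : E7, x ≠ 0 → L x ≠ 0 := by
    intro x hx h0
    have h1 := crossMat_pullback hL x
    have hx' : x.ofLp ≠ 0 := fun h => hx (by ext i; exact congrFun h i)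
    have h2 := crossMat_mul_self x.ofLp
    rw [← h1, h0] at h2
    have h3 : crossMat (0 : E7).ofLp = 0 := by
      ext i j; simp [crossMat]
    rw [h3] at h2
    have h4 := congrArg Matrix.trace h2
    have h5 : Matrix.trace (Matrix.vecMulVec x.ofLp x.ofLp) = x.ofLp ⬝ᵥ x.ofLp := by
      simp [Matrix.trace_vecMulVec]
    have := dotProduct_self_pos hx'
    simp only [mul_zero, zero_mul, Matrix.trace_add, Matrix.trace_smul, h5, Matrix.trace_one,
      Matrix.trace_zero, smul_eq_mul, Fintype.card_fin] at h4
    push_cast at h4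
    linarith
  -- The pullback by `L` of `crossMat y + y yᵀ` with `y = L x` is `crossMat x + l lᵀ` with `l = Pᵀ
  -- y`, so `l ⬝ᵥ x = |y|²`. The two determinant formulas then compare `|L x|` with `|x|`.
  have key : ∀ x : E7, P.det ^ 2 * ((L x).ofLp ⬝ᵥ (L x).ofLp) ^ 2 = (x.ofLp ⬝ᵥ x.ofLp) ^ 2 := by
    intro x
    by_cases hx : x = 0
    · simp [hx]
    have hx' : x.ofLp ≠ 0 := fun h => hx (by ext i; exact congrFun h i)
    have hy' : (L x).ofLp ≠ 0 := fun h => hker x hx (by ext i; exact congrFun h i)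
    set y := (L x).ofLp with hy
    have hry := dotProduct_self_pos hy'
    have hrx := dotProduct_self_pos hx'
    have hl : (y ᵥ* P) ⬝ᵥ x.ofLp = y ⬝ᵥ y := by
      rw [← Matrix.dotProduct_mulVec, ← hLx]
    have h1 : Pᵀ * (crossMat y + (1 : ℝ) • Matrix.vecMulVec y y) * P
        = crossMat x.ofLp + (1 : ℝ) • Matrix.vecMulVec (y ᵥ* P) (y ᵥ* P) := by
      rw [mul_add, add_mul, crossMat_pullback hL, one_smul, one_smul, Matrix.mul_vecMulVec,
        Matrix.vecMulVec_mul, Matrix.mulVec_transpose]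
    have h2 := congrArg (fun A => Matrix.det A ^ 2) h1
    simp only at h2
    rw [Matrix.det_mul, Matrix.det_mul, Matrix.det_transpose,
      det_crossMat_add_vecMulVec_sq hx' (by rw [hl]; exact hry.ne'), hl, mul_pow, mul_pow,
      det_crossMat_add_sq hy'] at h2
    have h3 : (P.det ^ 2 * (y ⬝ᵥ y) ^ 2) ^ 2 = ((x.ofLp ⬝ᵥ x.ofLp) ^ 2) ^ 2 := by
      have : (y ⬝ᵥ y) ^ 4 * (P.det ^ 2 * (y ⬝ᵥ y) ^ 2) ^ 2
          = (y ⬝ᵥ y) ^ 4 * ((x.ofLp ⬝ᵥ x.ofLp) ^ 2) ^ 2 := by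
        linear_combination h2
      exact mul_left_cancel₀ (by positivity) this
    exact (pow_left_inj₀ (by positivity) (by positivity) two_ne_zero).1 h3
  have key' : ∀ x : E7, |P.det| * ((L x).ofLp ⬝ᵥ (L x).ofLp) = x.ofLp ⬝ᵥ x.ofLp := by
    intro x
    have hnn : ∀ z : Fin 7 → ℝ, 0 ≤ z ⬝ᵥ z := fun z =>
      Finset.sum_nonneg fun i _ => mul_self_nonneg (z i)
    refine (pow_left_inj₀ (mul_nonneg (abs_nonneg _) (hnn _)) (hnn _) two_ne_zero).1 ?_
    rw [mul_pow, sq_abs, key]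
  -- Polarisation: `L` is a similarity with factor controlled by `|det P|`.
  have hPP : |P.det| • (Pᵀ * P) = 1 := by
    ext i j
    have h := key' (stdVec i + stdVec j)
    have hi := key' (stdVec i)
    have hj := key' (stdVec j)
    simp only [map_add, WithLp.ofLp_add, add_dotProduct, dotProduct_add] at h
    have hs : ∀ u v : Fin 7 → ℝ, u ⬝ᵥ v = v ⬝ᵥ u := dotProduct_comm
    rw [hs (L (stdVec j)).ofLp, hs (stdVec j).ofLp] at h
    have e1 : (Pᵀ * P) i j = (L (stdVec i)).ofLp ⬝ᵥ (L (stdVec j)).ofLp := rfl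
    have e2 : (1 : Matrix (Fin 7) (Fin 7) ℝ) i j = (stdVec i).ofLp ⬝ᵥ (stdVec j).ofLp := by
      simp [dotProduct, stdVec_apply, Matrix.one_apply, eq_comm]
    rw [Matrix.smul_apply, e1, e2, smul_eq_mul]
    linarith
  -- Determinants give `|det P|⁷ · |det P|² = 1`, so the similarity is an isometry.
  have hd := congrArg Matrix.det hPP
  rw [Matrix.det_smul, Matrix.det_mul, Matrix.det_transpose, Matrix.det_one, Fintype.card_fin,
    ← abs_mul_abs_self P.det] at hd
  have hd9 : |P.det| ^ 9 = 1 := by linear_combination hd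
  have hd1 : |P.det| = 1 := (pow_eq_one_iff_of_nonneg (abs_nonneg _) (by norm_num)).1 hd9
  rwa [hd1, one_smul] at hPP

/-! ### The metric of a positive form -/

lemma vec3_eta {V : Type*} (v : Fin 3 → V) : ![v 0, v 1, v 2] = v := by
  ext a : 1
  fin_cases a <;> rfl

lemma pullback_apply (α : Form3) (L : E7 →L[ℝ] E7) (x y z : E7) :
    α.compContinuousLinearMap L ![x, y, z] = α ![L x, L y, L z] := by
  rw [ContinuousAlternatingMap.compContinuousLinearMap_apply]
  congr 1
  ext a : 1
  fin_cases a <;> rfl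

lemma pullback_comp (α : Form3) (L K : E7 →L[ℝ] E7) :
    α.compContinuousLinearMap (L.comp K)
      = (α.compContinuousLinearMap L).compContinuousLinearMap K := rfl

lemma pullback_id (α : Form3) :
    α.compContinuousLinearMap (ContinuousLinearMap.id ℝ E7) = α := rfl

/-- The induced metric can be computed in any coframe. -/
lemma gram_eq_of_isCoframe {α : Form3} {f : E7 ≃L[ℝ] E7} (hf : IsCoframe α f) :
    gram α = (mat (f : E7 →L[ℝ] E7))ᵀ * mat (f : E7 →L[ℝ] E7) := by
  have hα : IsPositive α := ⟨f, hf⟩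
  set h := hα.choose with hh
  have hh' : IsCoframe α h := hα.choose_spec
  have h1 : gram α = (mat (h : E7 →L[ℝ] E7))ᵀ * mat (h : E7 →L[ℝ] E7) := by
    ext i j
    rw [gram, dif_pos hα, Matrix.of_apply, inner_eq_sum]
    rfl
  -- The transition between two coframes stabilises `stdForm`, so it is orthogonal.
  have h2 : stdForm.compContinuousLinearMap ((f : E7 →L[ℝ] E7).comp (h.symm : E7 →L[ℝ] E7))
      = stdForm := by
    rw [pullback_comp, hf, ← hh', ← pullback_comp, h.coe_comp_coe_symm, pullback_id]
  have h3 := mat_transpose_mul_self h2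
  rw [mat_comp] at h3
  have h4 := mat_symm_mul_equiv h
  have h4' : (mat (h : E7 →L[ℝ] E7))ᵀ * (mat (h.symm : E7 →L[ℝ] E7))ᵀ = 1 := by
    rw [← Matrix.transpose_mul, h4, Matrix.transpose_one]
  calc gram α = (mat (h : E7 →L[ℝ] E7))ᵀ * 1 * mat (h : E7 →L[ℝ] E7) := by rw [h1, mul_one]
    _ = ((mat (h : E7 →L[ℝ] E7))ᵀ * (mat (h.symm : E7 →L[ℝ] E7))ᵀ) * (mat (f : E7 →L[ℝ] E7))ᵀ
        * (mat (f : E7 →L[ℝ] E7) * (mat (h.symm : E7 →L[ℝ] E7) * mat (h : E7 →L[ℝ] E7))) := by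
      rw [← h3, Matrix.transpose_mul]
      simp only [mul_assoc]
    _ = _ := by rw [h4, h4', mul_one, one_mul]

lemma IsPositive.pullback {α : Form3} (hα : IsPositive α) (K : E7 ≃L[ℝ] E7) :
    IsPositive (α.compContinuousLinearMap (K : E7 →L[ℝ] E7)) := by
  obtain ⟨f, hf⟩ := hα
  exact ⟨K.trans f, by rw [← hf]; rfl⟩

lemma gram_pullback {α : Form3} (hα : IsPositive α) (K : E7 ≃L[ℝ] E7) :
    gram (α.compContinuousLinearMap (K : E7 →L[ℝ] E7))
      = (mat (K : E7 →L[ℝ] E7))ᵀ * gram α * mat (K : E7 →L[ℝ] E7) := by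
  obtain ⟨f, hf⟩ := hα
  have h : IsCoframe (α.compContinuousLinearMap (K : E7 →L[ℝ] E7)) (K.trans f) := by
    rw [← hf]; rfl
  have h2 : mat ((K.trans f : E7 ≃L[ℝ] E7) : E7 →L[ℝ] E7)
      = mat (f : E7 →L[ℝ] E7) * mat (K : E7 →L[ℝ] E7) :=
    mat_comp (f : E7 →L[ℝ] E7) (K : E7 →L[ℝ] E7)
  rw [gram_eq_of_isCoframe h, gram_eq_of_isCoframe hf, h2, Matrix.transpose_mul]
  simp only [mul_assoc]

lemma det_mat_ne_zero (f : E7 ≃L[ℝ] E7) : (mat (f : E7 →L[ℝ] E7)).det ≠ 0 := by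
  have h := congrArg Matrix.det (mat_symm_mul_equiv f)
  rw [Matrix.det_mul, Matrix.det_one] at h
  exact right_ne_zero_of_mul_eq_one h

lemma det_gram_pos {α : Form3} (hα : IsPositive α) : 0 < (gram α).det := by
  obtain ⟨f, hf⟩ := hα
  rw [gram_eq_of_isCoframe hf, Matrix.det_mul, Matrix.det_transpose]
  exact mul_self_pos.2 (det_mat_ne_zero f)

lemma gram_transpose (α : Form3) : (gram α)ᵀ = gram α := by
  by_cases h : IsPositive α
  · obtain ⟨f, hf⟩ := h
    rw [gram_eq_of_isCoframe hf, Matrix.transpose_mul, Matrix.transpose_transpose]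
  · simp [gram, h]

/-! ### The infinitesimal action of endomorphisms on forms -/

/-- The infinitesimal action `(A · α)(x, y, z) = α(A x, y, z) + α(x, A y, z) + α(x, y, A z)`. -/
def act (α : Form3) : (E7 →L[ℝ] E7) →L[ℝ] Form3 :=
  α.fderivCompContinuousLinearMap (ContinuousLinearMap.id ℝ E7)

lemma act_apply (α : Form3) (A : E7 →L[ℝ] E7) (x y z : E7) :
    act α A ![x, y, z] = α ![A x, y, z] + α ![x, A y, z] + α ![x, y, A z] := by
  rw [act, ContinuousAlternatingMap.fderivCompContinuousLinearMap_apply, Fin.sum_univ_three]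
  congr 1
  · congr 1 <;> congr 1 <;> ext a : 1 <;> fin_cases a <;> simp
  · congr 1; ext a : 1; fin_cases a <;> simp

lemma act_apply_update (α : Form3) (A : E7 →L[ℝ] E7) (v : Fin 3 → E7) :
    act α A v = ∑ a, α (Function.update v a (A (v a))) := by
  rw [← vec3_eta v, act_apply, Fin.sum_univ_three]
  congr 1
  · congr 1 <;> congr 1 <;> ext a : 1 <;> fin_cases a <;> simp
  · congr 1; ext a : 1; fin_cases a <;> simp

/-! ### Components of 3-forms -/

lemma form3_ext {α β : Form3}
    (h : ∀ i j k, α ![stdVec i, stdVec j, stdVec k] = β ![stdVec i, stdVec j, stdVec k]) :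
    α = β := by
  apply ContinuousAlternatingMap.toAlternatingMap_injective
  refine Module.Basis.ext_alternating (EuclideanSpace.basisFun (Fin 7) ℝ).toBasis fun v _ => ?_
  have h' := h (v 0) (v 1) (v 2)
  have e : (fun i => (EuclideanSpace.basisFun (Fin 7) ℝ).toBasis (v i))
      = ![stdVec (v 0), stdVec (v 1), stdVec (v 2)] := by
    ext a : 1
    fin_cases a <;> simp [stdVec]
  rw [e]
  exact h'

/-- The components `α_{ijk}` of a 3-form. -/
def coef (α : Form3) (i j k : Fin 7) : ℝ := α ![stdVec i, stdVec j, stdVec k]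

lemma form3_swap12 (α : Form3) (x y z : E7) : α ![x, y, z] = -α ![y, x, z] := by
  have h : ![y, x, z] ∘ Equiv.swap (0 : Fin 3) 1 = ![x, y, z] := by
    ext a : 1; fin_cases a <;> rfl
  rw [← h]
  exact α.toAlternatingMap.map_swap ![y, x, z] (by decide)

lemma form3_swap23 (α : Form3) (x y z : E7) : α ![x, y, z] = -α ![x, z, y] := by
  have h : ![x, z, y] ∘ Equiv.swap (1 : Fin 3) 2 = ![x, y, z] := by
    ext a : 1; fin_cases a <;> rfl
  rw [← h]
  exact α.toAlternatingMap.map_swap ![x, z, y] (by decide)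

lemma coef_swap12 (α : Form3) (i j k : Fin 7) : coef α i j k = -coef α j i k :=
  form3_swap12 α _ _ _

lemma coef_swap23 (α : Form3) (i j k : Fin 7) : coef α i j k = -coef α i k j :=
  form3_swap23 α _ _ _

lemma form3_ext_of_lt {α β : Form3} (h : ∀ i j k, i < j → j < k → coef α i j k = coef β i j k) :
    α = β := by
  refine form3_ext fun i j k => ?_
  change coef α i j k = coef β i j k
  have z12 : ∀ (γ : Form3) (i k : Fin 7), coef γ i i k = 0 := fun γ i k => by
    linarith [coef_swap12 γ i i k]
  have z23 : ∀ (γ : Form3) (i k : Fin 7), coef γ k i i = 0 := fun γ i k => by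
    linarith [coef_swap23 γ k i i]
  have z13 : ∀ (γ : Form3) (i k : Fin 7), coef γ i k i = 0 := fun γ i k => by
    linarith [coef_swap12 γ i k i, z23 γ i k]
  rcases lt_trichotomy i j with h1 | rfl | h1
  · rcases lt_trichotomy j k with h2 | rfl | h2
    · exact h i j k h1 h2
    · simp [z23]
    · rcases lt_trichotomy i k with h3 | rfl | h3
      · rw [coef_swap23 α, coef_swap23 β, h i k j h3 h2]
      · simp [z13]
      · rw [coef_swap23 α, coef_swap23 β, coef_swap12 α, coef_swap12 β, h k i j h3 h1]
  · simp [z12]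
  · rcases lt_trichotomy i k with h2 | rfl | h2
    · rw [coef_swap12 α, coef_swap12 β, h j i k h1 h2]
    · simp [z13]
    · rcases lt_trichotomy j k with h3 | rfl | h3
      · rw [coef_swap12 α, coef_swap12 β, coef_swap23 α, coef_swap23 β, h j k i h3 h2]
      · simp [z23]
      · rw [coef_swap12 α, coef_swap12 β, coef_swap23 α, coef_swap23 β, coef_swap12 α,
          coef_swap12 β, h k j i h3 h1]

/-- `B · stdForm` in coordinates. -/
lemma coef_act_stdForm (A : E7 →L[ℝ] E7) (i j k : Fin 7) : coef (act stdForm A) i j k =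
    fanoSign j k * mat A (third j k) i + fanoSign k i * mat A (third k i) j
      + fanoSign i j * mat A (third i j) k := by
  have key : ∀ (x : E7) (i j : Fin 7),
      stdForm ![x, stdVec i, stdVec j] = fanoSign i j * x (third i j) := by
    intro x i j
    rw [stdForm_apply]
    simp [stdVec_apply]
  have rot : ∀ x y z : E7, stdForm ![x, y, z] = stdForm ![y, z, x] := by
    intro x y z
    rw [form3_swap12, form3_swap23, neg_neg]
  rw [coef, act_apply, key, rot (stdVec i) (A _), key, rot (stdVec i) (stdVec j),
    rot (stdVec j), key]
  rfl

/-! ### Surjectivity of the infinitesimal action on the standard form -/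

/-- The components of a 3-form, as a linear map. -/
def coefL : Form3 →ₗ[ℝ] (Fin 7 → Fin 7 → Fin 7 → ℝ) where
  toFun α := coef α
  map_add' _ _ := rfl
  map_smul' _ _ := rfl

lemma coefL_injective : Function.Injective coefL := fun _ _ h =>
  form3_ext fun i j k => congrFun (congrFun (congrFun h i) j) k

instance : FiniteDimensional ℝ Form3 := FiniteDimensional.of_injective coefL coefL_injective

/-- The contraction `∑ α_{ikl} φ_{jkl}` of a 3-form with the standard form `φ`. -/
def contraction (α : Form3) : Matrix (Fin 7) (Fin 7) ℝ :=
  Matrix.of fun i j => ∑ k, fanoSign j k * coef α i k (third j k)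

/-- A right inverse of `A ↦ A · stdForm`. -/
def liftForm : Form3 →L[ℝ] (E7 →L[ℝ] E7) :=
  LinearMap.toContinuousLinearMap
    -- For symmetric `A` the contraction of `A · stdForm` is `4 A + 2 (tr A) 1`; for skew `A`
    -- orthogonal to `𝔤₂` it is `-12 A`. The coefficients invert this: `1/12 + 1/6 = 1/4` on the
    -- symmetric part, `1/12 - 1/6 = -1/12` on the skew part, and `1/36` removes the trace term, as
    -- `tr` of the contraction is `18 tr A`.
    { toFun := fun α => ofMat ((1 / 12 : ℝ) • contraction α + (1 / 6 : ℝ) • (contraction α)ᵀ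
        - ((1 / 36 : ℝ) * (contraction α).trace) • 1)
      map_add' := fun α β => by
        have h : contraction (α + β) = contraction α + contraction β := by
          ext i j
          simp [contraction, coef, mul_add, Finset.sum_add_distrib]
        rw [h, Matrix.trace_add, Matrix.transpose_add]
        apply Function.LeftInverse.injective ofMat_mat
        simp only [mat_ofMat, mat_add]
        module
      map_smul' := fun c α => by
        have h : contraction (c • α) = c • contraction α := by
          ext i j
          simp [contraction, coef, Finset.mul_sum, mul_left_comm]
        rw [h, Matrix.trace_smul, Matrix.transpose_smul, smul_eq_mul]
        apply Function.LeftInverse.injective ofMat_mat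
        simp only [mat_ofMat, mat_smul, RingHom.id_apply]
        module }

lemma mat_liftForm (α : Form3) : mat (liftForm α) = (1 / 12 : ℝ) • contraction α
    + (1 / 6 : ℝ) • (contraction α)ᵀ - ((1 / 36 : ℝ) * (contraction α).trace) • 1 :=
  mat_ofMat _

lemma contraction_apply (α : Form3) (i j : Fin 7) : contraction α i j =
    ![2 * (coef α i 1 2 + coef α i 3 4 + coef α i 5 6),
      2 * (-coef α i 0 2 + coef α i 3 5 - coef α i 4 6),
      2 * (coef α i 0 1 - coef α i 3 6 - coef α i 4 5),
      2 * (-coef α i 0 4 - coef α i 1 5 + coef α i 2 6),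
      2 * (coef α i 0 3 + coef α i 1 6 + coef α i 2 5),
      2 * (-coef α i 0 6 + coef α i 1 3 - coef α i 2 4),
      2 * (coef α i 0 5 - coef α i 1 4 - coef α i 2 3)] j := by
  have s23 : ∀ i j k : Fin 7, k < j → coef α i j k = -coef α i k j :=
    fun i j k _ => coef_swap23 α i j k
  simp only [contraction, Matrix.of_apply, Fin.sum_univ_seven]
  fin_cases j <;> simp [fanoSign, third, s23] <;> ring

lemma coef_self12 (α : Form3) (i k : Fin 7) : coef α i i k = 0 := by
  linarith [coef_swap12 α i i k]

lemma coef_self23 (α : Form3) (i k : Fin 7) : coef α k i i = 0 := by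
  linarith [coef_swap23 α k i i]

lemma coef_swap12_of_lt (α : Form3) {i j k : Fin 7} (_ : j < i) : coef α i j k = -coef α j i k :=
  coef_swap12 α i j k

lemma coef_swap23_of_lt (α : Form3) {i j k : Fin 7} (_ : k < j) : coef α i j k = -coef α i k j :=
  coef_swap23 α i j k

lemma trace_contraction (α : Form3) : (contraction α).trace =
    6 * (coef α 0 1 2 + coef α 0 3 4 + coef α 0 5 6 + coef α 1 3 5 - coef α 1 4 6
      - coef α 2 3 6 - coef α 2 4 5) := by
  simp only [Matrix.trace, Matrix.diag, Fin.sum_univ_seven, contraction_apply]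
  simp [coef_swap12_of_lt, coef_swap23_of_lt]
  ring

-- Infinitesimally, the `GL(7)`-orbit of `stdForm` is open: `49 - dim 𝔤₂ = 35 = dim Λ³`. With the
-- explicit inverse, only the 35 components with increasing indices have to be checked.
set_option maxHeartbeats 1000000 in
lemma act_liftForm (α : Form3) : act stdForm (liftForm α) = α := by
  refine form3_ext_of_lt fun i j k hij hjk => ?_
  rw [coef_act_stdForm, mat_liftForm, trace_contraction]
  simp only [Matrix.sub_apply, Matrix.add_apply, Matrix.smul_apply, Matrix.one_apply,
    Matrix.transpose_apply, smul_eq_mul, contraction_apply]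
  fin_cases i <;> fin_cases j <;> first | (exfalso; revert hij; decide) | skip
  all_goals fin_cases k <;> first | (exfalso; revert hjk; decide) | skip
  all_goals
    simp [fanoSign, third, coef_swap12_of_lt, coef_swap23_of_lt, coef_self12,
      coef_self23]
    ring

/-! ### Inner products of tensors -/

/-- The `k`-th tensor power of a matrix. -/
def tensorPow (k : ℕ) (F : Matrix (Fin 7) (Fin 7) ℝ) :
    Matrix (Fin k → Fin 7) (Fin k → Fin 7) ℝ :=
  Matrix.of fun I J => ∏ a, F (I a) (J a)

lemma tensorPow_mul (k : ℕ) (F G : Matrix (Fin 7) (Fin 7) ℝ) :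
    tensorPow k (F * G) = tensorPow k F * tensorPow k G := by
  ext I J
  simp only [tensorPow, Matrix.of_apply, Matrix.mul_apply, Finset.prod_univ_sum,
    Fintype.piFinset_univ, Finset.prod_mul_distrib]

lemma tensorPow_one (k : ℕ) : tensorPow k 1 = 1 := by
  ext I J
  simp only [tensorPow, Matrix.of_apply, Matrix.one_apply, Finset.prod_ite_zero,
    Finset.prod_const_one, Finset.mem_univ, true_imp_iff, funext_iff]

lemma tensorPow_transpose (k : ℕ) (F : Matrix (Fin 7) (Fin 7) ℝ) :
    tensorPow k Fᵀ = (tensorPow k F)ᵀ := rfl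

lemma formInner_eq {k : ℕ} (G : Matrix (Fin 7) (Fin 7) ℝ) (α β : (Fin k → Fin 7) → ℝ) :
    formInner G α β = (k.factorial : ℝ)⁻¹ * (α ⬝ᵥ tensorPow k G⁻¹ *ᵥ β) := by
  simp only [formInner, dotProduct, Matrix.mulVec, tensorPow, Matrix.of_apply, Finset.mul_sum]
  refine Finset.sum_congr rfl fun I _ => Finset.sum_congr rfl fun J _ => by ring

/-- In a coframe the pairing is a multiple of the standard dot product, which gives positive
definiteness. -/
lemma formInner_transpose_mul_self {k : ℕ} (F : Matrix (Fin 7) (Fin 7) ℝ)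
    (α β : (Fin k → Fin 7) → ℝ) :
    formInner (Fᵀ * F) α β = (k.factorial : ℝ)⁻¹ *
      ((tensorPow k F⁻¹)ᵀ *ᵥ α ⬝ᵥ (tensorPow k F⁻¹)ᵀ *ᵥ β) := by
  rw [formInner_eq, Matrix.mul_inv_rev, tensorPow_mul, ← Matrix.transpose_nonsing_inv,
    tensorPow_transpose, ← Matrix.mulVec_mulVec, Matrix.dotProduct_mulVec, Matrix.mulVec_transpose _ α]

lemma formInner_self_nonneg {α : Form3} (hα : IsPositive α) {k : ℕ} (ξ : (Fin k → Fin 7) → ℝ) :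
    0 ≤ formInner (gram α) ξ ξ := by
  obtain ⟨f, hf⟩ := hα
  rw [gram_eq_of_isCoframe hf, formInner_transpose_mul_self]
  exact mul_nonneg (by positivity) (Finset.sum_nonneg fun i _ => mul_self_nonneg _)

lemma eq_zero_of_formInner_self_eq_zero {α : Form3} (hα : IsPositive α) {k : ℕ}
    {ξ : (Fin k → Fin 7) → ℝ} (h : formInner (gram α) ξ ξ = 0) : ξ = 0 := by
  obtain ⟨f, hf⟩ := hα
  rw [gram_eq_of_isCoframe hf, formInner_transpose_mul_self] at h
  have h1 := (mul_eq_zero.1 h).resolve_left (by positivity)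
  rw [dotProduct_self_eq_zero] at h1
  have h2 := congrArg ((tensorPow k (mat (f : E7 →L[ℝ] E7)))ᵀ *ᵥ ·) h1
  simpa only [Matrix.mulVec_mulVec, ← Matrix.transpose_mul, ← tensorPow_mul,
    Matrix.nonsing_inv_mul _ (det_mat_ne_zero f).isUnit, tensorPow_one, Matrix.transpose_one,
    Matrix.one_mulVec, Matrix.mulVec_zero] using h2

lemma comps_pullback (α : Form3) (L : E7 →L[ℝ] E7) :
    comps (α.compContinuousLinearMap L) = (tensorPow 3 (mat L))ᵀ *ᵥ comps α := by
  ext I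
  simp only [comps, Matrix.mulVec, dotProduct, Matrix.transpose_apply, tensorPow, Matrix.of_apply]
  rw [ContinuousAlternatingMap.compContinuousLinearMap_apply]
  have h : (fun a => L (stdVec (I a))) = fun a => ∑ j, mat L j (I a) • stdVec j := by
    ext a : 1
    exact (sum_smul_stdVec _).symm
  have h' : (⇑L ∘ fun a => stdVec (I a)) = fun a => ∑ j, mat L j (I a) • stdVec j := h
  rw [h']
  have := α.toMultilinearMap.map_sum (fun a (j : Fin 7) => mat L j (I a) • stdVec j)
  refine this.trans (Finset.sum_congr rfl fun J _ => ?_)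
  exact (α.toMultilinearMap.map_smul_univ _ _)

lemma formInner_pullback {F G : Matrix (Fin 7) (Fin 7) ℝ} (hF : F.det ≠ 0) {k : ℕ}
    (α β : (Fin k → Fin 7) → ℝ) :
    formInner (Fᵀ * G * F) ((tensorPow k F)ᵀ *ᵥ α) ((tensorPow k F)ᵀ *ᵥ β) = formInner G α β := by
  have h1 : F * F⁻¹ = 1 := Matrix.mul_nonsing_inv _ hF.isUnit
  rw [formInner_eq, formInner_eq, Matrix.mul_inv_rev, Matrix.mul_inv_rev,
    ← Matrix.transpose_nonsing_inv, tensorPow_mul, tensorPow_mul, tensorPow_transpose,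
    Matrix.mulVec_transpose _ α, ← Matrix.dotProduct_mulVec, Matrix.mulVec_mulVec,
    Matrix.mulVec_mulVec]
  congr 2
  rw [mul_assoc, mul_assoc, mul_assoc, ← Matrix.transpose_mul, ← tensorPow_mul, h1, tensorPow_one,
    Matrix.transpose_one, mul_one, ← mul_assoc, ← tensorPow_mul, h1, tensorPow_one, one_mul]

/-! ### Pairing with the standard form -/

lemma sum_fin3 (F : (Fin 3 → Fin 7) → ℝ) : ∑ I, F I = ∑ i, ∑ j, ∑ k, F ![i, j, k] := by
  let e : Fin 7 × Fin 7 × Fin 7 ≃ (Fin 3 → Fin 7) :=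
    { toFun := fun p => ![p.1, p.2.1, p.2.2]
      invFun := fun I => (I 0, I 1, I 2)
      left_inv := fun p => rfl
      right_inv := fun I => vec3_eta I }
  rw [← e.sum_comp, Fintype.sum_prod_type]
  exact Finset.sum_congr rfl fun i _ => Fintype.sum_prod_type _

lemma comps_vec3 (α : Form3) (i j k : Fin 7) : comps α ![i, j, k] = coef α i j k := by
  rw [comps, coef]
  congr 1
  ext a : 1
  fin_cases a <;> rfl

lemma coef_stdForm (i j k : Fin 7) :
    coef stdForm i j k = if k = third i j then (fanoSign i j : ℝ) else 0 := by
  rw [coef, form3_swap23, form3_swap12, neg_neg, stdForm_apply]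
  simp [stdVec_apply, eq_comm]

/-- The pairing is `1/6` of the trace of the contraction, and `liftForm β` has `1/4 - 7/36 = 1/18`
of that trace. -/
lemma formInner_one_stdForm (β : Form3) :
    formInner 1 (comps stdForm) (comps β) = 3 * (mat (liftForm β)).trace := by
  have h : comps stdForm ⬝ᵥ comps β = (contraction β).trace := by
    rw [dotProduct, sum_fin3]
    simp only [comps_vec3, coef_stdForm, ite_mul, zero_mul, Finset.sum_ite_eq', Finset.mem_univ,
      if_true, Matrix.trace, Matrix.diag, contraction, Matrix.of_apply]
  rw [formInner_eq, inv_one, tensorPow_one, Matrix.one_mulVec, h, mat_liftForm]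
  simp [Matrix.trace_add, Matrix.trace_sub, Nat.factorial]
  ring

/-- Every 3-form is tangent to the orbit of a positive form. -/
lemma exists_act_eq {α : Form3} (hα : IsPositive α) (β : Form3) :
    ∃ B : E7 →L[ℝ] E7, act α B = β ∧
      formInner (gram α) (comps α) (comps β) = 3 * (mat B).trace := by
  obtain ⟨f, hf⟩ := hα
  set L : E7 →L[ℝ] E7 := (f : E7 →L[ℝ] E7)
  set K : E7 →L[ℝ] E7 := (f.symm : E7 →L[ℝ] E7)
  have hLK : L.comp K = ContinuousLinearMap.id ℝ E7 := f.coe_comp_coe_symm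
  have hKL : K.comp L = ContinuousLinearMap.id ℝ E7 := f.coe_symm_comp_coe
  have hLK' : ∀ x, L (K x) = x := fun x => f.apply_symm_apply x
  set β' : Form3 := β.compContinuousLinearMap K
  have hβ : β = β'.compContinuousLinearMap L := by
    rw [← pullback_comp, hKL, pullback_id]
  have hf' : stdForm.compContinuousLinearMap L = α := hf
  -- Conjugating the solution at `stdForm` by the coframe; conjugation preserves the trace.
  refine ⟨K.comp ((liftForm β').comp L), ?_, ?_⟩
  · rw [hβ, ← hf']
    refine form3_ext fun i j k => ?_
    rw [act_apply, pullback_apply, pullback_apply, pullback_apply, pullback_apply,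
      ← act_liftForm β', act_apply]
    simp only [ContinuousLinearMap.comp_apply, hLK', act_liftForm]
  · have h1 : gram α = (mat L)ᵀ * 1 * mat L := by
      rw [gram_eq_of_isCoframe hf, mul_one]
    rw [h1, ← hf', hβ, comps_pullback, comps_pullback, formInner_pullback (det_mat_ne_zero f),
      formInner_one_stdForm, mat_comp, mat_comp, Matrix.trace_mul_comm, mul_assoc, ← mat_comp L K,
      hLK, mat_id, mul_one]

/-! ### Local sections of the orbit map -/

instance : CompleteSpace Form3 := FiniteDimensional.complete ℝ Form3

lemma contDiff_form3_of_coef {E : Type*} [NormedAddCommGroup E] [NormedSpace ℝ E] {f : E → Form3}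
    {n : WithTop ℕ∞} (h : ∀ i j k, ContDiff ℝ n fun x => coef (f x) i j k) : ContDiff ℝ n f := by
  obtain ⟨g, hg⟩ := coefL.exists_leftInverse_of_injective (LinearMap.ker_eq_bot.2 coefL_injective)
  have h1 : ContDiff ℝ n fun x => coefL (f x) :=
    contDiff_pi.2 fun i => contDiff_pi.2 fun j => contDiff_pi.2 fun k => h i j k
  have h2 : f = fun x => LinearMap.toContinuousLinearMap g (coefL (f x)) :=
    funext fun x => (LinearMap.congr_fun hg (f x)).symm
  rw [h2]
  exact (LinearMap.toContinuousLinearMap g).contDiff.comp h1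

/-- The pullback of a 3-form, as a continuous linear map. -/
abbrev pullL (L : E7 →L[ℝ] E7) : Form3 →L[ℝ] Form3 :=
  ContinuousAlternatingMap.compContinuousLinearMapCLM L

lemma hasFDerivAt_pullback (α : Form3) (L : E7 →L[ℝ] E7) :
    HasFDerivAt (fun K : E7 →L[ℝ] E7 => α.compContinuousLinearMap K)
      (α.fderivCompContinuousLinearMap L) L := by
  have := (hasFDerivAt_const α L).continuousAlternatingMapCompContinuousLinearMap
    (hasFDerivAt_id L)
  simpa using this

lemma contDiff_orbit : ContDiff ℝ ∞ fun β : Form3 =>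
    stdForm.compContinuousLinearMap (ContinuousLinearMap.id ℝ E7 + liftForm β) := by
  refine contDiff_form3_of_coef fun i j k => ?_
  simp only [coef, pullback_apply, stdForm_apply]
  have : ∀ i j : Fin 7, ContDiff ℝ ∞ fun β : Form3 =>
      ((ContinuousLinearMap.id ℝ E7 + liftForm β) (stdVec i)) j := by
    intro i j
    have : (fun β : Form3 => ((ContinuousLinearMap.id ℝ E7 + liftForm β) (stdVec i)) j)
        = fun β => stdVec i j + (EuclideanSpace.proj j : E7 →L[ℝ] ℝ)
          ((ContinuousLinearMap.apply ℝ E7 (stdVec i)).comp liftForm β) := rfl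
    rw [this]
    fun_prop
  fun_prop

lemma hasFDerivAt_pullback_id (α : Form3) :
    HasFDerivAt (fun K : E7 →L[ℝ] E7 => α.compContinuousLinearMap K) (act α)
      (ContinuousLinearMap.id ℝ E7) :=
  hasFDerivAt_pullback α (ContinuousLinearMap.id ℝ E7)

lemma hasFDerivAt_pullback_id_add {E : Type*} [NormedAddCommGroup E] [NormedSpace ℝ E]
    (α : Form3) (l : E →L[ℝ] (E7 →L[ℝ] E7)) :
    HasFDerivAt (fun β : E => α.compContinuousLinearMap (ContinuousLinearMap.id ℝ E7 + l β))
      ((act α).comp l) 0 := by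
  have h1 : HasFDerivAt (fun β : E => ContinuousLinearMap.id ℝ E7 + l β) l 0 :=
    l.hasFDerivAt.const_add _
  have h2 : HasFDerivAt (fun K : E7 →L[ℝ] E7 => α.compContinuousLinearMap K)
      (act α) (ContinuousLinearMap.id ℝ E7 + l 0) := by
    rw [map_zero, add_zero]
    exact hasFDerivAt_pullback_id α
  exact HasFDerivAt.comp (g := fun K : E7 →L[ℝ] E7 => α.compContinuousLinearMap K)
    (0 : E) h2 h1

lemma act_comp_liftForm : (act stdForm).comp liftForm = ContinuousLinearMap.id ℝ Form3 :=
  ContinuousLinearMap.ext fun β => by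
    rw [ContinuousLinearMap.comp_apply, act_liftForm, ContinuousLinearMap.id_apply]

lemma hasFDerivAt_orbit : HasFDerivAt (fun β : Form3 =>
      stdForm.compContinuousLinearMap (ContinuousLinearMap.id ℝ E7 + liftForm β))
    (ContinuousLinearMap.id ℝ Form3) 0 :=
  act_comp_liftForm ▸ hasFDerivAt_pullback_id_add stdForm liftForm

/-- The inverse function theorem applies to `β ↦ (1 + liftForm β)^* stdForm`, whose derivative at
`0` is the identity because `liftForm` is a right inverse of the infinitesimal action. -/
lemma exists_section : ∃ s : Form3 → (E7 →L[ℝ] E7), ContDiffAt ℝ ∞ s stdForm ∧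
    ∀ᶠ γ in 𝓝 stdForm, stdForm.compContinuousLinearMap (s γ) = γ ∧
      ∃ e : E7 ≃L[ℝ] E7, (e : E7 →L[ℝ] E7) = s γ := by
  obtain ⟨Φ, hΦ⟩ : ∃ Φ : Form3 → Form3, Φ = fun β =>
    stdForm.compContinuousLinearMap (ContinuousLinearMap.id ℝ E7 + liftForm β) := ⟨_, rfl⟩
  have hc : ContDiffAt ℝ ∞ Φ 0 := hΦ ▸ contDiff_orbit.contDiffAt
  have hΦ0 : Φ 0 = stdForm := by
    rw [hΦ]
    simp only [map_zero, add_zero]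
    exact pullback_id _
  have hd : HasFDerivAt Φ ((ContinuousLinearEquiv.refl ℝ Form3 : Form3 ≃L[ℝ] Form3) :
      Form3 →L[ℝ] Form3) 0 := hΦ ▸ hasFDerivAt_orbit
  have hn : (∞ : WithTop ℕ∞) ≠ 0 := by simp
  have hg := hc.to_localInverse hd hn
  rw [hΦ0] at hg
  have hstrict := hc.hasStrictFDerivAt' hd hn
  have hr := hstrict.eventually_right_inverse
  rw [hΦ0] at hr
  set g := hc.localInverse hd hn with hgdef
  have hg0 : g stdForm = 0 := by
    rw [← hΦ0]
    exact hc.localInverse_apply_image hd hn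
  have hs : ContDiffAt ℝ ∞ (fun γ => ContinuousLinearMap.id ℝ E7 + liftForm (g γ)) stdForm :=
    contDiffAt_const.add (liftForm.contDiff.contDiffAt.comp _ hg)
  refine ⟨fun γ => ContinuousLinearMap.id ℝ E7 + liftForm (g γ), hs, ?_⟩
  have he : ∀ᶠ γ in 𝓝 stdForm, ContinuousLinearMap.id ℝ E7 + liftForm (g γ)
      ∈ range ((↑) : (E7 ≃L[ℝ] E7) → (E7 →L[ℝ] E7)) := by
    refine hs.continuousAt.eventually_mem ?_
    have := ContinuousLinearEquiv.nhds (ContinuousLinearEquiv.refl ℝ E7)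
    simpa [hg0] using this
  filter_upwards [hr, he] with γ h1 h2
  exact ⟨(congrFun hΦ _).symm.trans h1, h2⟩

/-! ### Smoothness of the metric, and its derivative -/

lemma isPositive_pullback_iff {α : Form3} (K : E7 ≃L[ℝ] E7) :
    IsPositive (α.compContinuousLinearMap (K : E7 →L[ℝ] E7)) ↔ IsPositive α := by
  refine ⟨fun h => ?_, fun h => h.pullback K⟩
  have := h.pullback K.symm
  rwa [← pullback_comp, K.coe_comp_coe_symm, pullback_id] at this

/-- Off the positive forms both sides are `0`, because pullback by an isomorphism preserves
non-positivity. -/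
lemma gram_pullback' (α : Form3) (K : E7 ≃L[ℝ] E7) :
    gram (α.compContinuousLinearMap (K : E7 →L[ℝ] E7))
      = (mat (K : E7 →L[ℝ] E7))ᵀ * gram α * mat (K : E7 →L[ℝ] E7) := by
  by_cases hα : IsPositive α
  · exact gram_pullback hα K
  · have : ¬ IsPositive (α.compContinuousLinearMap (K : E7 →L[ℝ] E7)) := by
      rwa [isPositive_pullback_iff]
    simp [gram, hα, this]

/-- Coframes can be chosen smoothly near a positive form. Openness of positivity and smoothness of
the metric both follow. -/
lemma eventually_coframe {α : Form3} (hα : IsPositive α) :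
    ∃ s : Form3 → (E7 →L[ℝ] E7), ContDiffAt ℝ ∞ s α ∧
    ∀ᶠ γ in 𝓝 α, ∃ e : E7 ≃L[ℝ] E7, (e : E7 →L[ℝ] E7) = s γ ∧ IsCoframe γ e := by
  obtain ⟨f, hf⟩ := hα
  obtain ⟨s, hs, hev⟩ := exists_section
  have hf0 : pullL (f.symm : E7 →L[ℝ] E7) α = stdForm := by
    rw [← hf]
    change (stdForm.compContinuousLinearMap (f : E7 →L[ℝ] E7)).compContinuousLinearMap
      (f.symm : E7 →L[ℝ] E7) = stdForm
    rw [← pullback_comp, f.coe_comp_coe_symm, pullback_id]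
  refine ⟨fun γ => (s (pullL (f.symm : E7 →L[ℝ] E7) γ)).comp (f : E7 →L[ℝ] E7), ?_, ?_⟩
  · have h1 : ContDiffAt ℝ ∞ (fun γ => s (pullL (f.symm : E7 →L[ℝ] E7) γ)) α := by
      refine ContDiffAt.comp (g := s) α ?_ (pullL (f.symm : E7 →L[ℝ] E7)).contDiff.contDiffAt
      rwa [hf0]
    exact h1.clm_comp contDiffAt_const
  · have hc : Filter.Tendsto (pullL (f.symm : E7 →L[ℝ] E7)) (𝓝 α) (𝓝 stdForm) := by
      rw [← hf0]
      exact (pullL (f.symm : E7 →L[ℝ] E7)).continuous.continuousAt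
    filter_upwards [hc.eventually hev] with γ ⟨h1, e, he⟩
    refine ⟨f.trans e, ?_, ?_⟩
    · rw [← he]; rfl
    · change (stdForm.compContinuousLinearMap (e : E7 →L[ℝ] E7)).compContinuousLinearMap
        (f : E7 →L[ℝ] E7) = γ
      rw [he, h1]
      change (γ.compContinuousLinearMap (f.symm : E7 →L[ℝ] E7)).compContinuousLinearMap
        (f : E7 →L[ℝ] E7) = γ
      rw [← pullback_comp, f.coe_symm_comp_coe, pullback_id]

lemma eventually_isPositive {α : Form3} (hα : IsPositive α) : ∀ᶠ γ in 𝓝 α, IsPositive γ := by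
  obtain ⟨s, -, hs⟩ := eventually_coframe hα
  exact hs.mono fun γ ⟨e, _, he⟩ => ⟨e, he⟩

lemma contDiffAt_gram {α : Form3} (hα : IsPositive α) (i j : Fin 7) :
    ContDiffAt ℝ ∞ (fun γ => gram γ i j) α := by
  obtain ⟨s, hs, hev⟩ := eventually_coframe hα
  have h1 : (fun γ => gram γ i j) =ᶠ[𝓝 α] fun γ => ∑ k, mat (s γ) k i * mat (s γ) k j := by
    filter_upwards [hev] with γ ⟨e, he, hc⟩
    rw [gram_eq_of_isCoframe hc, he]
    rfl
  refine ContDiffAt.congr_of_eventuallyEq ?_ h1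
  have h2 : ∀ i j, ContDiffAt ℝ ∞ (fun γ => mat (s γ) i j) α := fun i j =>
    (EuclideanSpace.proj i : E7 →L[ℝ] ℝ).contDiff.contDiffAt.comp α
      (hs.clm_apply contDiffAt_const)
  exact ContDiffAt.sum fun k _ => (h2 k i).mul (h2 k j)

lemma contDiffAt_det {E : Type*} [NormedAddCommGroup E] [NormedSpace ℝ E] {n : ℕ}
    {A : E → Matrix (Fin n) (Fin n) ℝ} {x : E}
    (h : ∀ i j, ContDiffAt ℝ ∞ (fun y => A y i j) x) : ContDiffAt ℝ ∞ (fun y => (A y).det) x := by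
  simp only [Matrix.det_apply]
  exact ContDiffAt.sum fun σ _ => (contDiffAt_prod fun i _ => h _ _).const_smul _

lemma contDiffAt_matrix_inv {E : Type*} [NormedAddCommGroup E] [NormedSpace ℝ E] {n : ℕ}
    {A : E → Matrix (Fin n) (Fin n) ℝ} {x : E}
    (h : ∀ i j, ContDiffAt ℝ ∞ (fun y => A y i j) x) (hx : (A x).det ≠ 0) (i j : Fin n) :
    ContDiffAt ℝ ∞ (fun y => (A y)⁻¹ i j) x := by
  simp only [Matrix.inv_def, Ring.inverse_eq_inv', Matrix.smul_apply, Matrix.adjugate_apply,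
    smul_eq_mul]
  refine ((contDiffAt_det h).inv hx).mul (contDiffAt_det fun a b => ?_)
  simp only [Matrix.updateRow_apply]
  split_ifs
  · exact contDiffAt_const
  · exact h a b

/-! ### Derivatives along the orbits -/

lemma eventually_id_add_smul_isEquiv (A : E7 →L[ℝ] E7) :
    ∀ᶠ t : ℝ in 𝓝 0, ∃ e : E7 ≃L[ℝ] E7,
      (e : E7 →L[ℝ] E7) = ContinuousLinearMap.id ℝ E7 + t • A := by
  have hc : Continuous fun t : ℝ => ContinuousLinearMap.id ℝ E7 + t • A := by fun_prop
  refine hc.continuousAt.eventually_mem (f := fun t : ℝ => ContinuousLinearMap.id ℝ E7 + t • A)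
    (s := range ((↑) : (E7 ≃L[ℝ] E7) → (E7 →L[ℝ] E7))) ?_
  have h0 : ContinuousLinearMap.id ℝ E7 + (0 : ℝ) • A
      = ((ContinuousLinearEquiv.refl ℝ E7 : E7 ≃L[ℝ] E7) : E7 →L[ℝ] E7) := by
    ext x; simp
  rw [h0]
  exact ContinuousLinearEquiv.nhds (ContinuousLinearEquiv.refl ℝ E7)

lemma hasDerivAt_pullback_id_add_smul (α : Form3) (A : E7 →L[ℝ] E7) :
    HasDerivAt (fun t : ℝ => α.compContinuousLinearMap (ContinuousLinearMap.id ℝ E7 + t • A))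
      (act α A) 0 := by
  have h := (hasFDerivAt_pullback_id_add α
    (ContinuousLinearMap.toSpanSingleton ℝ A)).hasDerivAt
  simpa using h

/-- Derivative along the orbits of a function which is differentiable at `α`. -/
lemma fderiv_act {F : Form3 → ℝ} {α : Form3} (hF : DifferentiableAt ℝ F α) (A : E7 →L[ℝ] E7)
    {c : ℝ} {φ : ℝ → ℝ} (hφ : HasDerivAt φ c 0)
    (h : ∀ t : ℝ, ∀ e : E7 ≃L[ℝ] E7, (e : E7 →L[ℝ] E7) = ContinuousLinearMap.id ℝ E7 + t • A →
      F (α.compContinuousLinearMap (e : E7 →L[ℝ] E7)) = φ t) :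
    fderiv ℝ F α (act α A) = c := by
  have h0 : α.compContinuousLinearMap (ContinuousLinearMap.id ℝ E7 + (0 : ℝ) • A) = α := by
    have : ContinuousLinearMap.id ℝ E7 + (0 : ℝ) • A = ContinuousLinearMap.id ℝ E7 := by
      ext x; simp
    rw [this, pullback_id]
  have hF' : HasFDerivAt F (fderiv ℝ F α)
      (α.compContinuousLinearMap (ContinuousLinearMap.id ℝ E7 + (0 : ℝ) • A)) := by
    rw [h0]; exact hF.hasFDerivAt
  have h1 := hF'.comp_hasDerivAt (0 : ℝ) (hasDerivAt_pullback_id_add_smul α A)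
  refine h1.unique (hφ.congr_of_eventuallyEq ?_)
  filter_upwards [eventually_id_add_smul_isEquiv A] with t ⟨e, he⟩
  rw [← h t e he, he]
  rfl

lemma mat_id_add_smul (A : E7 →L[ℝ] E7) (t : ℝ) :
    mat (ContinuousLinearMap.id ℝ E7 + t • A) = 1 + t • mat A := by
  rw [mat_add, mat_id, mat_smul]

lemma fderiv_gram_act {α : Form3} (hα : IsPositive α) (A : E7 →L[ℝ] E7) (i j : Fin 7) :
    fderiv ℝ (fun γ => gram γ i j) α (act α A)
      = ((mat A)ᵀ * gram α + gram α * mat A) i j := by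
  refine fderiv_act ((contDiffAt_gram hα i j).differentiableAt (by simp)) A
    (φ := fun t => gram α i j + t * ((mat A)ᵀ * gram α + gram α * mat A) i j
      + t ^ 2 * ((mat A)ᵀ * gram α * mat A) i j) ?_ ?_
  · have h1 := ((hasDerivAt_id (0 : ℝ)).mul_const
      (((mat A)ᵀ * gram α + gram α * mat A) i j)).const_add (gram α i j)
    have h2 := ((hasDerivAt_id (0 : ℝ)).pow 2).mul_const (((mat A)ᵀ * gram α * mat A) i j)
    exact (h1.add h2).congr_deriv (by simp)
  · intro t e he
    rw [gram_pullback hα, he, mat_id_add_smul]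
    have : (1 + t • mat A)ᵀ * gram α * (1 + t • mat A) = gram α
        + t • ((mat A)ᵀ * gram α + gram α * mat A) + t ^ 2 • ((mat A)ᵀ * gram α * mat A) := by
      simp only [Matrix.transpose_add, Matrix.transpose_one, Matrix.transpose_smul, add_mul, mul_add,
        one_mul, mul_one, smul_mul_assoc, mul_smul_comm, smul_smul, smul_add]
      module
    rw [this]
    rfl

/-! ### Variation of the volume, skew directions and scaling of the metric -/

/-- The Riemannian volume density of a form. -/
def volDensity (α : Form3) : ℝ := √(gram α).det

lemma volDensity_pos {α : Form3} (hα : IsPositive α) : 0 < volDensity α :=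
  Real.sqrt_pos.2 (det_gram_pos hα)

lemma contDiffAt_volDensity {α : Form3} (hα : IsPositive α) : ContDiffAt ℝ ∞ volDensity α :=
  (contDiffAt_det (contDiffAt_gram hα)).sqrt (det_gram_pos hα).ne'

/-- With `β = B · α`, moving along `(1 + tB)^* α` multiplies the volume by `|det (1 + tB)|`, whose
derivative at `0` is `tr B = ⅓⟨α, β⟩`. -/
lemma fderiv_volDensity {α : Form3} (hα : IsPositive α) (β : Form3) :
    fderiv ℝ volDensity α β = 1 / 3 * formInner (gram α) (comps α) (comps β) * volDensity α := by
  obtain ⟨B, hB, htr⟩ := exists_act_eq hα β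
  rw [htr]
  conv_lhs => rw [← hB]
  refine fderiv_act ((contDiffAt_volDensity hα).differentiableAt (by simp)) B
    (φ := fun t => |(1 + t • mat B).det| * volDensity α) ?_ ?_
  · have h1 : HasDerivAt (fun t : ℝ => (1 + t • mat B).det) (mat B).trace 0 := by
      obtain ⟨p, hp⟩ : ∃ p : Polynomial ℝ, ∀ t : ℝ, (1 + t • mat B).det
          = 1 + (mat B).trace * t + p.eval t * t ^ 2 := ⟨_, fun t => Matrix.det_one_add_smul t _⟩
      simp only [hp]
      have h1 := ((hasDerivAt_id (0 : ℝ)).const_mul (mat B).trace).const_add 1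
      have h2 := (p.hasDerivAt (0 : ℝ)).mul ((hasDerivAt_id (0 : ℝ)).pow 2)
      exact (h1.add h2).congr_deriv (by simp)
    have h2 : HasDerivAt (fun t : ℝ => |(1 + t • mat B).det|) (mat B).trace 0 := by
      refine h1.congr_of_eventuallyEq ?_
      have : ∀ᶠ t : ℝ in 𝓝 0, 0 < (1 + t • mat B).det :=
        h1.continuousAt.eventually (lt_mem_nhds (by simp))
      filter_upwards [this] with t ht
      exact abs_of_pos ht
    exact (h2.mul_const (volDensity α)).congr_deriv (by ring)
  · intro t e he
    rw [volDensity, gram_pullback hα, he, mat_id_add_smul, Matrix.det_mul, Matrix.det_mul,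
      Matrix.det_transpose, mul_right_comm, ← pow_two, Real.sqrt_mul (sq_nonneg _), Real.sqrt_sq_eq_abs]
    rfl

/-- A direction in which the metric does not change is given by a skew endomorphism. -/
lemma exists_act_eq_of_fderiv_gram_eq_zero {α β : Form3} (hα : IsPositive α)
    (h : ∀ i j, fderiv ℝ (fun γ => gram γ i j) α β = 0) :
    ∃ B : E7 →L[ℝ] E7, act α B = β ∧ (mat B)ᵀ * gram α + gram α * mat B = 0 := by
  obtain ⟨B, hB, -⟩ := exists_act_eq hα β
  refine ⟨B, hB, ?_⟩
  ext i j
  rw [← fderiv_gram_act hα, hB, h]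
  rfl

/-- Multiplication by `r` on `ℝ⁷` pulls `α` back to `r³ α` and scales the metric by `r²`. Cubes of
`r` are used throughout to avoid fractional powers. -/
lemma gram_cube_smul (α : Form3) {r : ℝ} (hr : 0 < r) : gram (r ^ 3 • α) = r ^ 2 • gram α := by
  let K : E7 ≃L[ℝ] E7 := ContinuousLinearEquiv.smulLeft (Units.mk0 r hr.ne')
  have hK : (K : E7 →L[ℝ] E7) = r • ContinuousLinearMap.id ℝ E7 := rfl
  have h1 : r ^ 3 • α = α.compContinuousLinearMap (K : E7 →L[ℝ] E7) := by
    refine form3_ext fun i j k => ?_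
    rw [pullback_apply, hK]
    have := α.toMultilinearMap.map_smul_univ (fun _ => r) ![stdVec i, stdVec j, stdVec k]
    simp only [Finset.prod_const, Finset.card_univ, Fintype.card_fin] at this
    refine this.symm.trans ?_
    change α _ = α _
    congr 1
    ext a : 1
    fin_cases a <;> rfl
  rw [h1, gram_pullback', hK, mat_smul, mat_id]
  simp [smul_smul, pow_two]

/-! ### Torsion as a function of the 1-jet of a form -/

/-- First derivative of the metric in terms of the 1-jet `(α, P)` of a form. -/
def gramJet (α : Form3) (P : E7 →L[ℝ] Form3) (i j l : Fin 7) : ℝ :=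
  fderiv ℝ (fun γ => gram γ j l) α (P (stdVec i))

/-- Christoffel symbols in terms of the 1-jet of a form. -/
def christoffelJet (α : Form3) (P : E7 →L[ℝ] Form3) (k i j : Fin 7) : ℝ :=
  (1 / 2) * ∑ l, (gram α)⁻¹ k l * (gramJet α P i j l + gramJet α P j i l - gramJet α P l i j)

/-- The endomorphism `Γ_i` given by the Christoffel symbols. -/
def christoffelEnd (α : Form3) (P : E7 →L[ℝ] Form3) (i : Fin 7) : E7 →L[ℝ] E7 :=
  ofMat (Matrix.of fun k j => christoffelJet α P k i j)

/-- The covariant derivative in terms of the 1-jet of a form. -/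
def nablaJet (α : Form3) (P : E7 →L[ℝ] Form3) (i : Fin 7) : Form3 :=
  P (stdVec i) - act α (christoffelEnd α P i)

/-- The codifferential in terms of the 1-jet of a form. -/
def codiffJet (α : Form3) (P : E7 →L[ℝ] Form3) (J : Fin 2 → Fin 7) : ℝ :=
  - ∑ i, ∑ l, (gram α)⁻¹ i l * comps (nablaJet α P i) (Fin.cons l J)

/-- The norm of the torsion in terms of the 1-jet of a form. -/
def torsionJet (α : Form3) (P : E7 →L[ℝ] Form3) : ℝ :=
  formInner (gram α) (comps (ContinuousAlternatingMap.alternatizeUncurryFin P))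
      (comps (ContinuousAlternatingMap.alternatizeUncurryFin P))
    + formInner (gram α) (codiffJet α P) (codiffJet α P)

lemma comps_act (α : Form3) (A : E7 →L[ℝ] E7) (I : Fin 3 → Fin 7) :
    comps (act α A) I = ∑ a, ∑ l, mat A l (I a) * comps α (Function.update I a l) := by
  rw [comps, act_apply_update]
  refine Finset.sum_congr rfl fun a _ => ?_
  have h1 : A (stdVec (I a)) = ∑ l, mat A l (I a) • stdVec l := (sum_smul_stdVec _).symm
  rw [h1]
  have h2 := α.toMultilinearMap.map_update_sum Finset.univ a
    (fun l => mat A l (I a) • stdVec l) fun b => stdVec (I b)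
  refine h2.trans (Finset.sum_congr rfl fun l _ => ?_)
  refine (α.toMultilinearMap.map_update_smul _ a _ _).trans ?_
  rw [smul_eq_mul, comps]
  congr 1
  change α _ = α _
  congr 1
  ext b : 1
  by_cases hb : b = a
  · subst hb; simp
  · simp [hb]

section Local

variable {w : E7 → Form3} {y : E7}

lemma pd_gram (hw : DifferentiableAt ℝ w y) (hp : IsPositive (w y)) (i j l : Fin 7) :
    pd (fun z => gram (w z) j l) y i = gramJet (w y) (fderiv ℝ w y) i j l := by
  have h := ((contDiffAt_gram hp j l).differentiableAt (by simp)).hasFDerivAt.comp y hw.hasFDerivAt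
  rw [pd, gramJet]
  change fderiv ℝ ((fun γ => gram γ j l) ∘ w) y (stdVec i) = _
  rw [h.fderiv]
  rfl

lemma christoffel_eq (hw : DifferentiableAt ℝ w y) (hp : IsPositive (w y)) (k i j : Fin 7) :
    christoffel w y k i j = christoffelJet (w y) (fderiv ℝ w y) k i j := by
  simp only [christoffel, pd_gram hw hp, christoffelJet]

lemma nabla_eq (hw : DifferentiableAt ℝ w y) (hp : IsPositive (w y)) (i : Fin 7)
    (I : Fin 3 → Fin 7) : nabla w y i I = comps (nablaJet (w y) (fderiv ℝ w y) i) I := by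
  have h1 : comps (nablaJet (w y) (fderiv ℝ w y) i) I = comps (fderiv ℝ w y (stdVec i)) I
      - comps (act (w y) (christoffelEnd (w y) (fderiv ℝ w y) i)) I := rfl
  have h2 : pd (fun z => comps (w z) I) y i = comps (fderiv ℝ w y (stdVec i)) I := by
    have := hw.hasFDerivAt.continuousAlternatingMap_apply_const (fun a => stdVec (I a))
    rw [pd]
    change fderiv ℝ (fun z => w z fun a => stdVec (I a)) y (stdVec i) = _
    rw [this.fderiv]
    rfl
  rw [h1, comps_act, nabla, h2, christoffelEnd, mat_ofMat]
  simp only [christoffel_eq hw hp, Matrix.of_apply]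

lemma codiff_eq (hw : DifferentiableAt ℝ w y) (hp : IsPositive (w y)) (J : Fin 2 → Fin 7) :
    codiff w y J = codiffJet (w y) (fderiv ℝ w y) J := by
  simp only [codiff, codiffJet, nabla_eq hw hp]

/-- The energy density thereby becomes a function on the space of 1-jets, and its first variation
becomes an application of the chain rule. -/
lemma torsionSq_eq (hw : DifferentiableAt ℝ w y) (hp : IsPositive (w y)) :
    torsionSq w y = torsionJet (w y) (fderiv ℝ w y) := by
  have h : codiff w y = codiffJet (w y) (fderiv ℝ w y) := funext fun J => codiff_eq hw hp J
  rw [torsionSq, torsionJet, h]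
  rfl

end Local

/-! ### Smoothness of the torsion -/

lemma contDiffAt_formInner {E : Type*} [NormedAddCommGroup E] [NormedSpace ℝ E] {k : ℕ}
    {α : E → Form3} {ξ : E → (Fin k → Fin 7) → ℝ} {x : E} (hα : ContDiffAt ℝ ∞ α x)
    (hp : IsPositive (α x)) (hξ : ∀ I, ContDiffAt ℝ ∞ (fun y => ξ y I) x) :
    ContDiffAt ℝ ∞ (fun y => formInner (gram (α y)) (ξ y) (ξ y)) x := by
  have hg : ∀ i j, ContDiffAt ℝ ∞ (fun y => (gram (α y))⁻¹ i j) x :=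
    contDiffAt_matrix_inv (fun i j => (contDiffAt_gram hp i j).comp x hα) (det_gram_pos hp).ne'
  refine contDiffAt_const.mul (ContDiffAt.sum fun I _ => ContDiffAt.sum fun J _ => ?_)
  exact ((contDiffAt_prod fun a _ => hg _ _).mul (hξ I)).mul (hξ J)

lemma contDiffAt_torsionJet {p : Form3 × (E7 →L[ℝ] Form3)} (hp : IsPositive p.1) :
    ContDiffAt ℝ ∞ (fun q : Form3 × (E7 →L[ℝ] Form3) => torsionJet q.1 q.2) p := by
  have hg : ∀ i j, ContDiffAt ℝ ∞ (fun q : Form3 × (E7 →L[ℝ] Form3) => (gram q.1)⁻¹ i j) p :=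
    contDiffAt_matrix_inv (fun i j => (contDiffAt_gram hp i j).comp p contDiffAt_fst)
      (det_gram_pos hp).ne'
  have hP : ∀ i, ContDiffAt ℝ ∞ (fun q : Form3 × (E7 →L[ℝ] Form3) => q.2 (stdVec i)) p :=
    fun i => contDiffAt_snd.clm_apply contDiffAt_const
  have hdg : ∀ i j l, ContDiffAt ℝ ∞
      (fun q : Form3 × (E7 →L[ℝ] Form3) => gramJet q.1 q.2 i j l) p := by
    intro i j l
    have h1 : ContDiffAt ℝ ∞ (fderiv ℝ fun γ => gram γ j l) p.1 :=
      (contDiffAt_gram hp j l).fderiv_right (by simp)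
    exact (h1.comp p contDiffAt_fst).clm_apply (hP i)
  have hΓ : ∀ k i j, ContDiffAt ℝ ∞
      (fun q : Form3 × (E7 →L[ℝ] Form3) => christoffelJet q.1 q.2 k i j) p := fun k i j =>
    contDiffAt_const.mul (ContDiffAt.sum fun l _ =>
      (hg k l).mul (((hdg i j l).add (hdg j i l)).sub (hdg l i j)))
  have hev : ∀ {k : ℕ} (v : Fin k → E7), ContDiff ℝ ∞ fun β : E7 [⋀^Fin k]→L[ℝ] ℝ => β v :=
    fun v => (ContinuousAlternatingMap.apply ℝ E7 ℝ v).contDiff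
  have hn : ∀ i I, ContDiffAt ℝ ∞
      (fun q : Form3 × (E7 →L[ℝ] Form3) => comps (nablaJet q.1 q.2 i) I) p := by
    intro i I
    have : (fun q : Form3 × (E7 →L[ℝ] Form3) => comps (nablaJet q.1 q.2 i) I) = fun q =>
        comps (q.2 (stdVec i)) I - ∑ a : Fin 3, ∑ l, christoffelJet q.1 q.2 l i (I a)
          * comps q.1 (Function.update I a l) := by
      ext q
      change comps (q.2 (stdVec i)) I - comps (act q.1 (christoffelEnd q.1 q.2 i)) I = _
      rw [comps_act, christoffelEnd, mat_ofMat]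
      rfl
    rw [this]
    exact ((hev _).contDiffAt.comp p (hP i)).sub (ContDiffAt.sum fun a _ => ContDiffAt.sum fun l _ =>
      (hΓ _ _ _).mul ((hev _).contDiffAt.comp p contDiffAt_fst))
  refine (contDiffAt_formInner contDiffAt_fst hp fun I => ?_).add
    (contDiffAt_formInner contDiffAt_fst hp fun J => ?_)
  · simp only [comps, ContinuousAlternatingMap.alternatizeUncurryFin_apply]
    exact ContDiffAt.sum fun i _ => ((hev _).contDiffAt.comp p (hP _)).const_smul _
  · exact (ContDiffAt.sum fun i _ => ContDiffAt.sum fun l _ => (hg i l).mul (hn i _)).neg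

/-! ### The Levi-Civita connection -/

lemma gramJet_symm (α : Form3) (P : E7 →L[ℝ] Form3) (i j l : Fin 7) :
    gramJet α P i j l = gramJet α P i l j := by
  have : (fun γ : Form3 => gram γ j l) = fun γ => gram γ l j := by
    ext γ
    rw [← gram_transpose γ, Matrix.transpose_apply, gram_transpose]
  rw [gramJet, gramJet, this]

lemma christoffelJet_symm (α : Form3) (P : E7 →L[ℝ] Form3) (k i j : Fin 7) :
    christoffelJet α P k i j = christoffelJet α P k j i := by
  simp only [christoffelJet, gramJet_symm α P _ i j]
  congr 1
  exact Finset.sum_congr rfl fun l _ => by ring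

lemma gram_mul_christoffelEnd {α : Form3} (hα : IsPositive α) (P : E7 →L[ℝ] Form3)
    (i j l : Fin 7) : (gram α * mat (christoffelEnd α P i)) l j
      = 1 / 2 * (gramJet α P i j l + gramJet α P j i l - gramJet α P l i j) := by
  have h1 : mat (christoffelEnd α P i) = (gram α)⁻¹ * Matrix.of fun l j =>
      1 / 2 * (gramJet α P i j l + gramJet α P j i l - gramJet α P l i j) := by
    rw [christoffelEnd, mat_ofMat]
    ext k j
    simp only [Matrix.of_apply, Matrix.mul_apply, christoffelJet, Finset.mul_sum]
    exact Finset.sum_congr rfl fun l _ => by ring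
  rw [h1, Matrix.mul_nonsing_inv_cancel_left _ _ (det_gram_pos hα).ne'.isUnit]
  rfl

/-- Metric compatibility: when the Koszul expression is added to its transpose, only the `i`-th
derivative of the metric survives. -/
lemma christoffelEnd_metric {α : Form3} (hα : IsPositive α) (P : E7 →L[ℝ] Form3)
    (i j l : Fin 7) : ((mat (christoffelEnd α P i))ᵀ * gram α
      + gram α * mat (christoffelEnd α P i)) j l = gramJet α P i j l := by
  have h : (mat (christoffelEnd α P i))ᵀ * gram α = (gram α * mat (christoffelEnd α P i))ᵀ := by
    rw [Matrix.transpose_mul, gram_transpose]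
  rw [h, Matrix.add_apply, Matrix.transpose_apply, gram_mul_christoffelEnd hα,
    gram_mul_christoffelEnd hα]
  linarith [gramJet_symm α P i l j, gramJet_symm α P j i l, gramJet_symm α P l i j]

/-- The covariant derivative of a positive form does not change the metric. -/
lemma fderiv_gram_nablaJet {α : Form3} (hα : IsPositive α) (P : E7 →L[ℝ] Form3) (i j l : Fin 7) :
    fderiv ℝ (fun γ => gram γ j l) α (nablaJet α P i) = 0 := by
  rw [nablaJet, map_sub, fderiv_gram_act hα, christoffelEnd_metric hα, gramJet, sub_self]

/-- A torsion-free connection which preserves the form is its Levi-Civita connection. -/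
lemma nablaJet_eq_zero {α : Form3} (hα : IsPositive α) {P : E7 →L[ℝ] Form3}
    {Γ : E7 → E7 →L[ℝ] E7} (hsymm : ∀ u v, Γ u v = Γ v u) (hP : ∀ v, P v = act α (Γ v))
    (i : Fin 7) : nablaJet α P i = 0 := by
  have hg : ∀ i j l, gramJet α P i j l
      = (gram α * mat (Γ (stdVec i))) l j + (gram α * mat (Γ (stdVec i))) j l := by
    intro i j l
    have h : (mat (Γ (stdVec i)))ᵀ * gram α = (gram α * mat (Γ (stdVec i)))ᵀ := by
      rw [Matrix.transpose_mul, gram_transpose]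
    rw [gramJet, hP, fderiv_gram_act hα, h]
    rfl
  have hs : ∀ i j l, (gram α * mat (Γ (stdVec i))) l j = (gram α * mat (Γ (stdVec j))) l i := by
    intro i j l
    simp only [Matrix.mul_apply, mat, Matrix.of_apply, hsymm (stdVec i) (stdVec j)]
  have h1 : gram α * mat (christoffelEnd α P i) = gram α * mat (Γ (stdVec i)) := by
    ext l j
    rw [gram_mul_christoffelEnd hα, hg, hg, hg, hs i j l, hs i l j, hs j l i]
    ring
  have h2 : mat (christoffelEnd α P i) = mat (Γ (stdVec i)) := by
    have := congrArg ((gram α)⁻¹ * ·) h1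
    simpa only [Matrix.nonsing_inv_mul_cancel_left _ _ (det_gram_pos hα).ne'.isUnit] using this
  have h3 : christoffelEnd α P i = Γ (stdVec i) := by
    rw [← ofMat_mat (christoffelEnd α P i), h2, ofMat_mat]
  rw [nablaJet, hP, h3, sub_self]

/-! ### Closed and coclosed implies parallel -/

/-- Since `𝔰𝔬(7) = 𝔤₂ ⊕ ℝ⁷` and `𝔤₂` kills `stdForm`, the result depends on `B` only through a
vector: up to sign it is the contraction of that vector with the dual 4-form. If `{i, j, k}` is not
a Fano line, `third (third j k) i` is the index completing it to the complement of a line; if it is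
one, that index is `i` and `fanoSign i i = 0`. -/
lemma coef_act_stdForm_of_skew {B : E7 →L[ℝ] E7} (hB : (mat B)ᵀ + mat B = 0) {i j k : Fin 7}
    (hij : i < j) (hjk : j < k) : coef (act stdForm B) i j k =
      fanoSign j k * fanoSign (third (third j k) i) i *
        (1 / 2 * ∑ m, fanoSign (third (third j k) i) m *
          mat B (third (third (third j k) i) m) m) := by
  have h : ∀ a b : Fin 7, a ≤ b → mat B b a = -mat B a b := fun a b _ => by
    have := congrFun (congrFun hB a) b
    simp only [Matrix.add_apply, Matrix.transpose_apply, Matrix.zero_apply] at this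
    linarith
  have h0 : ∀ a : Fin 7, mat B a a = 0 := fun a => by linarith [h a a le_rfl]
  rw [coef_act_stdForm]
  simp only [Fin.sum_univ_seven]
  generalize mat B = A at *
  have h' : ∀ a b : Fin 7, a < b → A b a = -A a b := fun a b hab => h a b hab.le
  clear h hB
  fin_cases i <;> fin_cases j <;> first | (exfalso; revert hij; decide) | skip
  all_goals fin_cases k <;> first | (exfalso; revert hjk; decide) | skip
  all_goals
    simp [fanoSign, third, h', h0]
    try ring

/-- The Fernández–Gray argument in coordinates: the 49 unknowns `t m q` satisfy 35 equations from
the alternation and 21 from the trace. The system splits into a diagonal block, with one alternation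
equation for each line complement, and seven blocks of six unknowns, collecting the pairs `m ≠ q`
with a fixed `third m q`; each of these has four alternation and three trace equations. -/
lemma eq_zero_of_closed_of_coclosed_stdForm {t : Fin 7 → Fin 7 → ℝ} {N : Fin 7 → Form3}
    (hN : ∀ m {i j k : Fin 7}, i < j → j < k → coef (N m) i j k =
      fanoSign j k * fanoSign (third (third j k) i) i * t m (third (third j k) i))
    (halt : ∀ i j k l, coef (N i) j k l - coef (N j) i k l + coef (N k) i j l
      - coef (N l) i j k = 0)
    (htr : ∀ p q, ∑ m, coef (N m) m p q = 0) (m q : Fin 7) : t m q = 0 := by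
  have g0 : t 0 0 = 0 ∧ t 1 1 = 0 ∧ t 2 2 = 0 ∧ t 3 3 = 0 ∧ t 4 4 = 0 ∧ t 5 5 = 0 ∧ t 6 6 = 0 := by
    have a1 := halt 0 1 3 6
    have a2 := halt 0 1 4 5
    have a3 := halt 0 2 3 5
    have a4 := halt 0 2 4 6
    have a5 := halt 1 2 3 4
    have a6 := halt 1 2 5 6
    have a7 := halt 3 4 5 6
    simp [hN, fanoSign, third] at a1 a2 a3 a4 a5 a6 a7
    refine ⟨?_, ?_, ?_, ?_, ?_, ?_, ?_⟩ <;> linarith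
  have g1 : t 1 2 = 0 ∧ t 2 1 = 0 ∧ t 3 4 = 0 ∧ t 4 3 = 0 ∧ t 5 6 = 0 ∧ t 6 5 = 0 := by
    have a1 := halt 0 1 3 5
    have a2 := halt 0 1 4 6
    have a3 := halt 0 2 3 6
    have a4 := halt 0 2 4 5
    have b1 := htr 1 2
    have b2 := htr 3 4
    have b3 := htr 5 6
    simp [hN, fanoSign, third] at a1 a2 a3 a4
    simp [hN, fanoSign, third, Fin.sum_univ_seven, coef_swap12_of_lt, coef_swap23_of_lt,
      coef_self12, coef_self23] at b1 b2 b3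
    refine ⟨?_, ?_, ?_, ?_, ?_, ?_⟩ <;> linarith
  have g2 : t 0 2 = 0 ∧ t 2 0 = 0 ∧ t 3 5 = 0 ∧ t 4 6 = 0 ∧ t 5 3 = 0 ∧ t 6 4 = 0 := by
    have a1 := halt 0 1 3 4
    have a2 := halt 0 1 5 6
    have a3 := halt 1 2 3 6
    have a4 := halt 1 2 4 5
    have b1 := htr 0 2
    have b2 := htr 3 5
    have b3 := htr 4 6
    simp [hN, fanoSign, third] at a1 a2 a3 a4
    simp [hN, fanoSign, third, Fin.sum_univ_seven, coef_swap12_of_lt, coef_swap23_of_lt,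
      coef_self12, coef_self23] at b1 b2 b3
    refine ⟨?_, ?_, ?_, ?_, ?_, ?_⟩ <;> linarith
  have g3 : t 0 1 = 0 ∧ t 1 0 = 0 ∧ t 3 6 = 0 ∧ t 4 5 = 0 ∧ t 5 4 = 0 ∧ t 6 3 = 0 := by
    have a1 := halt 0 2 3 4
    have a2 := halt 0 2 5 6
    have a3 := halt 1 2 3 5
    have a4 := halt 1 2 4 6
    have b1 := htr 0 1
    have b2 := htr 3 6
    have b3 := htr 4 5
    simp [hN, fanoSign, third] at a1 a2 a3 a4
    simp [hN, fanoSign, third, Fin.sum_univ_seven, coef_swap12_of_lt, coef_swap23_of_lt,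
      coef_self12, coef_self23] at b1 b2 b3
    refine ⟨?_, ?_, ?_, ?_, ?_, ?_⟩ <;> linarith
  have g4 : t 0 4 = 0 ∧ t 1 5 = 0 ∧ t 2 6 = 0 ∧ t 4 0 = 0 ∧ t 5 1 = 0 ∧ t 6 2 = 0 := by
    have a1 := halt 0 1 2 3
    have a2 := halt 0 3 5 6
    have a3 := halt 1 3 4 6
    have a4 := halt 2 3 4 5
    have b1 := htr 0 4
    have b2 := htr 1 5
    have b3 := htr 2 6
    simp [hN, fanoSign, third] at a1 a2 a3 a4
    simp [hN, fanoSign, third, Fin.sum_univ_seven, coef_swap12_of_lt, coef_swap23_of_lt,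
      coef_self12, coef_self23] at b1 b2 b3
    refine ⟨?_, ?_, ?_, ?_, ?_, ?_⟩ <;> linarith
  have g5 : t 0 3 = 0 ∧ t 1 6 = 0 ∧ t 2 5 = 0 ∧ t 3 0 = 0 ∧ t 5 2 = 0 ∧ t 6 1 = 0 := by
    have a1 := halt 0 1 2 4
    have a2 := halt 0 4 5 6
    have a3 := halt 1 3 4 5
    have a4 := halt 2 3 4 6
    have b1 := htr 0 3
    have b2 := htr 1 6
    have b3 := htr 2 5
    simp [hN, fanoSign, third] at a1 a2 a3 a4
    simp [hN, fanoSign, third, Fin.sum_univ_seven, coef_swap12_of_lt, coef_swap23_of_lt,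
      coef_self12, coef_self23] at b1 b2 b3
    refine ⟨?_, ?_, ?_, ?_, ?_, ?_⟩ <;> linarith
  have g6 : t 0 6 = 0 ∧ t 1 3 = 0 ∧ t 2 4 = 0 ∧ t 3 1 = 0 ∧ t 4 2 = 0 ∧ t 6 0 = 0 := by
    have a1 := halt 0 1 2 5
    have a2 := halt 0 3 4 5
    have a3 := halt 1 4 5 6
    have a4 := halt 2 3 5 6
    have b1 := htr 0 6
    have b2 := htr 1 3
    have b3 := htr 2 4
    simp [hN, fanoSign, third] at a1 a2 a3 a4
    simp [hN, fanoSign, third, Fin.sum_univ_seven, coef_swap12_of_lt, coef_swap23_of_lt,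
      coef_self12, coef_self23] at b1 b2 b3
    refine ⟨?_, ?_, ?_, ?_, ?_, ?_⟩ <;> linarith
  have g7 : t 0 5 = 0 ∧ t 1 4 = 0 ∧ t 2 3 = 0 ∧ t 3 2 = 0 ∧ t 4 1 = 0 ∧ t 5 0 = 0 := by
    have a1 := halt 0 1 2 6
    have a2 := halt 0 3 4 6
    have a3 := halt 1 3 5 6
    have a4 := halt 2 4 5 6
    have b1 := htr 0 5
    have b2 := htr 1 4
    have b3 := htr 2 3
    simp [hN, fanoSign, third] at a1 a2 a3 a4
    simp [hN, fanoSign, third, Fin.sum_univ_seven, coef_swap12_of_lt, coef_swap23_of_lt,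
      coef_self12, coef_self23] at b1 b2 b3
    refine ⟨?_, ?_, ?_, ?_, ?_, ?_⟩ <;> linarith
  fin_cases m <;> fin_cases q <;> simp [g0, g1, g2, g3, g4, g5, g6, g7]

/-! ### Transport to an arbitrary positive form -/

lemma coef_pullback (β : Form3) (L : E7 →L[ℝ] E7) (i j k : Fin 7) :
    coef (β.compContinuousLinearMap L) i j k
      = ∑ a, ∑ b, ∑ c, mat L a i * mat L b j * mat L c k * coef β a b c := by
  rw [← comps_vec3, comps_pullback]
  simp only [Matrix.mulVec, dotProduct, sum_fin3, comps_vec3, Matrix.transpose_apply, tensorPow,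
    Matrix.of_apply, Fin.prod_univ_three]
  rfl

/-- Terms with a symmetric `Γ` cancel in pairs. This is why the exterior derivative is the
alternation of the covariant derivative of any torsion-free connection. -/
lemma alternate_act_eq_zero (α : Form3) {Γ : Fin 7 → E7 →L[ℝ] E7}
    (hΓ : ∀ i j, Γ i (stdVec j) = Γ j (stdVec i)) (I : Fin 4 → Fin 7) :
    ∑ a : Fin 4, (-1 : ℝ) ^ (a : ℕ) *
      act α (Γ (I a)) (a.removeNth fun b => stdVec (I b)) = 0 := by
  have e0 : ((0 : Fin 4).removeNth fun b => stdVec (I b))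
      = ![stdVec (I 1), stdVec (I 2), stdVec (I 3)] := by
    ext a : 1; fin_cases a <;> rfl
  have e1 : ((1 : Fin 4).removeNth fun b => stdVec (I b))
      = ![stdVec (I 0), stdVec (I 2), stdVec (I 3)] := by
    ext a : 1; fin_cases a <;> rfl
  have e2 : ((2 : Fin 4).removeNth fun b => stdVec (I b))
      = ![stdVec (I 0), stdVec (I 1), stdVec (I 3)] := by
    ext a : 1; fin_cases a <;> rfl
  have e3 : ((3 : Fin 4).removeNth fun b => stdVec (I b))
      = ![stdVec (I 0), stdVec (I 1), stdVec (I 2)] := by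
    ext a : 1; fin_cases a <;> rfl
  rw [Fin.sum_univ_four, e0, e1, e2, e3]
  simp only [act_apply]
  rw [hΓ (I 1) (I 0), hΓ (I 2) (I 0), hΓ (I 3) (I 0), hΓ (I 2) (I 1), hΓ (I 3) (I 1),
    hΓ (I 3) (I 2)]
  simp only [Fin.val_zero, Fin.val_one, Fin.val_two, pow_zero, pow_one]
  rw [form3_swap12 α (stdVec (I 1)) (Γ (I 0) (stdVec (I 2))),
    form3_swap23 α (stdVec (I 1)) (stdVec (I 2)) (Γ (I 0) (stdVec (I 3))),
    form3_swap12 α (stdVec (I 1)) (Γ (I 0) (stdVec (I 3))),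
    form3_swap12 α (stdVec (I 0)) (Γ (I 1) (stdVec (I 2))),
    form3_swap23 α (stdVec (I 0)) (stdVec (I 2)) (Γ (I 1) (stdVec (I 3))),
    form3_swap12 α (stdVec (I 0)) (Γ (I 1) (stdVec (I 3))),
    form3_swap23 α (stdVec (I 0)) (stdVec (I 1)) (Γ (I 2) (stdVec (I 3))),
    form3_swap12 α (stdVec (I 0)) (Γ (I 2) (stdVec (I 3)))]
  have h3 : ((3 : Fin 4) : ℕ) = 3 := rfl
  rw [h3]
  ring

lemma form_eq_zero_of_comps {k : ℕ} {β : E7 [⋀^Fin k]→L[ℝ] ℝ} (h : comps β = 0) : β = 0 := by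
  apply ContinuousAlternatingMap.toAlternatingMap_injective
  refine Module.Basis.ext_alternating (EuclideanSpace.basisFun (Fin 7) ℝ).toBasis fun v _ => ?_
  have e : (fun i => (EuclideanSpace.basisFun (Fin 7) ℝ).toBasis (v i)) = fun i => stdVec (v i) := by
    ext a : 1
    simp [stdVec]
  rw [e]
  exact congrFun h v

/-- The linear map with prescribed values on the standard basis. -/
def ofValues {F : Type*} [NormedAddCommGroup F] [NormedSpace ℝ F] (N : Fin 7 → F) : E7 →L[ℝ] F :=
  ∑ i, (EuclideanSpace.proj i : E7 →L[ℝ] ℝ).smulRight (N i)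

lemma ofValues_apply {F : Type*} [NormedAddCommGroup F] [NormedSpace ℝ F] (N : Fin 7 → F) (x : E7) :
    ofValues N x = ∑ i, x i • N i := by
  simp [ofValues]

lemma ofValues_stdVec {F : Type*} [NormedAddCommGroup F] [NormedSpace ℝ F] (N : Fin 7 → F)
    (i : Fin 7) : ofValues N (stdVec i) = N i := by
  simp [ofValues_apply, stdVec_apply]

lemma sum_sum_mul_comm {ι : Type*} [Fintype ι] (u : ι → ι → ℝ) (v : ι → ι → ι → ι → ℝ) :
    ∑ m, ∑ a, ∑ b, ∑ c, u b c * v m a b c = ∑ b, ∑ c, u b c * ∑ m, ∑ a, v m a b c := by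
  simp only [Finset.mul_sum]
  rw [Finset.sum_congr rfl fun m _ => Finset.sum_comm, Finset.sum_comm]
  refine Finset.sum_congr rfl fun b _ => ?_
  rw [Finset.sum_congr rfl fun m _ => Finset.sum_comm, Finset.sum_comm]

/-- If the covariant derivative `N` of a positive form has no alternating part and no trace, then
it vanishes. -/
lemma eq_zero_of_closed_of_coclosed {α : Form3} (hα : IsPositive α) {N : Fin 7 → Form3}
    (hg : ∀ m i j, fderiv ℝ (fun γ => gram γ i j) α (N m) = 0)
    (halt : ContinuousAlternatingMap.alternatizeUncurryFin (ofValues N) = 0)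
    (htr : ∀ p q, ∑ i, ∑ l, (gram α)⁻¹ i l * coef (N i) l p q = 0) (m : Fin 7) : N m = 0 := by
  choose B hB hBskew using fun m => exists_act_eq_of_fderiv_gram_eq_zero hα (hg m)
  obtain ⟨f, hf⟩ := hα
  set L : E7 →L[ℝ] E7 := (f : E7 →L[ℝ] E7)
  set K : E7 →L[ℝ] E7 := (f.symm : E7 →L[ℝ] E7)
  have hf' : stdForm.compContinuousLinearMap L = α := hf
  have hLK : L.comp K = ContinuousLinearMap.id ℝ E7 := f.coe_comp_coe_symm
  have hKL : K.comp L = ContinuousLinearMap.id ℝ E7 := f.coe_symm_comp_coe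
  have hLK' : ∀ x, L (K x) = x := fun x => f.apply_symm_apply x
  have hKL' : ∀ x, K (L x) = x := fun x => f.symm_apply_apply x
  have hmLK : mat L * mat K = 1 := mat_equiv_mul_symm f
  have hgram : gram α = (mat L)ᵀ * mat L := gram_eq_of_isCoframe hf
  -- Both the differentiation index and the form are transported to the coframe, so that `n` is a
  -- covariant derivative at `stdForm` with the Euclidean metric. `C` transports the skew
  -- endomorphisms accordingly.
  set n : Fin 7 → Form3 := fun m => (ofValues N (K (stdVec m))).compContinuousLinearMap K with hn
  set C : Fin 7 → (E7 →L[ℝ] E7) := fun m => L.comp ((ofValues B (K (stdVec m))).comp K) with hC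
  have hnC : ∀ m, n m = act stdForm (C m) := by
    intro m
    have h1 : ofValues N (K (stdVec m)) = act α (ofValues B (K (stdVec m))) := by
      simp only [ofValues_apply, map_sum, map_smul, hB]
    refine form3_ext fun i j k => ?_
    rw [hn]
    simp only
    rw [pullback_apply, h1, act_apply, act_apply, ← hf']
    simp only [pullback_apply, hLK']
    rfl
  have hCskew : ∀ m, (mat (C m))ᵀ + mat (C m) = 0 := by
    intro m
    have h1 : (mat (ofValues B (K (stdVec m))))ᵀ * gram α
        + gram α * mat (ofValues B (K (stdVec m))) = 0 := by
      have : mat (ofValues B (K (stdVec m))) = ∑ i, (K (stdVec m)) i • mat (B i) := by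
        rw [ofValues_apply]
        ext a b
        simp [mat, Matrix.sum_apply]
      rw [this, Matrix.transpose_sum, Finset.sum_mul, Finset.mul_sum, ← Finset.sum_add_distrib]
      refine Finset.sum_eq_zero fun i _ => ?_
      rw [Matrix.transpose_smul, smul_mul_assoc, mul_smul_comm, ← smul_add, hBskew, smul_zero]
    have h2 := congrArg (fun A => (mat K)ᵀ * A * mat K) h1
    have h3 : (mat K)ᵀ * (mat L)ᵀ = 1 := by rw [← Matrix.transpose_mul, hmLK, Matrix.transpose_one]
    simp only [hgram, mul_add, add_mul, mul_zero, zero_mul] at h2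
    simp only [hC, mat_comp, Matrix.transpose_mul]
    have e1 : (mat K)ᵀ * ((mat (ofValues B (K (stdVec m))))ᵀ * ((mat L)ᵀ * mat L)) * mat K
        = (mat K)ᵀ * (mat (ofValues B (K (stdVec m))))ᵀ * (mat L)ᵀ * (mat L * mat K) := by
      simp only [mul_assoc]
    have e2 : (mat K)ᵀ * ((mat L)ᵀ * mat L * mat (ofValues B (K (stdVec m)))) * mat K
        = ((mat K)ᵀ * (mat L)ᵀ) * (mat L * (mat (ofValues B (K (stdVec m))) * mat K)) := by
      simp only [mul_assoc]
    rw [e1, e2, hmLK, h3, mul_one, one_mul] at h2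
    exact h2
  have hz : ∀ m q, (1 / 2 * ∑ i, fanoSign q i * mat (C m) (third q i) i : ℝ) = 0 := by
    refine eq_zero_of_closed_of_coclosed_stdForm (N := n)
      (t := fun m q => 1 / 2 * ∑ i, fanoSign q i * mat (C m) (third q i) i) ?_ ?_ ?_
    · intro m i j k hij hjk
      rw [hnC, coef_act_stdForm_of_skew (hCskew m) hij hjk]
    · intro i j k l
      have h1 := congrArg (fun β : E7 [⋀^Fin (3 + 1)]→L[ℝ] ℝ =>
        β ![K (stdVec i), K (stdVec j), K (stdVec k), K (stdVec l)]) halt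
      simp only [ContinuousAlternatingMap.alternatizeUncurryFin_apply] at h1
      rw [Fin.sum_univ_four] at h1
      have e0 : (0 : Fin 4).removeNth ![K (stdVec i), K (stdVec j), K (stdVec k), K (stdVec l)]
          = ![K (stdVec j), K (stdVec k), K (stdVec l)] := by
        ext a : 1; fin_cases a <;> rfl
      have e1 : (1 : Fin 4).removeNth ![K (stdVec i), K (stdVec j), K (stdVec k), K (stdVec l)]
          = ![K (stdVec i), K (stdVec k), K (stdVec l)] := by
        ext a : 1; fin_cases a <;> rfl
      have e2 : (2 : Fin 4).removeNth ![K (stdVec i), K (stdVec j), K (stdVec k), K (stdVec l)]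
          = ![K (stdVec i), K (stdVec j), K (stdVec l)] := by
        ext a : 1; fin_cases a <;> rfl
      have e3 : (3 : Fin 4).removeNth ![K (stdVec i), K (stdVec j), K (stdVec k), K (stdVec l)]
          = ![K (stdVec i), K (stdVec j), K (stdVec k)] := by
        ext a : 1; fin_cases a <;> rfl
      rw [e0, e1, e2, e3] at h1
      simp only [coef, hn, pullback_apply]
      have h3 : ((3 : Fin 4) : ℕ) = 3 := rfl
      simp only [Fin.val_zero, Fin.val_one, Fin.val_two, h3, pow_zero, pow_one] at h1
      have h4 : ((-1 : ℤ) ^ 2) = 1 := by norm_num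
      have h5 : ((-1 : ℤ) ^ 3) = -1 := by norm_num
      simp only [h4, h5, one_smul, neg_smul] at h1
      simpa [sub_eq_add_neg] using h1
    · intro p q
      have hinv : (gram α)⁻¹ = mat K * (mat K)ᵀ := by
        rw [hgram]
        apply Matrix.inv_eq_right_inv
        calc (mat L)ᵀ * mat L * (mat K * (mat K)ᵀ) = (mat L)ᵀ * (mat L * mat K) * (mat K)ᵀ := by
              simp only [mul_assoc]
          _ = (mat K * mat L)ᵀ := by rw [hmLK, mul_one, Matrix.transpose_mul]
          _ = 1 := by rw [← mat_comp, hKL, mat_id, Matrix.transpose_one]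
      have h1 : ∀ b c, ∑ m, ∑ a, mat K a m * ∑ i, mat K i m * coef (N i) a b c = 0 := by
        intro b c
        rw [← htr b c, hinv]
        simp only [Matrix.mul_apply, Matrix.transpose_apply, Finset.sum_mul, Finset.mul_sum]
        rw [Finset.sum_comm]
        rw [Finset.sum_congr rfl fun a _ => Finset.sum_comm]
        rw [Finset.sum_comm]
        exact Finset.sum_congr rfl fun i _ => Finset.sum_congr rfl fun a _ =>
          Finset.sum_congr rfl fun m _ => by ring
      have h2 : ∀ m a b c, coef (ofValues N (K (stdVec m))) a b c
          = ∑ i, mat K i m * coef (N i) a b c := by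
        intro m a b c
        rw [ofValues_apply]
        simp [coef, mat]
      calc ∑ m, coef (n m) m p q
          = ∑ m, ∑ a, ∑ b, ∑ c, (mat K b p * mat K c q) *
            (mat K a m * ∑ i, mat K i m * coef (N i) a b c) := by
            refine Finset.sum_congr rfl fun m _ => ?_
            rw [hn]
            simp only
            rw [coef_pullback]
            refine Finset.sum_congr rfl fun a _ => Finset.sum_congr rfl fun b _ =>
              Finset.sum_congr rfl fun c _ => ?_
            rw [h2]
            ring
        _ = ∑ b, ∑ c, (mat K b p * mat K c q) *
            ∑ m, ∑ a, mat K a m * ∑ i, mat K i m * coef (N i) a b c := by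
            exact sum_sum_mul_comm _ _
        _ = 0 := by simp only [h1, mul_zero, Finset.sum_const_zero]
  have hn0 : ∀ m, n m = 0 := by
    intro m
    refine form3_ext_of_lt fun i j k hij hjk => ?_
    rw [hnC, coef_act_stdForm_of_skew (hCskew m) hij hjk, hz, mul_zero]
    rfl
  have hNK : ∀ m, ofValues N (K (stdVec m)) = 0 := by
    intro m
    have h1 : (n m).compContinuousLinearMap L = ofValues N (K (stdVec m)) := by
      rw [hn]
      simp only
      rw [← pullback_comp, hKL, pullback_id]
    rw [← h1, hn0]
    rfl
  rw [← ofValues_stdVec N m, ← hKL' (stdVec m), ← sum_smul_stdVec (L (stdVec m))]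
  simp only [map_sum, map_smul, hNK, smul_zero, Finset.sum_const_zero]

lemma sum_alternate_ofValues {P : E7 →L[ℝ] Form3} {N : Fin 7 → Form3} {α : Form3}
    {Γ : Fin 7 → E7 →L[ℝ] E7} (hΓ : ∀ i j, Γ i (stdVec j) = Γ j (stdVec i))
    (hN : ∀ i, N i = P (stdVec i) - act α (Γ i)) :
    comps (ContinuousAlternatingMap.alternatizeUncurryFin (ofValues N))
      = comps (ContinuousAlternatingMap.alternatizeUncurryFin P) := by
  ext I
  have h := alternate_act_eq_zero α hΓ I
  simp only [comps, ContinuousAlternatingMap.alternatizeUncurryFin_apply, ofValues_stdVec, hN,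
    ContinuousAlternatingMap.sub_apply, smul_sub, Finset.sum_sub_distrib]
  rw [sub_eq_self, ← h]
  exact Finset.sum_congr rfl fun a _ => by simp

lemma christoffelEnd_symm (α : Form3) (P : E7 →L[ℝ] Form3) (i j : Fin 7) :
    christoffelEnd α P i (stdVec j) = christoffelEnd α P j (stdVec i) := by
  ext k
  simp [christoffelEnd, ofMat_apply, stdVec_apply, christoffelJet_symm α P k i j]

lemma torsionJet_nonneg {α : Form3} (hα : IsPositive α) (P : E7 →L[ℝ] Form3) :
    0 ≤ torsionJet α P :=
  add_nonneg (formInner_self_nonneg hα _) (formInner_self_nonneg hα _)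

/-- By definiteness of the norms, vanishing means that the alternation and the trace of the
covariant derivative are zero. As that derivative does not vary the metric,
`eq_zero_of_closed_of_coclosed` applies. -/
lemma torsionJet_eq_zero_iff {α : Form3} (hα : IsPositive α) (P : E7 →L[ℝ] Form3) :
    torsionJet α P = 0 ↔ ∀ i, nablaJet α P i = 0 := by
  have halt := sum_alternate_ofValues (christoffelEnd_symm α P) (N := nablaJet α P)
    fun i => rfl
  constructor
  · intro h
    rw [torsionJet, add_eq_zero_iff_of_nonneg (formInner_self_nonneg hα _)
      (formInner_self_nonneg hα _)] at h
    have h1 := eq_zero_of_formInner_self_eq_zero hα h.1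
    have h2 := eq_zero_of_formInner_self_eq_zero hα h.2
    refine eq_zero_of_closed_of_coclosed hα (fderiv_gram_nablaJet hα P)
      (form_eq_zero_of_comps (halt.trans h1)) fun p q => ?_
    have h3 := congrFun h2 ![p, q]
    simp only [codiffJet, Pi.zero_apply, neg_eq_zero] at h3
    rw [← h3]
    refine Finset.sum_congr rfl fun i _ => Finset.sum_congr rfl fun l _ => ?_
    rw [← comps_vec3]
    rfl
  · intro h
    have h0 : nablaJet α P = 0 := funext h
    have h1 : ContinuousAlternatingMap.alternatizeUncurryFin (ofValues (nablaJet α P)) = 0 := by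
      have : ofValues (nablaJet α P) = 0 := by
        ext1 x
        simp [ofValues_apply, h]
      rw [this]
      exact map_zero (ContinuousAlternatingMap.alternatizeUncurryFinCLM ℝ E7 ℝ)
    have h2 : codiffJet α P = 0 := by
      ext J
      simp [codiffJet, h, comps]
    rw [torsionJet, ← halt, h1, h2]
    simp [formInner, comps]

/-! ### Differentiation under the integral sign -/

/-- Differentiation under the integral over a compact set, with one-sided derivatives allowed. -/
lemma hasDerivWithinAt_setIntegral {I : Set ℝ} (hI : Convex ℝ I) {K : Set E7} (hK : IsCompact K)
    {G G' : ℝ → E7 → ℝ} (hc : ∀ t ∈ I, ContinuousOn (G t) K)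
    (hG : ∀ t ∈ I, ∀ y ∈ K, HasDerivWithinAt (fun s => G s y) (G' t y) I t)
    (hc' : ContinuousOn (fun q : ℝ × E7 => G' q.1 q.2) (I ×ˢ K)) {t₀ : ℝ} (ht₀ : t₀ ∈ I) :
    HasDerivWithinAt (fun t => ∫ y in K, G t y) (∫ y in K, G' t₀ y) I t₀ := by
  have hcK : ContinuousOn (G' t₀) K :=
    hc'.comp (f := fun y => (t₀, y)) (by fun_prop) fun y hy => ⟨ht₀, hy⟩
  obtain ⟨C, hC⟩ := hK.exists_bound_of_continuousOn hcK
  -- Compactness of `K` makes the bound on `G'` near `t₀` uniform in `y`. The mean value inequality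
  -- on a convex neighbourhood in `I` then dominates the difference quotients.
  have hev : ∀ᶠ t in 𝓝 t₀, ∀ y ∈ K, t ∈ I → y ∈ K → ‖G' t y‖ < C + 1 := by
    refine hK.eventually_forall_of_forall_eventually fun y hy => ?_
    have h1 : ContinuousWithinAt (fun q : ℝ × E7 => ‖G' q.1 q.2‖) (I ×ˢ K) (t₀, y) :=
      (hc' (t₀, y) ⟨ht₀, hy⟩).norm
    have h2 := h1.eventually (gt_mem_nhds (show ‖G' t₀ y‖ < C + 1 by linarith [hC y hy]))
    rw [eventually_nhdsWithin_iff] at h2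
    filter_upwards [h2] with q hq h3 h4 using hq ⟨h3, h4⟩
  obtain ⟨ε, hε, hball⟩ := Metric.eventually_nhds_iff_ball.1 hev
  have hlip : ∀ t ∈ I ∩ Metric.ball t₀ ε, ∀ y ∈ K, ‖G t y - G t₀ y‖ ≤ (C + 1) * ‖t - t₀‖ := by
    intro t ht y hy
    refine (hI.inter (convex_ball t₀ ε)).norm_image_sub_le_of_norm_hasDerivWithin_le
      (f := fun s => G s y) (f' := fun s => G' s y) (fun s hs => (hG s hs.1 y hy).mono inter_subset_left)
      (fun s hs => (hball s hs.2 y hy hs.1 hy).le) ⟨ht₀, Metric.mem_ball_self hε⟩ ht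
  rw [hasDerivWithinAt_iff_tendsto_slope]
  have hint : ∀ t ∈ I, IntegrableOn (G t) K := fun t ht => (hc t ht).integrableOn_compact hK
  have hI' : ∀ᶠ t in 𝓝[I \ {t₀}] t₀, t ∈ I ∩ Metric.ball t₀ ε ∧ t ≠ t₀ := by
    filter_upwards [self_mem_nhdsWithin, mem_nhdsWithin_of_mem_nhds (Metric.ball_mem_nhds t₀ hε)]
      with t h1 h2 using ⟨⟨h1.1, h2⟩, h1.2⟩
  have hslope : ∀ᶠ t in 𝓝[I \ {t₀}] t₀, ∫ y in K, slope (fun s => G s y) t₀ t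
      = slope (fun t => ∫ y in K, G t y) t₀ t := by
    filter_upwards [hI'] with t ht
    simp only [slope, vsub_eq_sub, smul_eq_mul]
    rw [integral_const_mul, integral_sub (hint t ht.1.1) (hint t₀ ht₀)]
  refine Filter.Tendsto.congr' hslope ?_
  refine tendsto_integral_filter_of_dominated_convergence (fun _ => C + 1) ?_ ?_ ?_ ?_
  · filter_upwards [hI'] with t ht
    simp only [slope, vsub_eq_sub, smul_eq_mul]
    exact (((hint t ht.1.1).sub (hint t₀ ht₀)).const_mul _).aestronglyMeasurable
  · filter_upwards [hI'] with t ht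
    refine (ae_restrict_iff' hK.measurableSet).2 (Filter.Eventually.of_forall fun y hy => ?_)
    rw [slope, vsub_eq_sub, norm_smul, norm_inv]
    have h0 : 0 < ‖t - t₀‖ := norm_pos_iff.2 (sub_ne_zero.2 ht.2)
    rw [inv_mul_le_iff₀ h0, mul_comm]
    exact hlip t ht.1 y hy
  · exact continuousOn_const.integrableOn_compact hK
  · refine (ae_restrict_iff' hK.measurableSet).2 (Filter.Eventually.of_forall fun y hy => ?_)
    exact hasDerivWithinAt_iff_tendsto_slope.1 (hG t₀ ht₀ y hy)

/-! ### Families of forms -/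

section Family

variable {F : Type*} [NormedAddCommGroup F] [NormedSpace ℝ F] {I : Set ℝ} {U : Set E7}
  {W V : ℝ → E7 → F}

lemma uniqueDiffOn_prod (hI : Convex ℝ I) (hI' : (interior I).Nonempty) (hU : IsOpen U) :
    UniqueDiffOn ℝ (I ×ˢ U) :=
  (uniqueDiffOn_convex hI hI').prod hU.uniqueDiffOn

/-- Spatial derivative of a time-dependent family. -/
lemma hasFDerivAt_slice (hU : IsOpen U)
    {W' : ℝ × E7 →L[ℝ] F} {t : ℝ} {y : E7} (ht : t ∈ I) (hy : y ∈ U)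
    (hW : HasFDerivWithinAt (fun q : ℝ × E7 => W q.1 q.2) W' (I ×ˢ U) (t, y)) :
    HasFDerivAt (W t) (W'.comp (ContinuousLinearMap.inr ℝ ℝ E7)) y := by
  have h1 : HasFDerivWithinAt (fun z : E7 => (t, z)) (ContinuousLinearMap.inr ℝ ℝ E7) U y :=
    (hasFDerivAt_prodMk_right t y).hasFDerivWithinAt
  have h2 := hW.comp y h1 fun z hz => ⟨ht, hz⟩
  exact h2.hasFDerivAt (hU.mem_nhds hy)

/-- Time derivative of a time-dependent family. -/
lemma hasDerivWithinAt_slice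
    {W' : ℝ × E7 →L[ℝ] F} {t : ℝ} {y : E7} (hy : y ∈ U)
    (hW : HasFDerivWithinAt (fun q : ℝ × E7 => W q.1 q.2) W' (I ×ˢ U) (t, y)) :
    HasDerivWithinAt (fun s => W s y) (W' (1, 0)) I t := by
  have h1 : HasFDerivWithinAt (fun s : ℝ => (s, y)) (ContinuousLinearMap.inl ℝ ℝ E7) I t :=
    (hasFDerivAt_prodMk_left t y).hasFDerivWithinAt
  have hmaps : MapsTo (fun s : ℝ => (s, y)) I (I ×ˢ U) := fun s hs => ⟨hs, hy⟩
  have h2 := (hW.comp t h1 hmaps).hasDerivWithinAt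
  exact h2.congr_deriv (by simp)

/-- For a family which is smooth on `I × U`, its spatial derivative is smooth on `I × U`, and so is
its time derivative; time and spatial derivatives commute. -/
lemma family_derivatives (hI : Convex ℝ I) (hI' : (interior I).Nonempty) (hU : IsOpen U)
    (hW : ContDiffOn ℝ ∞ (fun q : ℝ × E7 => W q.1 q.2) (I ×ˢ U))
    (hV : ∀ t ∈ I, ∀ y ∈ U, HasDerivWithinAt (fun s => W s y) (V t y) I t) :
    ContDiffOn ℝ ∞ (fun q : ℝ × E7 => fderiv ℝ (W q.1) q.2) (I ×ˢ U) ∧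
    ContDiffOn ℝ ∞ (fun q : ℝ × E7 => V q.1 q.2) (I ×ˢ U) ∧
    ContDiffOn ℝ ∞ (fun q : ℝ × E7 => fderiv ℝ (V q.1) q.2) (I ×ˢ U) ∧
    ∀ t ∈ I, ∀ y ∈ U, HasDerivWithinAt (fun s => fderiv ℝ (W s) y) (fderiv ℝ (V t) y) I t := by
  set S := I ×ˢ U with hS
  have hSu : UniqueDiffOn ℝ S := uniqueDiffOn_prod hI hI' hU
  set 𝒲 : ℝ × E7 → F := fun q => W q.1 q.2 with h𝒲
  have hd : ∀ q ∈ S, HasFDerivWithinAt 𝒲 (fderivWithin ℝ 𝒲 S q) S q := fun q hq =>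
    (hW.differentiableOn (by simp) q hq).hasFDerivWithinAt
  have hW1 : ContDiffOn ℝ ∞ (fderivWithin ℝ 𝒲 S) S := hW.fderivWithin hSu (by simp)
  have eP : ∀ q ∈ S, fderiv ℝ (W q.1) q.2
      = (fderivWithin ℝ 𝒲 S q).comp (ContinuousLinearMap.inr ℝ ℝ E7) := fun q hq =>
    (hasFDerivAt_slice hU hq.1 hq.2 (hd q hq)).fderiv
  have eV : ∀ q ∈ S, V q.1 q.2 = fderivWithin ℝ 𝒲 S q (1, 0) := fun q hq =>
    (uniqueDiffOn_convex hI hI' q.1 hq.1).eq_deriv _ (hV q.1 hq.1 q.2 hq.2)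
      (hasDerivWithinAt_slice hq.2 (hd q hq))
  have hP : ContDiffOn ℝ ∞ (fun q : ℝ × E7 => fderiv ℝ (W q.1) q.2) S :=
    (hW1.clm_comp contDiffOn_const).congr eP
  have hVs : ContDiffOn ℝ ∞ (fun q : ℝ × E7 => V q.1 q.2) S :=
    (hW1.clm_apply contDiffOn_const).congr eV
  have hdV : ∀ q ∈ S, HasFDerivWithinAt (fun q : ℝ × E7 => V q.1 q.2)
      (fderivWithin ℝ (fun q : ℝ × E7 => V q.1 q.2) S q) S q := fun q hq =>
    (hVs.differentiableOn (by simp) q hq).hasFDerivWithinAt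
  refine ⟨hP, hVs, ?_, ?_⟩
  · refine ((hVs.fderivWithin hSu (by simp)).clm_comp
      (contDiffOn_const (c := ContinuousLinearMap.inr ℝ ℝ E7))).congr fun q hq => ?_
    exact (hasFDerivAt_slice hU hq.1 hq.2 (hdV q hq)).fderiv
  · intro t ht y hy
    have hq : (t, y) ∈ S := ⟨ht, hy⟩
    set W2 := fderivWithin ℝ (fderivWithin ℝ 𝒲 S) S (t, y) with hW2
    have h1 : HasFDerivWithinAt (fderivWithin ℝ 𝒲 S) W2 S (t, y) :=
      (hW1.differentiableOn (by simp) _ hq).hasFDerivWithinAt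
    have h2 : HasDerivWithinAt (fun s => fderiv ℝ (W s) y)
        ((W2 (1, 0)).comp (ContinuousLinearMap.inr ℝ ℝ E7)) I t := by
      have h3 : HasDerivWithinAt (fun s => fderivWithin ℝ 𝒲 S (s, y)) (W2 (1, 0)) I t :=
        hasDerivWithinAt_slice (W := fun s z => fderivWithin ℝ 𝒲 S (s, z)) hy h1
      have h4 := h3.clm_comp (hasDerivWithinAt_const t I (ContinuousLinearMap.inr ℝ ℝ E7))
      refine (h4.congr (fun s hs => eP (s, y) ⟨hs, hy⟩) (eP (t, y) hq)).congr_deriv ?_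
      simp
    have h5 : HasFDerivAt (V t) ((ContinuousLinearMap.apply ℝ F ((1 : ℝ), (0 : E7))).comp
        (W2.comp (ContinuousLinearMap.inr ℝ ℝ E7))) y := by
      have h6 : HasFDerivAt (fun z => fderivWithin ℝ 𝒲 S (t, z))
          (W2.comp (ContinuousLinearMap.inr ℝ ℝ E7)) y :=
        hasFDerivAt_slice (W := fun s z => fderivWithin ℝ 𝒲 S (s, z)) hU ht hy h1
      have h7 := (ContinuousLinearMap.apply ℝ F ((1 : ℝ), (0 : E7))).hasFDerivAt.comp y h6
      refine h7.congr_of_eventuallyEq ?_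
      filter_upwards [hU.mem_nhds hy] with z hz using eV (t, z) ⟨ht, hz⟩
    -- Symmetry of the second derivative also holds at the endpoint of `I`, since a convex set with
    -- nonempty interior lies in the closure of that interior.
    have hsymm : IsSymmSndFDerivWithinAt ℝ 𝒲 S (t, y) := by
      refine (hW (t, y) hq).isSymmSndFDerivWithinAt
        (by rw [minSmoothness_of_isRCLikeNormedField]; exact WithTop.coe_le_coe.2 le_top) hSu ?_ hq
      rw [hS, interior_prod_eq, hU.interior_eq, closure_prod_eq]
      refine ⟨?_, subset_closure hy⟩
      rw [hI.closure_interior_eq_closure_of_nonempty_interior hI']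
      exact subset_closure ht
    rw [h5.fderiv]
    refine h2.congr_deriv ?_
    ext1 v
    exact hsymm (1, 0) (0, v)

/-- The directional derivative of a function `L` of 1-jets at the jet `(α, P)`. -/
def jetDeriv (L : F × (E7 →L[ℝ] F) → ℝ) (α : F) (P : E7 →L[ℝ] F) (β : F) (R : E7 →L[ℝ] F) : ℝ :=
  fderiv ℝ L (α, P) (β, R)

/-- Differentiation of the integral of a function of the 1-jets of a family. -/
lemma hasDerivWithinAt_setIntegral_jet {K : Set E7}
    (hI : Convex ℝ I) (hI' : (interior I).Nonempty) (hU : IsOpen U)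
    (hW : ContDiffOn ℝ ∞ (fun q : ℝ × E7 => W q.1 q.2) (I ×ˢ U))
    (hV : ∀ t ∈ I, ∀ y ∈ U, HasDerivWithinAt (fun s => W s y) (V t y) I t)
    (hK : IsCompact K) (hKU : K ⊆ U)
    {ρ : E7 → ℝ} (hρ : ContinuousOn ρ K) {L : F × (E7 →L[ℝ] F) → ℝ}
    (hL : ∀ t ∈ I, ∀ y ∈ K, ContDiffAt ℝ ∞ L (W t y, fderiv ℝ (W t) y)) {t₀ : ℝ} (ht₀ : t₀ ∈ I) :
    HasDerivWithinAt (fun t => ∫ y in K, ρ y * L (W t y, fderiv ℝ (W t) y))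
      (∫ y in K, ρ y * jetDeriv L (W t₀ y) (fderiv ℝ (W t₀) y) (V t₀ y) (fderiv ℝ (V t₀) y))
      I t₀ := by
  obtain ⟨hP, hVs, hDV, hcomm⟩ := family_derivatives hI hI' hU hW hV
  have hsub : I ×ˢ K ⊆ I ×ˢ U := prod_mono_right hKU
  have hjet : ContinuousOn (fun q : ℝ × E7 => (W q.1 q.2, fderiv ℝ (W q.1) q.2)) (I ×ˢ K) :=
    (hW.continuousOn.mono hsub).prodMk (hP.continuousOn.mono hsub)
  have hslice : ∀ t ∈ I, ∀ {X : Type} [TopologicalSpace X] {g : ℝ × E7 → X},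
      ContinuousOn g (I ×ˢ K) → ContinuousOn (fun y => g (t, y)) K := fun t ht X _ g hg =>
    hg.comp (f := fun y => (t, y)) (by fun_prop) fun y hy => ⟨ht, hy⟩
  have hρ' : ContinuousOn (fun q : ℝ × E7 => ρ q.2) (I ×ˢ K) :=
    hρ.comp continuousOn_snd fun q hq => hq.2
  refine hasDerivWithinAt_setIntegral hI hK
    (G' := fun t y => ρ y * fderiv ℝ L (W t y, fderiv ℝ (W t) y) (V t y, fderiv ℝ (V t) y))
    ?_ ?_ ?_ ht₀
  · intro t ht
    have h1 : ContinuousOn (fun q : ℝ × E7 => L (W q.1 q.2, fderiv ℝ (W q.1) q.2)) (I ×ˢ K) :=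
      fun q hq => (hL q.1 hq.1 q.2 hq.2).continuousAt.comp_continuousWithinAt
        (f := fun q : ℝ × E7 => (W q.1 q.2, fderiv ℝ (W q.1) q.2)) (hjet q hq)
    exact hρ.mul (hslice t ht h1)
  · intro t ht y hy
    have h1 := ((hL t ht y hy).differentiableAt
      (by simp)).hasFDerivAt
    have h2 := (hV t ht y (hKU hy)).prodMk (hcomm t ht y (hKU hy))
    exact (h1.comp_hasDerivWithinAt t h2).const_mul (ρ y)
  · have h1 : ContinuousOn (fun q : ℝ × E7 => fderiv ℝ L (W q.1 q.2, fderiv ℝ (W q.1) q.2))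
        (I ×ˢ K) := fun q hq =>
      (((hL q.1 hq.1 q.2 hq.2).fderiv_right
        (m := 0) (by simp)).continuousAt).comp_continuousWithinAt
        (f := fun q : ℝ × E7 => (W q.1 q.2, fderiv ℝ (W q.1) q.2)) (hjet q hq)
    exact hρ'.mul (h1.clm_apply ((hVs.continuousOn.mono hsub).prodMk (hDV.continuousOn.mono hsub)))

end Family

/-! ### Naturality of the Levi-Civita connection -/

lemma fderivComp_apply (α : Form3) (L A : E7 →L[ℝ] E7) (x y z : E7) :
    α.fderivCompContinuousLinearMap L A ![x, y, z]
      = α ![A x, L y, L z] + α ![L x, A y, L z] + α ![L x, L y, A z] := by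
  rw [ContinuousAlternatingMap.fderivCompContinuousLinearMap_apply, Fin.sum_univ_three]
  congr 1
  · congr 1 <;> congr 1 <;> ext a : 1 <;> fin_cases a <;> simp
  · congr 1; ext a : 1; fin_cases a <;> simp

/-- If a form is parallel, then so are its pullbacks. -/
lemma nablaJet_eq_zero_of_pullback {w w' : E7 → Form3} {τ : E7 → E7} {y : E7} {e : E7 ≃L[ℝ] E7}
    (hτ : ContDiffAt ℝ ∞ τ y) (he : (e : E7 →L[ℝ] E7) = fderiv ℝ τ y)
    (hw : ∀ᶠ z in 𝓝 y, w z = (w' (τ z)).compContinuousLinearMap (fderiv ℝ τ z))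
    (hw' : DifferentiableAt ℝ w' (τ y)) (hpos : IsPositive (w y))
    (h0 : ∀ i, nablaJet (w' (τ y)) (fderiv ℝ w' (τ y)) i = 0) (i : Fin 7) :
    nablaJet (w y) (fderiv ℝ w y) i = 0 := by
  set α' := w' (τ y) with hα'
  set P' := fderiv ℝ w' (τ y) with hP'
  set D := fderiv ℝ τ y with hD
  set D2 := fderiv ℝ (fderiv ℝ τ) y with hD2
  set Γ' : E7 →L[ℝ] (E7 →L[ℝ] E7) := ofValues (christoffelEnd α' P') with hΓ'
  have hPΓ : ∀ v, P' v = act α' (Γ' v) := by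
    intro v
    conv_lhs => rw [← sum_smul_stdVec v]
    rw [hΓ', ofValues_apply, map_sum, map_sum]
    refine Finset.sum_congr rfl fun i _ => ?_
    rw [map_smul, map_smul, sub_eq_zero.1 (h0 i)]
  have hΓsymm : ∀ u v, Γ' u v = Γ' v u := by
    intro u v
    have h1 : ∀ u v, Γ' u v = ∑ i, ∑ j, (u i * v j) • christoffelEnd α' P' i (stdVec j) := by
      intro u v
      conv_lhs => rw [← sum_smul_stdVec v]
      rw [hΓ', ofValues_apply]
      simp only [sum_apply, smul_apply, map_sum, map_smul,
        smul_smul, Finset.smul_sum]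
      rw [Finset.sum_comm]
      exact Finset.sum_congr rfl fun i _ => Finset.sum_congr rfl fun j _ => by rw [mul_comm]
    rw [h1, h1, Finset.sum_comm]
    refine Finset.sum_congr rfl fun i _ => Finset.sum_congr rfl fun j _ => ?_
    rw [christoffelEnd_symm, mul_comm]
  have hDτ : HasFDerivAt τ D y := (hτ.differentiableAt (by simp)).hasFDerivAt
  have hD2τ : HasFDerivAt (fderiv ℝ τ) D2 y :=
    ((hτ.fderiv_right (m := ∞) (by simp)).differentiableAt (by simp)).hasFDerivAt
  have hsymm : ∀ u v, D2 u v = D2 v u := by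
    have : IsSymmSndFDerivAt ℝ τ y := hτ.isSymmSndFDerivAt
      (by rw [minSmoothness_of_isRCLikeNormedField]; exact WithTop.coe_le_coe.2 le_top)
    exact fun u v => this u v
  have h1 : HasFDerivAt (fun z => w' (τ z)) (P'.comp D) y := hw'.hasFDerivAt.comp y hDτ
  have h2 := h1.continuousAlternatingMapCompContinuousLinearMap hD2τ
  have h3 := h2.congr_of_eventuallyEq hw
  have hwy : w y = α'.compContinuousLinearMap D := hw.self_of_nhds
  -- The pulled-back connection, with the usual second-derivative term of the coordinate change. It
  -- is symmetric because `Γ'` and `D2` are, and it preserves `w y`, so by uniqueness it is the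
  -- Levi-Civita connection.
  refine nablaJet_eq_zero hpos
    (Γ := fun v => (e.symm : E7 →L[ℝ] E7).comp ((Γ' (D v)).comp D + D2 v)) ?_ ?_ i
  · intro u v
    simp only [ContinuousLinearMap.comp_apply, add_apply]
    rw [hΓsymm, hsymm]
  · intro v
    rw [h3.fderiv]
    refine form3_ext fun i j k => ?_
    have hDe : ∀ x, D ((e.symm : E7 →L[ℝ] E7) x) = x := by
      intro x
      rw [← he]
      exact e.apply_symm_apply x
    have h4 : (pullL D (P' (D v))) ![stdVec i, stdVec j, stdVec k]
        = act α' (Γ' (D v)) ![D (stdVec i), D (stdVec j), D (stdVec k)] := by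
      rw [← hPΓ]
      exact pullback_apply _ _ _ _ _
    have h5 := fderivComp_apply α' D (D2 v) (stdVec i) (stdVec j) (stdVec k)
    rw [act_apply] at h4 ⊢
    rw [hwy]
    simp only [pullback_apply, ContinuousLinearMap.comp_apply, hDe]
    refine (congrArg₂ (· + ·) h4 h5).trans ?_
    have add0 : ∀ a b y z : E7, α' ![a + b, y, z] = α' ![a, y, z] + α' ![b, y, z] := by
      intro a b y z
      have := α'.toMultilinearMap.map_update_add ![a, y, z] 0 a b
      have u : ∀ c : E7, Function.update ![a, y, z] 0 c = ![c, y, z] := by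
        intro c; ext t : 1; fin_cases t <;> simp
      rw [u, u, u] at this
      exact this
    have add1 : ∀ a b y z : E7, α' ![y, a + b, z] = α' ![y, a, z] + α' ![y, b, z] := by
      intro a b y z
      rw [form3_swap12, add0, form3_swap12 α' y a, form3_swap12 α' y b]
      ring
    have add2 : ∀ a b y z : E7, α' ![y, z, a + b] = α' ![y, z, a] + α' ![y, z, b] := by
      intro a b y z
      rw [form3_swap23, add1, form3_swap23 α' y z a, form3_swap23 α' y z b]
      ring
    simp only [add_apply, ContinuousLinearMap.comp_apply, add0, add1, add2]
    ring

/-! ### Scaling -/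

/-- Otherwise the default value `0` of `gram` at `r³ α` would, by scaling, make the metric of `α`
vanish. -/
lemma isPositive_cube_smul {α : Form3} (hα : IsPositive α) {r : ℝ} (hr : 0 < r) :
    IsPositive (r ^ 3 • α) := by
  by_contra h
  have h1 := gram_cube_smul α hr
  rw [gram, dif_neg h] at h1
  have h2 := det_gram_pos hα
  have h3 : gram α = 0 := (smul_eq_zero.1 h1.symm).resolve_left (by positivity)
  rw [h3] at h2
  simp [Matrix.det_zero] at h2

lemma volDensity_cube_smul (α : Form3) {r : ℝ} (hr : 0 < r) :
    volDensity (r ^ 3 • α) = r ^ 7 * volDensity α := by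
  rw [volDensity, gram_cube_smul α hr, Matrix.det_smul, Fintype.card_fin, ← pow_mul, mul_comm 2 7,
    pow_mul, Real.sqrt_mul (sq_nonneg _), Real.sqrt_sq (by positivity)]
  rfl

lemma inv_smul_matrix {G : Matrix (Fin 7) (Fin 7) ℝ} (hG : G.det ≠ 0) {c : ℝ} (hc : c ≠ 0) :
    (c • G)⁻¹ = c⁻¹ • G⁻¹ := by
  apply Matrix.inv_eq_right_inv
  rw [smul_mul_smul_comm, mul_inv_cancel₀ hc, Matrix.mul_nonsing_inv _ hG.isUnit, one_smul]

lemma formInner_smul {k : ℕ} {G : Matrix (Fin 7) (Fin 7) ℝ} (hG : G.det ≠ 0) {c : ℝ} (hc : c ≠ 0)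
    (b : ℝ) (ξ : (Fin k → Fin 7) → ℝ) :
    formInner (c • G) (b • ξ) (b • ξ) = c⁻¹ ^ k * b ^ 2 * formInner G ξ ξ := by
  simp only [formInner, inv_smul_matrix hG hc, Matrix.smul_apply, smul_eq_mul, Pi.smul_apply,
    Finset.prod_mul_distrib, Finset.prod_const, Finset.card_univ, Fintype.card_fin, Finset.mul_sum]
  exact Finset.sum_congr rfl fun I _ => Finset.sum_congr rfl fun J _ => by ring

lemma gramJet_cube_smul {α : Form3} (hα : IsPositive α) (P : E7 →L[ℝ] Form3) {r : ℝ} (hr : 0 < r)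
    (i j l : Fin 7) : gramJet (r ^ 3 • α) (r ^ 3 • P) i j l = r ^ 2 * gramJet α P i j l := by
  have h1 : HasFDerivAt (fun γ : Form3 => r ^ 3 • γ) (r ^ 3 • ContinuousLinearMap.id ℝ Form3) α :=
    (hasFDerivAt_id α).const_smul (r ^ 3)
  have h2 := ((contDiffAt_gram (isPositive_cube_smul hα hr) j l).differentiableAt
    (by simp)).hasFDerivAt.comp α h1
  have h3 : (fun γ : Form3 => gram γ j l) ∘ (fun γ : Form3 => r ^ 3 • γ)
      = fun γ => r ^ 2 * gram γ j l := by
    ext γ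
    simp only [Function.comp_apply, gram_cube_smul γ hr]
    rfl
  rw [h3] at h2
  have h4 := ((contDiffAt_gram hα j l).differentiableAt (by simp)).hasFDerivAt.const_mul (r ^ 2)
  have h5 := congrArg (fun T => T (P (stdVec i))) (h2.unique h4)
  exact h5

lemma nablaJet_cube_smul {α : Form3} (hα : IsPositive α) (P : E7 →L[ℝ] Form3) {r : ℝ} (hr : 0 < r)
    (i : Fin 7) : nablaJet (r ^ 3 • α) (r ^ 3 • P) i = r ^ 3 • nablaJet α P i := by
  have h1 : christoffelEnd (r ^ 3 • α) (r ^ 3 • P) i = christoffelEnd α P i := by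
    rw [christoffelEnd, christoffelEnd]
    congr 1
    ext k j
    simp only [Matrix.of_apply, christoffelJet, gramJet_cube_smul hα P hr, gram_cube_smul α hr,
      inv_smul_matrix (det_gram_pos hα).ne' (pow_pos hr 2).ne', Matrix.smul_apply, smul_eq_mul]
    congr 1
    refine Finset.sum_congr rfl fun l _ => ?_
    field_simp
  refine form3_ext fun a b c => ?_
  have h2 : act (r ^ 3 • α) (christoffelEnd α P i) ![stdVec a, stdVec b, stdVec c]
      = r ^ 3 * act α (christoffelEnd α P i) ![stdVec a, stdVec b, stdVec c] := by
    simp only [act_apply, ContinuousAlternatingMap.smul_apply, smul_eq_mul]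
    ring
  simp only [nablaJet, h1, ContinuousAlternatingMap.sub_apply, h2, smul_apply,
    ContinuousAlternatingMap.smul_apply, smul_eq_mul]
  ring

/-- The Christoffel symbols are unchanged. The exterior derivative scales by `r³` and 4-form norms
by `r⁻⁴`; the codifferential scales by `r` and 2-form norms by `r⁻²`. Both squared norms therefore
scale by `r⁻²`. -/
lemma torsionJet_cube_smul {α : Form3} (hα : IsPositive α) (P : E7 →L[ℝ] Form3) {r : ℝ}
    (hr : 0 < r) : torsionJet (r ^ 3 • α) (r ^ 3 • P) = r⁻¹ ^ 2 * torsionJet α P := by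
  have h1 : comps (ContinuousAlternatingMap.alternatizeUncurryFin (r ^ 3 • P))
      = r ^ 3 • comps (ContinuousAlternatingMap.alternatizeUncurryFin P) := by
    rw [ContinuousAlternatingMap.alternatizeUncurryFin_smul]
    rfl
  have h2 : codiffJet (r ^ 3 • α) (r ^ 3 • P) = r • codiffJet α P := by
    ext J
    have h3 : ∀ i I, comps (r ^ 3 • nablaJet α P i) I = r ^ 3 * comps (nablaJet α P i) I :=
      fun i I => rfl
    simp only [codiffJet, nablaJet_cube_smul hα P hr, gram_cube_smul α hr, h3, Pi.smul_apply,
      inv_smul_matrix (det_gram_pos hα).ne' (pow_pos hr 2).ne', Matrix.smul_apply, smul_eq_mul,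
      mul_neg, Finset.mul_sum]
    congr 1
    refine Finset.sum_congr rfl fun i _ => Finset.sum_congr rfl fun l _ => ?_
    field_simp
  rw [torsionJet, h1, h2, gram_cube_smul α hr,
    formInner_smul (det_gram_pos hα).ne' (pow_pos hr 2).ne',
    formInner_smul (det_gram_pos hα).ne' (pow_pos hr 2).ne', torsionJet]
  have h3 : (r ^ 2)⁻¹ ^ 4 * (r ^ 3) ^ 2 = r⁻¹ ^ 2 := by field_simp
  have h4 : (r ^ 2)⁻¹ ^ 2 * r ^ 2 = r⁻¹ ^ 2 := by field_simp
  simp only [Nat.reduceAdd, h3, h4, mul_add]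

section Manifold

variable {M : Type*} [TopologicalSpace M] [ChartedSpace E7 M]

/-! ### Local expressions -/

/-- A 3-form on `M`, with all tangent spaces identified with the model space. -/
def modelForm (α : ThreeForm M) (x : M) : Form3 := α x

/-- The derivative of the inverse of a chart. -/
def symmDeriv (e : OpenPartialHomeomorph M E7) (y : E7) : E7 →L[ℝ] E7 :=
  mfderiv 𝓘(ℝ, E7) 𝓘(ℝ, E7) e.symm y

lemma inChart_eq (e : OpenPartialHomeomorph M E7) (α : ThreeForm M) (y : E7) :
    inChart e α y = (modelForm α (e.symm y)).compContinuousLinearMap (symmDeriv e y) := rfl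

lemma inChart_smul (e : OpenPartialHomeomorph M E7) (α : ThreeForm M) (s : ℝ) (y : E7) :
    inChart e (s • α) y = s • inChart e α y := rfl

lemma contDiffOn_inChart_line {Ω η : ThreeForm M} (hΩ : IsSmooth Ω) (hη : IsSmooth η)
    {e : OpenPartialHomeomorph M E7} (he : e ∈ atlas E7 M) (I : Set ℝ) :
    ContDiffOn ℝ ∞ (fun q : ℝ × E7 => inChart e (Ω + q.1 • η) q.2) (I ×ˢ e.target) := by
  have h1 : ContDiffOn ℝ ∞ (fun q : ℝ × E7 => inChart e Ω q.2) (I ×ˢ e.target) :=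
    (hΩ e he).comp contDiffOn_snd fun q hq => hq.2
  have h2 : ContDiffOn ℝ ∞ (fun q : ℝ × E7 => inChart e η q.2) (I ×ˢ e.target) :=
    (hη e he).comp contDiffOn_snd fun q hq => hq.2
  exact h1.add (contDiffOn_fst.smul h2)

lemma IsSmooth.add_smul {Ω η : ThreeForm M} (hΩ : IsSmooth Ω) (hη : IsSmooth η) (s : ℝ) :
    IsSmooth (Ω + s • η) := fun e he =>
  (hΩ e he).add ((hη e he).const_smul s)

variable [IsManifold 𝓘(ℝ, E7) ∞ M] {e e' : OpenPartialHomeomorph M E7}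

lemma exists_equiv_symmDeriv (he : e ∈ atlas E7 M) {y : E7} (hy : y ∈ e.target) :
    ∃ f : E7 ≃L[ℝ] E7, (f : E7 →L[ℝ] E7) = symmDeriv e y := by
  have : IsManifold 𝓘(ℝ, E7) 1 M := IsManifold.of_le (n := ∞) (by simp)
  have h := (mdifferentiable_of_mem_atlas (I := 𝓘(ℝ, E7)) he).symm
  exact ⟨h.mfderiv (x := y) hy, rfl⟩

lemma isPositive_inChart (he : e ∈ atlas E7 M) {y : E7} (hy : y ∈ e.target) {α : ThreeForm M}
    (hα : IsPositive (α (e.symm y))) : IsPositive (inChart e α y) := by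
  obtain ⟨f, hf⟩ := exists_equiv_symmDeriv he hy
  have hα' : IsPositive (modelForm α (e.symm y)) := hα
  rw [inChart_eq, ← hf]
  exact hα'.pullback f

lemma contDiffAt_transition (he : e ∈ atlas E7 M) (he' : e' ∈ atlas E7 M) {y : E7}
    (hy : y ∈ e.target) (hy' : e.symm y ∈ e'.source) :
    ContDiffAt ℝ ∞ (fun z => e' (e.symm z)) y := by
  have h1 : ContMDiffAt 𝓘(ℝ, E7) 𝓘(ℝ, E7) ∞ e.symm y :=
    (contMDiffOn_symm_of_mem_maximalAtlas
      (IsManifold.subset_maximalAtlas he)).contMDiffAt (e.open_target.mem_nhds hy)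
  have h2 : ContMDiffAt 𝓘(ℝ, E7) 𝓘(ℝ, E7) ∞ e' (e.symm y) :=
    (contMDiffOn_of_mem_maximalAtlas
      (IsManifold.subset_maximalAtlas he')).contMDiffAt (e'.open_source.mem_nhds hy')
  exact (h2.comp y h1).contDiffAt

lemma symmDeriv_transition (he : e ∈ atlas E7 M) (he' : e' ∈ atlas E7 M) {y : E7}
    (hy : y ∈ e.target) (hy' : e.symm y ∈ e'.source) :
    symmDeriv e y = (symmDeriv e' (e' (e.symm y))).comp (fderiv ℝ (fun z => e' (e.symm z)) y) := by
  have : IsManifold 𝓘(ℝ, E7) 1 M := IsManifold.of_le (n := ∞) (by simp)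
  have h1 : MDifferentiableAt 𝓘(ℝ, E7) 𝓘(ℝ, E7) e'.symm (e' (e.symm y)) :=
    mdifferentiableAt_atlas_symm he' (e'.map_source hy')
  have h2 : MDifferentiableAt 𝓘(ℝ, E7) 𝓘(ℝ, E7) (fun z => e' (e.symm z)) y :=
    ((contDiffAt_transition he he' hy hy').differentiableAt (by simp)).mdifferentiableAt
  have h3 : e.symm =ᶠ[𝓝 y] e'.symm ∘ fun z => e' (e.symm z) := by
    have : ∀ᶠ z in 𝓝 y, e.symm z ∈ e'.source :=
      (e.symm.continuousAt hy).eventually (e'.open_source.mem_nhds hy')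
    filter_upwards [this] with z hz
    exact (e'.left_inv hz).symm
  have h4 := mfderiv_comp y h1 h2
  rw [← h3.mfderiv_eq, mfderiv_eq_fderiv] at h4
  exact h4

lemma inChart_transition (he : e ∈ atlas E7 M) (he' : e' ∈ atlas E7 M) {y : E7}
    (hy : y ∈ e.target) (hy' : e.symm y ∈ e'.source) (α : ThreeForm M) :
    inChart e α y = (inChart e' α (e' (e.symm y))).compContinuousLinearMap
      (fderiv ℝ (fun z => e' (e.symm z)) y) := by
  rw [inChart_eq, inChart_eq, e'.left_inv hy', symmDeriv_transition he he' hy hy']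
  rfl

/-- If `∇^Ω Ω` vanishes at a point in one chart, then it does in every chart. -/
lemma nablaJet_inChart_eq_zero (he : e ∈ atlas E7 M) (he' : e' ∈ atlas E7 M) {y : E7}
    (hy : y ∈ e.target) (hy' : e.symm y ∈ e'.source) {Ω : ThreeForm M} (hΩ : IsSmooth Ω)
    (hpos : ∀ x, IsPositive (Ω x))
    (h0 : ∀ i, nablaJet (inChart e' Ω (e' (e.symm y))) (fderiv ℝ (inChart e' Ω) (e' (e.symm y))) i
      = 0) (i : Fin 7) :
    nablaJet (inChart e Ω y) (fderiv ℝ (inChart e Ω) y) i = 0 := by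
  obtain ⟨f, hf⟩ := exists_equiv_symmDeriv he hy
  obtain ⟨f', hf'⟩ := exists_equiv_symmDeriv he' (e'.map_source hy')
  refine nablaJet_eq_zero_of_pullback (w' := inChart e' Ω) (e := f.trans f'.symm)
    (contDiffAt_transition he he' hy hy') ?_ ?_ ?_ (isPositive_inChart he hy (hpos _)) h0 i
  · have h1 := symmDeriv_transition he he' hy hy'
    rw [← hf, ← hf'] at h1
    ext1 v
    have h2 := congrArg (fun T : E7 →L[ℝ] E7 => f'.symm (T v)) h1
    simpa using h2
  · filter_upwards [e.open_target.mem_nhds hy,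
      (e.symm.continuousAt hy).eventually (e'.open_source.mem_nhds hy')] with z hz hz'
    exact inChart_transition he he' hz hz' Ω
  · exact ((hΩ e' he').contDiffAt
      (e'.open_target.mem_nhds (e'.map_source hy'))).differentiableAt (by simp)

lemma nabla_inChart {Ω : ThreeForm M} (hΩ : IsSmooth Ω) (hpos : ∀ x, IsPositive (Ω x))
    {e : OpenPartialHomeomorph M E7} (he : e ∈ atlas E7 M) {y : E7} (hy : y ∈ e.target)
    (i : Fin 7) (I : Fin 3 → Fin 7) : nabla (inChart e Ω) y i I
      = comps (nablaJet (inChart e Ω y) (fderiv ℝ (inChart e Ω) y) i) I :=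
  nabla_eq (((hΩ e he).contDiffAt (e.open_target.mem_nhds hy)).differentiableAt (by simp))
    (isPositive_inChart he hy (hpos _)) i I

end Manifold

/-! ### Functions of the 1-jet that depend on the form only -/

section Jet

variable {F : Type*} [NormedAddCommGroup F] [NormedSpace ℝ F]

lemma jetDeriv_fst {f : F → ℝ} {α : F} (hf : DifferentiableAt ℝ f α) (P : E7 →L[ℝ] F) (β : F)
    (R : E7 →L[ℝ] F) : jetDeriv (fun q => f q.1) α P β R = fderiv ℝ f α β := by
  have h : HasFDerivAt (fun q : F × (E7 →L[ℝ] F) => f q.1)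
      ((fderiv ℝ f α).comp (ContinuousLinearMap.fst ℝ F (E7 →L[ℝ] F))) (α, P) :=
    HasFDerivAt.comp (α, P) hf.hasFDerivAt hasFDerivAt_fst
  rw [jetDeriv, h.fderiv]
  rfl

lemma contDiffAt_comp_fst {f : F → ℝ} {p : F × (E7 →L[ℝ] F)} (hf : ContDiffAt ℝ ∞ f p.1) :
    ContDiffAt ℝ ∞ (fun q : F × (E7 →L[ℝ] F) => f q.1) p :=
  ContDiffAt.comp p hf contDiffAt_fst

end Jet

section Manifold

variable {M : Type*} [TopologicalSpace M] [ChartedSpace E7 M]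
  [CompactSpace M] [T2Space M] [IsManifold 𝓘(ℝ, E7) ∞ M]

/-! ### Integration over `M` -/

variable (M) in
lemma partition_isSubordinate : (partition M).IsSubordinate fun p => (chartAt E7 p).source :=
  (SmoothPartitionOfUnity.exists_isSubordinate_chartAt_source 𝓘(ℝ, E7) M).choose_spec

/-- The support of the `p`-th function of the partition of unity, in the chart at `p`. -/
def chartSupport (p : M) : Set E7 := chartAt E7 p '' tsupport (partition M p)

/-- The `p`-th function of the partition of unity, in the chart at `p`. -/
def weight (p : M) (y : E7) : ℝ := partition M p ((chartAt E7 p).symm y)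

lemma isCompact_chartSupport (p : M) : IsCompact (chartSupport p) :=
  (isClosed_tsupport _).isCompact.image_of_continuousOn
    ((chartAt E7 p).continuousOn.mono (partition_isSubordinate M p))

lemma chartSupport_subset (p : M) : chartSupport p ⊆ (chartAt E7 p).target := by
  rintro _ ⟨x, hx, rfl⟩
  exact (chartAt E7 p).map_source (partition_isSubordinate M p hx)

lemma weight_nonneg (p : M) (y : E7) : 0 ≤ weight p y := (partition M).nonneg p _

lemma weight_eq_zero {p : M} {y : E7} (hy : y ∈ (chartAt E7 p).target \ chartSupport p) :
    weight p y = 0 := by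
  by_contra h
  exact hy.2 ⟨(chartAt E7 p).symm y, subset_tsupport _ h, (chartAt E7 p).right_inv hy.1⟩

lemma continuousOn_weight (p : M) : ContinuousOn (weight p) (chartAt E7 p).target :=
  (partition M p).contMDiff.continuous.comp_continuousOn (chartAt E7 p).continuousOn_symm

variable (M) in
lemma finite_active : {p : M | (Function.support (partition M p)).Nonempty}.Finite :=
  (partition M).locallyFinite.finite_nonempty_of_compact

variable (M) in
/-- The indices of the nonzero functions of the partition of unity. -/
def active : Finset M := (finite_active M).toFinset

/-- Compactness leaves finitely many nonzero cutoffs, each supported in a compact subset of its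
chart, where differentiation under the integral is available. -/
lemma volIntegral_eq (Ω : ThreeForm M) (F : OpenPartialHomeomorph M E7 → E7 → ℝ) :
    volIntegral Ω F = ∑ p ∈ active M, ∫ y in chartSupport p,
      weight p y * F (chartAt E7 p) y * volDensity (inChart (chartAt E7 p) Ω y) := by
  rw [volIntegral, finsum_eq_sum_of_support_subset (s := active M)]
  · refine Finset.sum_congr rfl fun p _ => ?_
    refine setIntegral_eq_of_subset_of_forall_sdiff_eq_zero
      (chartAt E7 p).open_target.measurableSet (chartSupport_subset p) fun y hy => ?_
    have := weight_eq_zero hy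
    rw [weight] at this
    rw [this, zero_mul, zero_mul]
  · intro p hp
    rw [active, Set.Finite.coe_toFinset]
    by_contra h
    refine hp ?_
    have h0 : ∀ x, partition M p x = 0 := fun x => by
      by_contra hx
      exact h ⟨x, hx⟩
    simp [h0]

/-- The integral over `M` of a density which is a function of the 1-jet of `Ω`. -/
def jetIntegral (L : Form3 × (E7 →L[ℝ] Form3) → ℝ) (Ω : ThreeForm M) : ℝ :=
  ∑ p ∈ active M, ∫ y in chartSupport p, weight p y *
    L (inChart (chartAt E7 p) Ω y, fderiv ℝ (inChart (chartAt E7 p) Ω) y)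

/-- The first variation of `jetIntegral L` at `Ω` in the direction `η`. -/
def jetVariation (L : Form3 × (E7 →L[ℝ] Form3) → ℝ) (Ω η : ThreeForm M) : ℝ :=
  ∑ p ∈ active M, ∫ y in chartSupport p, weight p y *
    jetDeriv L (inChart (chartAt E7 p) Ω y) (fderiv ℝ (inChart (chartAt E7 p) Ω) y)
      (inChart (chartAt E7 p) η y) (fderiv ℝ (inChart (chartAt E7 p) η) y)

/-- Positivity on the supports of the partition of unity. -/
def IsChartPositive (Ω : ThreeForm M) : Prop :=
  ∀ p ∈ active M, ∀ y ∈ chartSupport p, IsPositive (inChart (chartAt E7 p) Ω y)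

lemma isChartPositive_of_isPositive {Ω : ThreeForm M} (hΩ : ∀ x, IsPositive (Ω x)) :
    IsChartPositive Ω := fun p _ _ hy =>
  isPositive_inChart (chart_mem_atlas E7 p) (chartSupport_subset p hy) (hΩ _)

/-- The integrand of the Dirichlet energy. -/
def dirichletDensity (q : Form3 × (E7 →L[ℝ] Form3)) : ℝ :=
  1 / 2 * torsionJet q.1 q.2 * volDensity q.1

lemma hitchin_eq (Ω : ThreeForm M) :
    hitchin Ω = jetIntegral (fun q => volDensity q.1) Ω := by
  simp [hitchin, volIntegral_eq, jetIntegral]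

lemma dirichlet_eq {Ω : ThreeForm M} (hΩ : IsSmooth Ω) (hpos : IsChartPositive Ω) :
    dirichlet Ω = jetIntegral dirichletDensity Ω := by
  rw [dirichlet, volIntegral_eq, jetIntegral, Finset.mul_sum]
  refine Finset.sum_congr rfl fun p hp => ?_
  rw [← integral_const_mul]
  refine setIntegral_congr_fun (isCompact_chartSupport p).measurableSet fun y hy => ?_
  have hd : DifferentiableAt ℝ (inChart (chartAt E7 p) Ω) y :=
    ((hΩ _ (chart_mem_atlas E7 p)).contDiffAt ((chartAt E7 p).open_target.mem_nhds
      (chartSupport_subset p hy))).differentiableAt (by simp)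
  simp only [torsionSq_eq hd (hpos p hp y hy), dirichletDensity]
  ring

lemma formInner_comm {k : ℕ} {G : Matrix (Fin 7) (Fin 7) ℝ} (hG : Gᵀ = G)
    (ξ η : (Fin k → Fin 7) → ℝ) : formInner G ξ η = formInner G η ξ := by
  have h : ∀ i j, G⁻¹ i j = G⁻¹ j i := fun i j => by
    conv_lhs => rw [← hG, ← Matrix.transpose_nonsing_inv]
    rfl
  rw [formInner, formInner, Finset.sum_comm]
  congr 1
  refine Finset.sum_congr rfl fun I _ => Finset.sum_congr rfl fun J _ => ?_
  simp only [h (J _) (I _)]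
  ring

lemma l2Inner_comm (Ω α β : ThreeForm M) : l2Inner Ω α β = l2Inner Ω β α := by
  simp only [l2Inner]
  congr 1
  ext e y
  exact formInner_comm (gram_transpose _) _ _

lemma l2Inner_self_nonneg {Ω : ThreeForm M} (hΩ : IsChartPositive Ω) (α : ThreeForm M) :
    0 ≤ l2Inner Ω α α := by
  rw [l2Inner, volIntegral_eq]
  refine Finset.sum_nonneg fun p hp =>
    setIntegral_nonneg (isCompact_chartSupport p).measurableSet fun y hy => ?_
  exact mul_nonneg (mul_nonneg (weight_nonneg p y) (formInner_self_nonneg (hΩ p hp y hy) _))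
    (Real.sqrt_nonneg _)

lemma jetDeriv_volDensity {α : Form3} (hα : IsPositive α) (P : E7 →L[ℝ] Form3) (β : Form3)
    (R : E7 →L[ℝ] Form3) : jetDeriv (fun q => volDensity q.1) α P β R
      = 1 / 3 * (formInner (gram α) (comps α) (comps β) * volDensity α) := by
  rw [jetDeriv_fst ((contDiffAt_volDensity hα).differentiableAt (by simp)),
    fderiv_volDensity hα β, mul_assoc]

lemma jetVariation_volDensity {Ω : ThreeForm M} (hΩ : IsChartPositive Ω) (η : ThreeForm M) :
    jetVariation (fun q => volDensity q.1) Ω η = 1 / 3 * l2Inner Ω Ω η := by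
  rw [l2Inner, volIntegral_eq, jetVariation, Finset.mul_sum]
  refine Finset.sum_congr rfl fun p hp => ?_
  rw [← integral_const_mul]
  refine setIntegral_congr_fun (isCompact_chartSupport p).measurableSet fun y hy => ?_
  simp only [jetDeriv_volDensity (hΩ p hp y hy)]
  ring

/-- First variation formula along a smooth family of 3-forms. -/
lemma hasDerivWithinAt_jetIntegral {I : Set ℝ} (hI : Convex ℝ I) (hI' : (interior I).Nonempty)
    {Ω V : ℝ → ThreeForm M}
    (hΩ : ∀ e ∈ atlas E7 M,
      ContDiffOn ℝ ∞ (fun q : ℝ × E7 => inChart e (Ω q.1) q.2) (I ×ˢ e.target))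
    (hV : ∀ e ∈ atlas E7 M, ∀ t ∈ I, ∀ y ∈ e.target,
      HasDerivWithinAt (fun s => inChart e (Ω s) y) (inChart e (V t) y) I t)
    {L : Form3 × (E7 →L[ℝ] Form3) → ℝ}
    (hL : ∀ p : Form3 × (E7 →L[ℝ] Form3), IsPositive p.1 → ContDiffAt ℝ ∞ L p)
    (hpos : ∀ t ∈ I, IsChartPositive (Ω t)) {t₀ : ℝ} (ht₀ : t₀ ∈ I) :
    HasDerivWithinAt (fun t => jetIntegral L (Ω t)) (jetVariation L (Ω t₀) (V t₀)) I t₀ := by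
  unfold jetIntegral jetVariation
  refine HasDerivWithinAt.fun_sum fun p hp => ?_
  have he := chart_mem_atlas E7 p
  exact hasDerivWithinAt_setIntegral_jet (W := fun t y => inChart (chartAt E7 p) (Ω t) y)
    (V := fun t y => inChart (chartAt E7 p) (V t) y) hI hI' (chartAt E7 p).open_target (hΩ _ he)
    (hV _ he) (isCompact_chartSupport p) (chartSupport_subset p)
    ((continuousOn_weight p).mono (chartSupport_subset p))
    (fun t ht y hy => hL _ (hpos t ht p hp y hy)) ht₀

lemma contDiffAt_volDensity_fst {p : Form3 × (E7 →L[ℝ] Form3)} (hp : IsPositive p.1) :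
    ContDiffAt ℝ ∞ (fun q : Form3 × (E7 →L[ℝ] Form3) => volDensity q.1) p :=
  contDiffAt_comp_fst (contDiffAt_volDensity hp)

lemma contDiffAt_dirichletDensity {p : Form3 × (E7 →L[ℝ] Form3)} (hp : IsPositive p.1) :
    ContDiffAt ℝ ∞ dirichletDensity p :=
  (contDiffAt_const.mul (contDiffAt_torsionJet hp)).mul (contDiffAt_volDensity_fst hp)

end Manifold

section Manifold

variable {M : Type*} [TopologicalSpace M] [ChartedSpace E7 M]
  [CompactSpace M] [T2Space M] [IsManifold 𝓘(ℝ, E7) ∞ M]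

/-! ### Variation of the Dirichlet energy -/

/-- Positivity is open, and the chart supports are compact and finite in number, so one bound on `s`
serves all points. -/
lemma eventually_isChartPositive {Ω η : ThreeForm M} (hΩ : IsSmooth Ω) (hη : IsSmooth η)
    (hpos : IsChartPositive Ω) : ∀ᶠ s : ℝ in 𝓝 0, IsChartPositive (Ω + s • η) := by
  refine (Filter.eventually_all_finset _).2 fun p hp => ?_
  refine (isCompact_chartSupport p).eventually_forall_of_forall_eventually fun y hy => ?_
  have hy' := chartSupport_subset p hy
  have he := chart_mem_atlas E7 p
  have h1 := (contDiffOn_inChart_line hΩ hη he univ).continuousOn.continuousAt (x := (0, y))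
    ((isOpen_univ.prod (chartAt E7 p).open_target).mem_nhds ⟨mem_univ _, hy'⟩)
  refine h1.eventually (eventually_isPositive ?_)
  simpa using hpos p hp y hy

lemma hasDerivAt_dirichlet_line {Ω η : ThreeForm M} (hΩ : IsSmooth Ω) (hη : IsSmooth η)
    (hpos : IsChartPositive Ω) :
    HasDerivAt (fun s : ℝ => dirichlet (Ω + s • η)) (jetVariation dirichletDensity Ω η) 0 := by
  -- `dirichlet` is identified with the jet integral only at chart-positive forms, hence the
  -- restriction to a small ball of parameters.
  obtain ⟨ε, hε, h⟩ := Metric.eventually_nhds_iff_ball.1 (eventually_isChartPositive hΩ hη hpos)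
  have h0 : (0 : ℝ) ∈ Metric.ball (0 : ℝ) ε := Metric.mem_ball_self hε
  have h1 := hasDerivWithinAt_jetIntegral (I := Metric.ball (0 : ℝ) ε) (convex_ball 0 ε)
    (by rw [Metric.isOpen_ball.interior_eq]; exact ⟨0, h0⟩) (Ω := fun s => Ω + s • η)
    (V := fun _ => η) (fun e he => contDiffOn_inChart_line hΩ hη he _)
    (fun e _ t _ y _ => by
      have h2 : HasDerivAt (fun s : ℝ => inChart e Ω y + s • inChart e η y)
          ((1 : ℝ) • inChart e η y) t := ((hasDerivAt_id t).smul_const _).const_add _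
      rw [one_smul] at h2
      exact h2.hasDerivWithinAt)
    (fun _ => contDiffAt_dirichletDensity) h h0
  have h3 := (h1.congr (fun s hs => dirichlet_eq (hΩ.add_smul hη s) (h s hs))
    (dirichlet_eq (hΩ.add_smul hη 0) (h 0 h0))).hasDerivAt (Metric.ball_mem_nhds 0 hε)
  simpa using h3

/-- The Dirichlet energy is homogeneous of degree `5/3`. -/
lemma dirichlet_cube_smul {Ω : ThreeForm M} (hΩ : IsSmooth Ω) (hpos : IsChartPositive Ω) {r : ℝ}
    (hr : 0 < r) : dirichlet (r ^ 3 • Ω) = r ^ 5 * dirichlet Ω := by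
  have hs : IsSmooth (r ^ 3 • Ω) := fun e he => (hΩ e he).const_smul (r ^ 3)
  rw [dirichlet_eq hs fun p hp y hy => isPositive_cube_smul (hpos p hp y hy) hr,
    dirichlet_eq hΩ hpos, jetIntegral, jetIntegral, Finset.mul_sum]
  refine Finset.sum_congr rfl fun p hp => ?_
  rw [← integral_const_mul]
  refine setIntegral_congr_fun (isCompact_chartSupport p).measurableSet fun y hy => ?_
  have hd : DifferentiableAt ℝ (inChart (chartAt E7 p) Ω) y :=
    ((hΩ _ (chart_mem_atlas E7 p)).contDiffAt ((chartAt E7 p).open_target.mem_nhds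
      (chartSupport_subset p hy))).differentiableAt (by simp)
  have h1 : fderiv ℝ (inChart (chartAt E7 p) (r ^ 3 • Ω)) y
      = r ^ 3 • fderiv ℝ (inChart (chartAt E7 p) Ω) y := (hd.hasFDerivAt.const_smul (r ^ 3)).fderiv
  simp only [h1, inChart_smul, dirichletDensity, torsionJet_cube_smul (hpos p hp y hy) _ hr,
    volDensity_cube_smul _ hr]
  field_simp

/-- Euler's formula for the Dirichlet energy. -/
lemma jetVariation_dirichletDensity_self {Ω : ThreeForm M} (hΩ : IsSmooth Ω)
    (hpos : IsChartPositive Ω) :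
    jetVariation dirichletDensity Ω Ω = 5 / 3 * dirichlet Ω := by
  -- With `s = (1 + u)³ - 1` the line `Ω + sΩ` becomes `(1 + u)³ Ω`. Comparing derivatives at `u =
  -- 0` gives `3 D𝒟(Ω) = 5 𝒟(Ω)`.
  have h1 : HasDerivAt (fun u : ℝ => (1 + u) ^ 3 - 1) 3 0 := by
    simpa using (((hasDerivAt_id (0 : ℝ)).const_add 1).pow 3).sub_const 1
  have h2 : HasDerivAt (fun u : ℝ => dirichlet (Ω + ((1 + u) ^ 3 - 1) • Ω))
      (jetVariation dirichletDensity Ω Ω * 3) 0 :=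
    HasDerivAt.comp (h₂ := fun s : ℝ => dirichlet (Ω + s • Ω)) 0
      (by simpa using hasDerivAt_dirichlet_line hΩ hΩ hpos) h1
  have h3 : HasDerivAt (fun u : ℝ => (1 + u) ^ 5 * dirichlet Ω) (5 * dirichlet Ω) 0 := by
    simpa using (((hasDerivAt_id (0 : ℝ)).const_add 1).pow 5).mul_const (dirichlet Ω)
  have h4 : (fun u : ℝ => dirichlet (Ω + ((1 + u) ^ 3 - 1) • Ω))
      =ᶠ[𝓝 0] fun u => (1 + u) ^ 5 * dirichlet Ω := by
    filter_upwards [lt_mem_nhds (show (-1 : ℝ) < 0 by norm_num)] with u hu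
    rw [← dirichlet_cube_smul hΩ hpos (show 0 < 1 + u by linarith)]
    congr 1
    ext x v
    change Ω x v + ((1 + u) ^ 3 - 1) * Ω x v = (1 + u) ^ 3 * Ω x v
    ring
  have h5 := h2.unique (h3.congr_of_eventuallyEq h4)
  linarith

/-! ### Vanishing of the Dirichlet energy -/

lemma dirichletDensity_nonneg {q : Form3 × (E7 →L[ℝ] Form3)} (hq : IsPositive q.1) :
    0 ≤ dirichletDensity q :=
  mul_nonneg (mul_nonneg (by norm_num) (torsionJet_nonneg hq _)) (Real.sqrt_nonneg _)

lemma dirichlet_nonneg {Ω : ThreeForm M} (hΩ : IsSmooth Ω) (hpos : IsChartPositive Ω) :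
    0 ≤ dirichlet Ω := by
  rw [dirichlet_eq hΩ hpos]
  exact Finset.sum_nonneg fun p hp => setIntegral_nonneg (isCompact_chartSupport p).measurableSet
    fun y hy => mul_nonneg (weight_nonneg p y) (dirichletDensity_nonneg (hpos p hp y hy))

/-- A sum of integrals of nonnegative continuous functions vanishes only if each integrand does;
where the weight and the volume density are positive, the torsion must be zero. -/
lemma torsionJet_eq_zero_of_dirichlet_eq_zero {Ω : ThreeForm M} (hΩ : IsSmooth Ω)
    (hpos : IsChartPositive Ω) (h0 : dirichlet Ω = 0) {p : M} (hp : p ∈ active M) {y : E7}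
    (hy : y ∈ (chartAt E7 p).target) (hw : 0 < weight p y) :
    torsionJet (inChart (chartAt E7 p) Ω y) (fderiv ℝ (inChart (chartAt E7 p) Ω) y) = 0 := by
  set e := chartAt E7 p with he
  set f : E7 → ℝ := fun y => weight p y * dirichletDensity (inChart e Ω y, fderiv ℝ (inChart e Ω) y)
    with hf
  -- An open set is needed to pass from vanishing almost everywhere to vanishing at the given point.
  set V : Set E7 := e.target ∩ weight p ⁻¹' Ioi 0 with hV
  have hKm := (isCompact_chartSupport p).measurableSet
  have hVK : V ⊆ chartSupport p := fun z hz => by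
    by_contra h
    exact (ne_of_gt hz.2) (weight_eq_zero ⟨hz.1, h⟩)
  have hVo : IsOpen V := (continuousOn_weight p).isOpen_inter_preimage e.open_target isOpen_Ioi
  have hpV : ∀ z ∈ V, IsPositive (inChart e Ω z) := fun z hz => hpos p hp z (hVK hz)
  have hfK : ContinuousOn f (chartSupport p) := by
    have hsm := (hΩ e (chart_mem_atlas E7 p))
    refine ((continuousOn_weight p).mono (chartSupport_subset p)).mul fun z hz => ?_
    have hz' := e.open_target.mem_nhds (chartSupport_subset p hz)
    have h1 := (hsm.contDiffAt hz')
    have h2 := (h1.fderiv_right (m := 0) (by simp)).continuousAt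
    exact ((contDiffAt_dirichletDensity (p := (_, _)) (hpos p hp z hz)).continuousAt.comp
      (f := fun z => (inChart e Ω z, fderiv ℝ (inChart e Ω) z))
      (h1.continuousAt.prodMk h2)).continuousWithinAt
  have hint : ∫ z in chartSupport p, f z = 0 := by
    rw [dirichlet_eq hΩ hpos, jetIntegral, Finset.sum_eq_zero_iff_of_nonneg] at h0
    · exact h0 p hp
    · exact fun p hp => setIntegral_nonneg (isCompact_chartSupport p).measurableSet
        fun y hy => mul_nonneg (weight_nonneg p y) (dirichletDensity_nonneg (hpos p hp y hy))
  have h1 : f =ᵐ[volume.restrict (chartSupport p)] 0 := by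
    refine (setIntegral_eq_zero_iff_of_nonneg_ae ?_
      (hfK.integrableOn_compact (isCompact_chartSupport p))).1 hint
    exact (ae_restrict_iff' hKm).2 (Filter.Eventually.of_forall fun z hz =>
      mul_nonneg (weight_nonneg p z) (dirichletDensity_nonneg (hpos p hp z hz)))
  have h2 : f =ᵐ[volume.restrict V] 0 := ae_restrict_of_ae_restrict_of_subset hVK h1
  have h3 : f y = 0 := Measure.eqOn_open_of_ae_eq h2 hVo (hfK.mono hVK) continuousOn_const
    ⟨hy, hw⟩
  have h4 := volDensity_pos (hpV y ⟨hy, hw⟩)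
  have h5 := (mul_eq_zero.1 h3).resolve_left hw.ne'
  rw [dirichletDensity, mul_eq_zero, mul_eq_zero] at h5
  rcases h5 with (h5 | h5) | h5
  · norm_num at h5
  · exact h5
  · exact absurd h5 h4.ne'

/-- The Dirichlet energy vanishes exactly at the torsion-free forms. -/
lemma dirichlet_eq_zero_iff {Ω : ThreeForm M} (hΩ : IsSmooth Ω) (hpos : ∀ x, IsPositive (Ω x)) :
    dirichlet Ω = 0 ↔ IsTorsionFree Ω := by
  have hpos' := isChartPositive_of_isPositive hpos
  constructor
  · intro h0 e he y hy i I
    -- Some partition function is positive at this point. The torsion vanishes there in the chart at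
    -- `p`, and naturality carries this to the given chart `e`.
    obtain ⟨p, hp⟩ := (partition M).exists_pos_of_mem (mem_univ (e.symm y))
    have hx : e.symm y ∈ (chartAt E7 p).source :=
      partition_isSubordinate M p (subset_tsupport _ hp.ne')
    have hpa : p ∈ active M := (finite_active M).mem_toFinset.2 ⟨_, hp.ne'⟩
    have hyp := (chartAt E7 p).map_source hx
    have h1 := torsionJet_eq_zero_of_dirichlet_eq_zero hΩ hpos' h0 hpa hyp
      (by rwa [weight, (chartAt E7 p).left_inv hx])
    have hc := chart_mem_atlas E7 p
    have h2 := (torsionJet_eq_zero_iff (isPositive_inChart hc hyp (hpos _)) _).1 h1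
    rw [nabla_inChart hΩ hpos he hy, nablaJet_inChart_eq_zero he hc hy hx hΩ hpos h2 i]
    rfl
  · intro h
    rw [dirichlet_eq hΩ hpos', jetIntegral]
    refine Finset.sum_eq_zero fun p hp => ?_
    refine setIntegral_eq_zero_of_forall_eq_zero fun y hy => ?_
    have hc := chart_mem_atlas E7 p
    have hy' := chartSupport_subset p hy
    rw [dirichletDensity, (torsionJet_eq_zero_iff (hpos' p hp y hy) _).2 fun i => ?_]
    · simp
    · refine form_eq_zero_of_comps (funext fun I => ?_)
      rw [← nabla_inChart hΩ hpos hc hy']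
      exact h _ hc y hy' i I

end Manifold

/-! ### The flow -/

lemma convex_timeInterval (T : EReal) : Convex ℝ (timeInterval T) :=
  OrdConnected.convex ⟨fun _ ha _ hb _ hc =>
    ⟨ha.1.trans hc.1, (EReal.coe_le_coe_iff.2 hc.2).trans_lt hb.2⟩⟩

lemma interior_timeInterval_nonempty {T : EReal} (hT : 0 < T) :
    (interior (timeInterval T)).Nonempty := by
  obtain ⟨b, hb, hbT⟩ := EReal.lt_iff_exists_real_btwn.1 hT
  have hb' : 0 < b := EReal.coe_pos.1 hb
  refine ⟨b / 2, mem_interior_iff_mem_nhds.2 (Filter.mem_of_superset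
    (Ioo_mem_nhds (half_pos hb') (half_lt_self hb')) fun t ht => ⟨ht.1.le, ?_⟩)⟩
  exact (EReal.coe_lt_coe_iff.2 ht.2).trans hbT

section Manifold

variable {M : Type*} [TopologicalSpace M] [ChartedSpace E7 M]
  [CompactSpace M] [T2Space M] [IsManifold 𝓘(ℝ, E7) ∞ M] {T : EReal} {Ω : ℝ → ThreeForm M}

namespace IsDirichletFlow

lemma isSmooth (h : IsDirichletFlow T Ω) {t : ℝ} (ht : t ∈ timeInterval T) : IsSmooth (Ω t) :=
  fun e he => (h.smooth e he).comp (f := fun y => (t, y)) (by fun_prop) fun _ hy => ⟨ht, hy⟩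

lemma isChartPositive (h : IsDirichletFlow T Ω) {t : ℝ} (ht : t ∈ timeInterval T) :
    IsChartPositive (Ω t) :=
  isChartPositive_of_isPositive (h.positive t ht)

/-- Joint smoothness supplies a time derivative in the space of forms; evaluating it on vectors
identifies it with `Q`, by uniqueness of one-sided derivatives on `[0, T)`. -/
lemma hasDerivWithinAt_inChart (h : IsDirichletFlow T Ω) (hT : 0 < T) {Q : ThreeForm M} {t : ℝ}
    (ht : t ∈ timeInterval T)
    (hQ : ∀ x v, HasDerivWithinAt (fun s => Ω s x v) (Q x v) (timeInterval T) t)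
    {e : OpenPartialHomeomorph M E7} (he : e ∈ atlas E7 M) {y : E7} (hy : y ∈ e.target) :
    HasDerivWithinAt (fun s => inChart e (Ω s) y) (inChart e Q y) (timeInterval T) t := by
  have h1 := hasDerivWithinAt_slice (W := fun s y => inChart e (Ω s) y) hy
    ((h.smooth e he).differentiableOn (by simp) (t, y) ⟨ht, hy⟩).hasFDerivWithinAt
  refine h1.congr_deriv ?_
  have hu := uniqueDiffOn_convex (convex_timeInterval T) (interior_timeInterval_nonempty hT) t ht
  refine ContinuousAlternatingMap.ext fun v => ?_
  refine hu.eq_deriv _ ?_ (hQ (e.symm y) fun a => symmDeriv e y (v a))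
  exact (ContinuousAlternatingMap.apply ℝ E7 ℝ v).hasFDerivAt.comp_hasDerivWithinAt t h1

/-- Along the flow, `dℋ/dt = -5/9 𝒟`. -/
lemma hasDerivWithinAt_hitchin (h : IsDirichletFlow T Ω) (hT : 0 < T) {t : ℝ}
    (ht : t ∈ timeInterval T) :
    HasDerivWithinAt (fun s => hitchin (Ω s)) (-(5 / 9) * dirichlet (Ω t)) (timeInterval T) t := by
  choose! Q hQ using h.flow
  have h1 := hasDerivWithinAt_jetIntegral (convex_timeInterval T)
    (interior_timeInterval_nonempty hT) h.smooth
    (fun e he s hs y hy => h.hasDerivWithinAt_inChart hT hs (hQ s hs).2 he hy)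
    (fun _ => contDiffAt_comp_fst ∘ contDiffAt_volDensity) (fun s hs => h.isChartPositive hs) ht
  have hs := h.isSmooth ht
  have hp := h.isChartPositive ht
  -- Testing the gradient against `Ω` itself gives `-⟨Q, Ω⟩ = 5/3 𝒟`; the variation of the volume
  -- contributes the factor `1/3`.
  have h2 := ((hQ t ht).1.2 (Ω t) hs).unique (hasDerivAt_dirichlet_line hs hs hp)
  rw [jetVariation_dirichletDensity_self hs hp] at h2
  rw [jetVariation_volDensity hp, l2Inner_comm] at h1
  simp only [hitchin_eq] at h1 ⊢
  refine h1.congr_deriv ?_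
  linarith

/-- Along the flow, `d𝒟/dt = -‖Q‖²`. -/
lemma hasDerivWithinAt_dirichlet (h : IsDirichletFlow T Ω) (hT : 0 < T) {Q : ℝ → ThreeForm M}
    (hQ : ∀ t ∈ timeInterval T, IsNegGradient (Ω t) (Q t) ∧
      ∀ x v, HasDerivWithinAt (fun s => Ω s x v) (Q t x v) (timeInterval T) t)
    {t : ℝ} (ht : t ∈ timeInterval T) :
    HasDerivWithinAt (fun s => dirichlet (Ω s)) (-l2Inner (Ω t) (Q t) (Q t))
      (timeInterval T) t := by
  have h1 := hasDerivWithinAt_jetIntegral (convex_timeInterval T)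
    (interior_timeInterval_nonempty hT) h.smooth
    (fun e he s hs y hy => h.hasDerivWithinAt_inChart hT hs (hQ s hs).2 he hy)
    (fun _ => contDiffAt_dirichletDensity) (fun s hs => h.isChartPositive hs) ht
  have hs := h.isSmooth ht
  have hp := h.isChartPositive ht
  have hQt := (hQ t ht).1
  -- Testing the gradient against `Q`: the derivatives along the flow and along the line `Ω + sQ`
  -- are the same `jetVariation`.
  rw [(hQt.2 (Q t) hQt.1).unique (hasDerivAt_dirichlet_line hs hQt.1 hp)]
  exact h1.congr (fun s hs => dirichlet_eq (h.isSmooth hs) (h.isChartPositive hs))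
    (dirichlet_eq hs hp)

end IsDirichletFlow

end Manifold

end

end G2Flow

/-! ### Monotonicity and convexity of the Hitchin functional -/

theorem proposition2p3 {M : Type*} [TopologicalSpace M] [ChartedSpace G2Flow.E7 M]
    [CompactSpace M] [T2Space M] [IsManifold 𝓘(ℝ, G2Flow.E7) ∞ M]
    (T : EReal) (hT : 0 < T) (Ω : ℝ → G2Flow.ThreeForm M) (hΩ : G2Flow.IsDirichletFlow T Ω) :
    (∀ t ∈ G2Flow.timeInterval T,
      HasDerivWithinAt (fun s => G2Flow.hitchin (Ω s)) (-(5 / 9) * G2Flow.dirichlet (Ω t))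
          (G2Flow.timeInterval T) t ∧
        derivWithin (fun s => G2Flow.hitchin (Ω s)) (G2Flow.timeInterval T) t ≤ 0 ∧
        DifferentiableWithinAt ℝ
          (derivWithin (fun s => G2Flow.hitchin (Ω s)) (G2Flow.timeInterval T))
          (G2Flow.timeInterval T) t ∧
        0 ≤ derivWithin (derivWithin (fun s => G2Flow.hitchin (Ω s)) (G2Flow.timeInterval T))
          (G2Flow.timeInterval T) t ∧
        (derivWithin (fun s => G2Flow.hitchin (Ω s)) (G2Flow.timeInterval T) t = 0 ↔
          G2Flow.IsTorsionFree (Ω t))) ∧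
      AntitoneOn (fun s => G2Flow.hitchin (Ω s)) (G2Flow.timeInterval T) ∧
      ConvexOn ℝ (G2Flow.timeInterval T) (fun s => G2Flow.hitchin (Ω s)) := by
  have hc := G2Flow.convex_timeInterval T
  have hu := uniqueDiffOn_convex hc (G2Flow.interior_timeInterval_nonempty hT)
  have hH := fun t (ht : t ∈ G2Flow.timeInterval T) => hΩ.hasDerivWithinAt_hitchin hT ht
  choose! Q hQ using hΩ.flow
  have hD := fun t (ht : t ∈ G2Flow.timeInterval T) =>
    (hΩ.hasDerivWithinAt_dirichlet hT hQ ht).const_mul (-(5 / 9))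
  have hQ0 := fun t (ht : t ∈ G2Flow.timeInterval T) =>
    G2Flow.l2Inner_self_nonneg (hΩ.isChartPositive ht) (Q t)
  have hD0 := fun t (ht : t ∈ G2Flow.timeInterval T) =>
    G2Flow.dirichlet_nonneg (hΩ.isSmooth ht) (hΩ.isChartPositive ht)
  have hH' : EqOn (derivWithin (fun s => G2Flow.hitchin (Ω s)) (G2Flow.timeInterval T))
      (fun t => -(5 / 9) * G2Flow.dirichlet (Ω t)) (G2Flow.timeInterval T) :=
    fun t ht => (hH t ht).derivWithin (hu t ht)
  -- The second derivative is `-5/9 · (-‖Q‖²)`.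
  have hH'' := fun t (ht : t ∈ G2Flow.timeInterval T) => (hD t ht).congr hH' (hH' ht)
  have hcont : ContinuousOn (fun s => G2Flow.hitchin (Ω s)) (G2Flow.timeInterval T) :=
    fun t ht => (hH t ht).continuousWithinAt
  refine ⟨fun t ht => ⟨hH t ht, ?_, (hH'' t ht).differentiableWithinAt, ?_, ?_⟩, ?_, ?_⟩
  · rw [hH' ht]
    linarith [hD0 t ht]
  · rw [(hH'' t ht).derivWithin (hu t ht)]
    linarith [hQ0 t ht]
  · rw [hH' ht, ← G2Flow.dirichlet_eq_zero_iff (hΩ.isSmooth ht) (hΩ.positive t ht)]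
    norm_num
  · refine antitoneOn_of_hasDerivWithinAt_nonpos hc hcont
      (fun t ht => (hH t (interior_subset ht)).mono interior_subset) fun t ht => ?_
    linarith [hD0 t (interior_subset ht)]
  · refine convexOn_of_hasDerivWithinAt2_nonneg hc hcont
      (fun t ht => (hH t (interior_subset ht)).mono interior_subset)
      (fun t ht => (hD t (interior_subset ht)).mono interior_subset) fun t ht => ?_
    linarith [hQ0 t (interior_subset ht)]
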